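/- **Conventions.** A *$b$-bit rational* is a pair $(\alpha,\beta)$ of an integer $\alpha$ and a natural number $\beta$ with $|\alpha|<\beta\le 2^b$; its value is $\alpha/\beta$. Consider the following computational problems. Polynomials have rational coefficients and are given by their coefficients; "of degree $d$" means of degree at most $d$ except for monic polynomials. Input rationals are given as the pair $(\alpha,\beta)$ in binary; an output rational may be returned as any fraction with that value. * $\mathbf{MatPow}(m,d,b,k)$: given an $m\times m$ matrix $A$ of polynomials in $x$ of degree $d$ whose coefficients are $b$-bit rationals and whose entries have constant terms of magnitude at most $(3m)^{-1}$, compute $\sum_{i=0}^{k}(xA)^i$. * $\mathbf{DetPoly}(m,d,b)$: given an $m\times m$ matrix of univariate polynomials of degree $d$ with $b$-bit rational coefficients, compute its determinant (a polynomial). * $\mathbf{Interpolate}(d,b)$: given the values of a univariate polynomial of degree $d$ at $d+1$ distinct points, where the points and the values are $b$-bit rationals, compute the coefficients of the polynomial (arbitrary rationals, not necessarily smaller than one). * $\mathbf{Div}(m,m',b)$: given monic univariate polynomials $g$ of degree $m$ and $f$ of degree $m'$ whose other coefficients are $b$-bit rationals, compute the quotient of $g$ on division by $f$. A family of problems $(P_n)_n$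 *$\mathsf{AC}^0$-reduces to the conjunction* of families $(Q^1_n)_n,\dots,(Q^r_n)_n$ if for every $n$ the problem $P_n$ is solved by circuits of constant depth and of size polynomial in $n$, with unbounded fan-in $\wedge,\vee$-gates, $\neg$-gates, and oracle gates for $Q^1_n,\dots,Q^r_n$ (each with output length polynomial in $n$; the circuits must be correct whatever correct answers the oracle gates return). The circuits are uniform, i.e. given by a fixed $\mathsf{FO}(\le,+,\times)$ formula with oracles over a universe of size polynomial in $n$, in which $n$ and the parameters of the problems are available as numerical constants. **Statement.** Let $l,d,b,k$ be functions of $n$ with values in $\mathbb N$ such that $$l=O\!\left(\frac{\log n}{\log\log n}\right),\qquad k=O(\log n),\qquad b=\log^{O(1)}n,\qquad d\le\log^{O(1)}n ,$$ where $b = \log^{O(1)} n$ is only an upper bound. Then $\mathbf{MatPow}(l,d,b,k)$ $\mathsf{AC}^0$-reduces to the conjunction of $$\mathbf{MatPow}(l,0,lb,l),\quad \mathbf{DetPoly}(l,1,lb+2k^2d),\quad \mathbf{Interpolate}(dk,\;kl^2b+k^3ld),\quad \mathbf{Div}(k,l,\;l^2b+2k^2ld).$$ -/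

import Mathlib

open Polynomial Asymptotics Filter

namespace ACZero

/-- A finite string of bits, presented as a relation on the natural numbers, as is usual for inputs
of first-order formulas. The five coordinates of a bit are `(tag, i, j, m, t)`: the triple
`(i, j, m)` names a cell that holds one fraction, and `tag` and `t` name a bit of that fraction,
see `Stores`. -/
abbrev Word : Type := (Fin 5 → ℕ) → Prop

/-- The cell `(i, j, m)` of `w` holds the fraction `q.1 / q.2`: tag `0` is the sign, tag `1` the
binary expansion of the absolute value of the numerator, tag `2` that of the denominator. -/
def Stores (w : Word) (i j m : ℕ) (q : ℤ × ℕ) : Prop :=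
  (w ![0, i, j, m, 0] ↔ q.1 < 0) ∧
  (∀ t : ℕ, w ![1, i, j, m, t] ↔ q.1.natAbs.testBit t = true) ∧
  (∀ t : ℕ, w ![2, i, j, m, t] ↔ q.2.testBit t = true)

/-- The cell `(i, j, m)` of `w` holds some fraction, not necessarily in lowest terms, whose value
is the rational number `r`. -/
def Represents (w : Word) (i j m : ℕ) (r : ℚ) : Prop :=
  ∃ q : ℤ × ℕ, 0 < q.2 ∧ r = (q.1 : ℚ) / (q.2 : ℚ) ∧ Stores w i j m q

/-- A `b`-bit rational: a pair of an integer and a natural number, `|num| < den ≤ 2 ^ b`. -/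
structure BitRat (b : ℕ) where
  num : ℤ
  den : ℕ
  abs_num_lt : |num| < (den : ℤ)
  den_le : den ≤ 2 ^ b

/-- The value of a `b`-bit rational. -/
def BitRat.val {b : ℕ} (q : BitRat b) : ℚ := (q.num : ℚ) / (q.den : ℚ)

/-- The pair that is written down for a `b`-bit rational. -/
def BitRat.pair {b : ℕ} (q : BitRat b) : ℤ × ℕ := (q.num, q.den)

/-- A computational (search) problem: the words that are codes of an instance, and the words that
are correct answers for it. -/
structure Problem where
  Instance : Type
  Code : Instance → Word → Prop
  Answer : Instance → Word → Prop

/-- The polynomial with the given list of `N` coefficients. -/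
noncomputable def polyOf {b N : ℕ} (c : Fin N → BitRat b) : ℚ[X] :=
  ∑ m : Fin N, C (c m).val * X ^ (m : ℕ)

/-- The matrix of polynomials of degree at most `d` with the given coefficients. -/
noncomputable def polyMatrix {n d b : ℕ} (A : Fin n → Fin n → Fin (d + 1) → BitRat b) :
    Matrix (Fin n) (Fin n) ℚ[X] :=
  Matrix.of fun i j => polyOf (A i j)

/-- `MatPow(n, d, b, k)`: given an `n × n` matrix `A` of polynomials in `x` of degree at most `d`
with `b`-bit rational coefficients, and constant terms of magnitude at most `1 / (3 n)`, compute
(the coefficients of the entries of) `∑_{i ≤ k} (x A) ^ i`. -/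
noncomputable def MatPow (n d b k : ℕ) : Problem where
  Instance := {A : Fin n → Fin n → Fin (d + 1) → BitRat b //
    ∀ i j, |((polyMatrix A i j).coeff 0)| ≤ 1 / (3 * (n : ℚ))}
  Code A w := ∀ (i j : Fin n) (m : Fin (d + 1)), Stores w i j m (A.1 i j m).pair
  Answer A w := ∀ (i j : Fin n) (m : ℕ), m ≤ k * (d + 1) →
    Represents w i j m
      (((∑ s ∈ Finset.range (k + 1), ((X : ℚ[X]) • polyMatrix A.1) ^ s) i j).coeff m)

/-- `DetPoly(n, d, b)`: compute (the coefficients of) the determinant of an `n × n` matrix of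
polynomials of degree at most `d` with `b`-bit rational coefficients. -/
noncomputable def DetPoly (n d b : ℕ) : Problem where
  Instance := Fin n → Fin n → Fin (d + 1) → BitRat b
  Code A w := ∀ (i j : Fin n) (m : Fin (d + 1)), Stores w i j m (A i j m).pair
  Answer A w := ∀ m : ℕ, m ≤ n * d → Represents w 0 0 m ((polyMatrix A).det.coeff m)

/-- `Interpolate(d, b)`: compute the coefficients (arbitrary rationals) of the polynomial of degree
at most `d` whose values at `d + 1` different points are given, the points and the values being
`b`-bit rationals. -/
noncomputable def Interpolate (d b : ℕ) : Problem where
  Instance := {z : (Fin (d + 1) → BitRat b) × (Fin (d + 1) → BitRat b) //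
    Function.Injective fun j => (z.1 j).val}
  Code z w := ∀ j : Fin (d + 1), Stores w 0 0 j (z.1.1 j).pair ∧ Stores w 1 0 j (z.1.2 j).pair
  Answer z w := ∃ p : ℚ[X], p.natDegree ≤ d ∧
    (∀ j : Fin (d + 1), p.eval (z.1.1 j).val = (z.1.2 j).val) ∧
    ∀ m : ℕ, m ≤ d → Represents w 0 0 m (p.coeff m)

/-- `Div(n, m, b)`: compute the quotient of `g` by `f`, where `g` is monic of degree `n`, `f` is
monic of degree `m`, and the other coefficients are `b`-bit rationals. -/
noncomputable def Div (n m b : ℕ) : Problem where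
  Instance := (Fin n → BitRat b) × (Fin m → BitRat b)
  Code z w := (∀ i : Fin n, Stores w 0 0 i (z.1 i).pair) ∧
    ∀ i : Fin m, Stores w 1 0 i (z.2 i).pair
  Answer z w := ∀ t : ℕ, t ≤ n →
    Represents w 0 0 t (((X ^ n + polyOf z.1) /ₘ (X ^ m + polyOf z.2)).coeff t)

/-- First-order formulas with `v` free variables over the built-in arithmetic relations
`=, ≤, +, ×, BIT`, with `s` numerical constants, an input relation, and `r` oracles. (`BIT` is
definable from `+` and `×`, so it does not change the class.)
`oracle i φ x`: the answer of oracle `i`, to the query whose bits are defined by `φ` in terms of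
five new variables, has a one at position `x`. -/
inductive Formula (s r : ℕ) : ℕ → Type
  | eq {v : ℕ} (x y : Fin v) : Formula s r v
  | le {v : ℕ} (x y : Fin v) : Formula s r v
  | add {v : ℕ} (x y z : Fin v) : Formula s r v
  | mul {v : ℕ} (x y z : Fin v) : Formula s r v
  | bit {v : ℕ} (x y : Fin v) : Formula s r v
  | const {v : ℕ} (c : Fin s) (x : Fin v) : Formula s r v
  | input {v : ℕ} (x : Fin 5 → Fin v) : Formula s r v
  | not {v : ℕ} (φ : Formula s r v) : Formula s r v
  | and {v : ℕ} (φ ψ : Formula s r v) : Formula s r v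
  | all {v : ℕ} (φ : Formula s r (v + 1)) : Formula s r v
  | oracle {v : ℕ} (i : Fin r) (φ : Formula s r (v + 5)) (x : Fin 5 → Fin v) : Formula s r v

/-- Truth of a formula in the universe `{0, …, N - 1}`, with numerical constants `c`, input `w`,
oracles `O`, and values `a` of the free variables. -/
def Formula.Holds {s r : ℕ} (N : ℕ) (c : Fin s → ℕ) (w : Word) (O : Fin r → Word → Word) :
    {v : ℕ} → Formula s r v → (Fin v → ℕ) → Prop
  | _, .eq x y, a => a x = a y
  | _, .le x y, a => a x ≤ a y
  | _, .add x y z, a => a x + a y = a z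
  | _, .mul x y z, a => a x * a y = a z
  | _, .bit x y, a => (a x).testBit (a y) = true
  | _, .const p x, a => a x = c p
  | _, .input x, a => w fun j => a (x j)
  | _, .not φ, a => ¬ φ.Holds N c w O a
  | _, .and φ ψ, a => φ.Holds N c w O a ∧ ψ.Holds N c w O a
  | _, .all φ, a => ∀ u : ℕ, u < N → φ.Holds N c w O (Fin.snoc a u)
  | _, .oracle i φ x, a =>
      O i (fun q => (∀ j, q j < N) ∧ φ.Holds N c w O (Fin.append a q)) fun j => a (x j)

/-- The word that a formula with five free variables defines in the universe `{0, …, N - 1}`. -/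
def Formula.output {s r : ℕ} (φ : Formula s r 5) (N : ℕ) (c : Fin s → ℕ) (w : Word)
    (O : Fin r → Word → Word) : Word :=
  fun q => (∀ j, q j < N) ∧ φ.Holds N c w O q

/-- `O` is an oracle for `P` with answers of size at most `N` in each coordinate: on every code of
an instance it returns some correct answer (on other words it is arbitrary). -/
def Problem.IsOracle (P : Problem) (N : ℕ) (O : Word → Word) : Prop :=
  (∀ (w : Word) (q : Fin 5 → ℕ), O w q → ∀ j, q j < N) ∧
  ∀ (a : P.Instance) (w : Word), P.Code a w → P.Answer a (O w)

/-- The family of problems `P n` is reducible, by uniform constant-depth oracle circuits of size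
polynomial in `n`, to the conjunction of the families `Q i n`. Uniform circuits are given in the
form of one first-order formula, over a universe of size polynomial in `n`, which knows the
numbers `c p n`. It has to be correct with every choice of oracles for the problems `Q i n`, whose
answers may be of any length polynomial in `n`. -/
def Reduces {s r : ℕ} (c : Fin s → ℕ → ℕ) (P : ℕ → Problem) (Q : Fin r → ℕ → Problem) : Prop :=
  ∀ e : ℕ, ∃ (f : ℕ) (φ : Formula s r 5), ∀ (n : ℕ) (O : Fin r → Word → Word),
    (∀ i, (Q i n).IsOracle ((n + 2) ^ e) (O i)) →
    ∀ (a : (P n).Instance) (w : Word), (P n).Code a w →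
      (P n).Answer a (φ.output ((n + 2) ^ f) (fun p => c p n) w O)

end ACZero

/-!
For parameters in this range the matrix power problem is itself first-order definable over a
universe of polynomial size, so that the formula which is constructed here is correct whatever the
oracles answer: it never queries them. Let `L` be the number of bits of `n`.

*Small numbers.* Over a universe of size `n ^ O(1)` one can quantify over strings of `O(L)` bits. A
loop of about `√L` steps with a state of `O(log L)` bits is definable by guessing its history, and
loops of `L ^ O(1)` steps are nested loops of this kind of constant depth (`Def.recur`). This gives
arithmetic, sums and products of length `L ^ O(1)` modulo numbers below `L ^ O(1)` (`DefZ`).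

*Long numbers.* A number with `L ^ O(1)` bits is handled through the predicate that defines its
bits (`Big`). Sums of such numbers are definable by a loop over carries (`Big.sum`). Products
(`Big.prod`) are first taken over about `√L` factors, as the value at `2` of a product of polynomials
with coefficients `0` and `1`. The coefficients of this product have `O(L)` bits, and can be guessed
from their residues modulo primes `q` below `L ^ O(1)`. The residues come from interpolation at all
elements of the prime field: the coefficient at `X ^ t` is `-∑ v, v ^ (q - 1 - t) f(v)`
(`coeff_eq_neg_sum_eval`). Given products, a long number can be computed from its residues by Chinese
remaindering (`Big.of_residues`). There are enough primes by Chebyshev's bound (`exists_moduli`).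

*Powers of a matrix modulo a small prime* (`DefZ.matrix_pow`). Here `l = O(log n / log log n)` enters:
a vector of `l` residues, and a polynomial of degree `l`, have `O(L)` bits and can be quantified over.
An entry of `M ^ e` is a coefficient of the power series `N / D` with `N = adj(1 - X M)_{ab}` and
`D = det(1 - X M)`. These polynomials need not be computed: any `N` and `D` of degree at most `l` with
`D(0) = 1` and with `N(z) = D(z) x_a` whenever `(1 - z M) x = e_b` have the same quotient
(`IsResolvent.mul_det_eq`), because the prime is larger than `3 l`. So they are guessed. The power
series is expanded as `N ∑_{j ≤ e} (1 - D) ^ j`, whose coefficient is again found by interpolation.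

*The matrix power problem.* Multiplied by the `k`-th power of the product of all denominators, the
coefficients of the output are integers with `L ^ O(1)` bits. Their residues modulo a small prime are
interpolated from sums of powers of matrices over the prime field (`cast_coeff_clearedSum`), and they
are reconstructed from these residues (`Big.clearedSum`).
-/

namespace ACZero

/-! ### Renaming of variables and definability over a fixed universe -/

/-- Renaming of the free variables of a formula. -/
def Formula.rename {s r : ℕ} : {v v' : ℕ} → (Fin v → Fin v') → Formula s r v → Formula s r v'
  | _, _, ρ, .eq x y => .eq (ρ x) (ρ y)
  | _, _, ρ, .le x y => .le (ρ x) (ρ y)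
  | _, _, ρ, .add x y z => .add (ρ x) (ρ y) (ρ z)
  | _, _, ρ, .mul x y z => .mul (ρ x) (ρ y) (ρ z)
  | _, _, ρ, .bit x y => .bit (ρ x) (ρ y)
  | _, _, ρ, .const c x => .const c (ρ x)
  | _, _, ρ, .input x => .input fun j => ρ (x j)
  | _, _, ρ, .not φ => .not (φ.rename ρ)
  | _, _, ρ, .and φ ψ => .and (φ.rename ρ) (ψ.rename ρ)
  | _, v', ρ, .all φ =>
      .all (φ.rename (Fin.snoc (α := fun _ => Fin (v' + 1)) (fun i => (ρ i).castSucc)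
          (Fin.last v')))
  | _, v', ρ, .oracle i φ x =>
      .oracle i (φ.rename (Fin.append (fun i => (ρ i).castAdd 5) (fun j => Fin.natAdd v' j)))
        fun j => ρ (x j)

theorem Formula.holds_rename {s r : ℕ} (N : ℕ) (c : Fin s → ℕ) (w : Word)
    (O : Fin r → Word → Word) {v : ℕ} (φ : Formula s r v) {v' : ℕ} (ρ : Fin v → Fin v')
    (a : Fin v' → ℕ) :
    (φ.rename ρ).Holds N c w O a ↔ φ.Holds N c w O fun i => a (ρ i) := by
  induction φ generalizing v' with
  | eq | le | add | mul | bit | const | input => simp [Formula.rename, Formula.Holds]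
  | not φ ih => simp [Formula.rename, Formula.Holds, ih]
  | and φ ψ ih₁ ih₂ => simp [Formula.rename, Formula.Holds, ih₁, ih₂]
  | all φ ih =>
    simp only [Formula.rename, Formula.Holds, ih]
    refine forall_congr' fun u => imp_congr_right fun _ => iff_of_eq (congrArg _ ?_)
    funext i
    refine Fin.lastCases ?_ (fun i => ?_) i <;> simp
  | oracle i φ x ih =>
    simp only [Formula.rename, Formula.Holds, ih]
    refine iff_of_eq (congrFun (congrArg _ ?_) _)
    funext q
    refine propext (and_congr_right fun _ => iff_of_eq (congrArg _ ?_))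
    funext i
    refine Fin.addCases (fun i => ?_) (fun i => ?_) i <;> simp

/-- A family of structures in which formulas are evaluated: for every point a universe size,
constants, an input word, and the values of `D` free variables. -/
structure Points (D : ℕ) where
  pt : Type
  top : pt → ℕ
  cst : pt → Fin 5 → ℕ
  word : pt → Word
  val : pt → Fin D → ℕ

namespace Points

variable {D D' : ℕ}

/-- One formula defines the predicate `P` at all points, whatever the oracles answer. -/
def Rep (S : Points D) (P : S.pt → Prop) : Prop :=
  ∃ φ : Formula 5 4 D, ∀ i O, φ.Holds (S.top i) (S.cst i) (S.word i) O (S.val i) ↔ P i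

/-- The points together with a value, in the universe, of one more variable. -/
def snoc (S : Points D) : Points (D + 1) where
  pt := (i : S.pt) × Fin (S.top i)
  top p := S.top p.1
  cst p := S.cst p.1
  word p := S.word p.1
  val p := Fin.snoc (S.val p.1) p.2.1

/-- One formula defines the graph of `g` at all points. -/
def RepG (S : Points D) (g : S.pt → ℕ) : Prop := S.snoc.Rep fun p => p.2.1 = g p.1

variable {S : Points D}

theorem Rep.congr {P Q : S.pt → Prop} (h : S.Rep P) (hPQ : ∀ i, P i ↔ Q i) : S.Rep Q :=
  let ⟨φ, hφ⟩ := h; ⟨φ, fun i O => (hφ i O).trans (hPQ i)⟩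

theorem Rep.not {P : S.pt → Prop} (h : S.Rep P) : S.Rep fun i => ¬ P i :=
  let ⟨φ, hφ⟩ := h; ⟨.not φ, fun i O => not_congr (hφ i O)⟩

theorem Rep.and {P Q : S.pt → Prop} (h : S.Rep P) (h' : S.Rep Q) : S.Rep fun i => P i ∧ Q i :=
  let ⟨φ, hφ⟩ := h; let ⟨ψ, hψ⟩ := h'; ⟨.and φ ψ, fun i O => and_congr (hφ i O) (hψ i O)⟩

theorem Rep.all {P : S.snoc.pt → Prop} (h : S.snoc.Rep P) :
    S.Rep fun i => ∀ u : Fin (S.top i), P ⟨i, u⟩ :=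
  let ⟨φ, hφ⟩ := h
  ⟨.all φ, fun i O => ⟨fun H u => (hφ ⟨i, u⟩ O).1 (H u u.2),
    fun H u hu => (hφ ⟨i, ⟨u, hu⟩⟩ O).2 (H ⟨u, hu⟩)⟩⟩

theorem Rep.ex {P : S.snoc.pt → Prop} (h : S.snoc.Rep P) :
    S.Rep fun i => ∃ u : Fin (S.top i), P ⟨i, u⟩ :=
  (h.not.all.not).congr fun i => by simp

/-- Definable predicates may be pulled back along maps that only forget or permute variables. -/
theorem Rep.pullback {S' : Points D'} (F : S'.pt → S.pt) (ρ : Fin D → Fin D')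
    (htop : ∀ i, S.top (F i) = S'.top i) (hcst : ∀ i, S.cst (F i) = S'.cst i)
    (hword : ∀ i, S.word (F i) = S'.word i) (hval : ∀ i j, S.val (F i) j = S'.val i (ρ j))
    {P : S.pt → Prop} (h : S.Rep P) : S'.Rep fun i => P (F i) := by
  obtain ⟨φ, hφ⟩ := h
  refine ⟨φ.rename ρ, fun i O => ?_⟩
  refine Iff.trans ?_ (hφ (F i) O)
  rw [Formula.holds_rename, htop, hcst, hword,
    show S.val (F i) = fun j => S'.val i (ρ j) from funext (hval i)]

theorem RepG.pullback {S' : Points D'} (F : S'.pt → S.pt) (ρ : Fin D → Fin D')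
    (htop : ∀ i, S.top (F i) = S'.top i) (hcst : ∀ i, S.cst (F i) = S'.cst i)
    (hword : ∀ i, S.word (F i) = S'.word i) (hval : ∀ i j, S.val (F i) j = S'.val i (ρ j))
    {g : S.pt → ℕ} (h : S.RepG g) : S'.RepG fun i => g (F i) :=
  Rep.pullback (S := S.snoc) (S' := S'.snoc) (fun p => ⟨F p.1, Fin.cast (htop p.1).symm p.2⟩)
    (Fin.snoc (α := fun _ => Fin (D' + 1)) (fun i => (ρ i).castSucc) (Fin.last D'))
    (fun p => htop p.1) (fun p => hcst p.1) (fun p => hword p.1)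
    (fun p j => by refine Fin.lastCases ?_ (fun j => ?_) j <;> simp [snoc, hval]) h

theorem RepG.weaken {g : S.pt → ℕ} (h : S.RepG g) : S.snoc.RepG fun p => g p.1 :=
  h.pullback (S' := S.snoc) (fun p => p.1) Fin.castSucc (fun _ => rfl) (fun _ => rfl)
    (fun _ => rfl) (fun p j => by simp [snoc])

theorem RepG.var (j : Fin D) : S.RepG fun i => S.val i j :=
  ⟨.eq (Fin.last D) j.castSucc, fun p O => by simp [Formula.Holds, snoc]⟩

theorem RepG.last : S.snoc.RepG fun p => p.2.1 := by
  have h := RepG.var (S := S.snoc) (Fin.last D)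
  simpa [snoc] using h

/-- Substitution of definable functions for the free variables of a formula. -/
theorem Rep.subst {v : ℕ} (φ : Formula 5 4 v) (g : Fin v → S.pt → ℕ) (hg : ∀ j, S.RepG (g j))
    (hlt : ∀ j i, g j i < S.top i) {P : S.pt → Prop}
    (hP : ∀ i O, φ.Holds (S.top i) (S.cst i) (S.word i) O (fun j => g j i) ↔ P i) : S.Rep P := by
  -- The variables are replaced one by one, the old variables being kept in front.
  suffices H : ∀ (v : ℕ) (φ : Formula 5 4 (D + v)) (g : Fin v → S.pt → ℕ),
      (∀ j, S.RepG (g j)) → (∀ j i, g j i < S.top i) →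
      ∃ ψ : Formula 5 4 D, ∀ i O, ψ.Holds (S.top i) (S.cst i) (S.word i) O (S.val i) ↔
        φ.Holds (S.top i) (S.cst i) (S.word i) O (Fin.append (S.val i) fun j => g j i) by
    obtain ⟨ψ, hψ⟩ := H v (φ.rename (Fin.natAdd D)) g hg hlt
    refine ⟨ψ, fun i O => (hψ i O).trans ?_⟩
    rw [Formula.holds_rename, ← hP i O]
    simp
  clear hP P hlt hg g φ v
  intro v
  induction v with
  | zero =>
    intro φ g _ _
    refine ⟨φ, fun i O => iff_of_eq (congrArg _ ?_)⟩
    funext j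
    exact (Fin.append_left (S.val i) (fun j => g j i) j).symm
  | succ v ih =>
    intro φ g hg hlt
    obtain ⟨χ, hχ⟩ := hg (Fin.last v)
    obtain ⟨ψ, hψ⟩ := ih (.not (.all (.not (.and
      (χ.rename (Fin.snoc (α := fun _ => Fin (D + v + 1)) (fun i => (i.castAdd v).castSucc)
        (Fin.last (D + v)))) φ))))
      (fun j => g j.castSucc) (fun j => hg _) (fun j => hlt _)
    refine ⟨ψ, fun i O => (hψ i O).trans ?_⟩
    have key : Fin.append (S.val i) (fun j => g j i) =
        Fin.snoc (α := fun _ => ℕ) (Fin.append (S.val i) fun j => g (Fin.castSucc j) i)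
            (g (Fin.last v) i) := by
      rw [← Fin.append_snoc]
      congr 1
      funext j
      refine Fin.lastCases ?_ (fun j => ?_) j <;> simp
    have hχ' : ∀ u (hu : u < S.top i), (χ.rename
        (Fin.snoc (α := fun _ => Fin (D + v + 1)) (fun i => (i.castAdd v).castSucc)
        (Fin.last (D + v)))).Holds (S.top i) (S.cst i) (S.word i) O
        (Fin.snoc (α := fun _ => ℕ) (Fin.append (S.val i) fun j => g (Fin.castSucc j) i) u) ↔
          u = g (Fin.last v) i := by
      intro u hu
      refine Iff.trans ?_ (hχ ⟨i, u, hu⟩ O)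
      rw [Formula.holds_rename]
      refine iff_of_eq (congrArg _ ?_)
      funext j
      refine Fin.lastCases ?_ (fun j => ?_) j <;> simp [snoc]
    simp only [Formula.Holds, not_forall, not_not]
    rw [key]
    constructor
    · rintro ⟨u, hu, h1, h2⟩
      rw [hχ' u hu] at h1
      rwa [← h1]
    · intro h
      exact ⟨_, hlt _ i, (hχ' _ (hlt _ i)).2 rfl, h⟩

end Points

/-! ### Definable functions on contexts -/

/-- A context: points that carry a size parameter, an input word, numerical constants, and the
values of `dim` number variables. -/
class Ctx (Γ : Type) where
  dim : ℕ
  size : Γ → ℕ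
  cst : Γ → Fin 5 → ℕ
  word : Γ → Word
  val : Γ → Fin dim → ℕ
  cst_zero : ∀ γ, cst γ 0 = size γ

/-- All number variables are bounded by the `e`-th power of the size. -/
def Ctx.Bounded (Γ : Type) [Ctx Γ] (e : ℕ) (γ : Γ) : Prop :=
  ∀ i, Ctx.val γ i < (Ctx.size γ + 2) ^ e

/-- The points of a context with variables bounded by the `e`-th power of the size, in the universe
whose size is the `f`-th power. -/
def Ctx.points (Γ : Type) [Ctx Γ] (e f : ℕ) : Points (Ctx.dim Γ) where
  pt := {γ : Γ // Ctx.Bounded Γ e γ}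
  top γ := (Ctx.size γ.1 + 2) ^ f
  cst γ := Ctx.cst γ.1
  word γ := Ctx.word γ.1
  val γ := Ctx.val γ.1

/-- The types that can be the target of a definable function. -/
class Target (α : Type) where
  IsDef : ∀ {Γ : Type} [Ctx Γ], (Γ → α) → Prop

/-- `f` is first-order definable, uniformly in all sufficiently large polynomial universes. For
`f` with values in `ℕ`, this includes that the values are polynomially bounded. -/
@[fun_prop]
def Def {Γ α : Type} [Ctx Γ] [Target α] (f : Γ → α) : Prop := Target.IsDef f

instance : Target Prop where
  IsDef {Γ} _ P := ∀ e, ∀ᶠ f in atTop, (Ctx.points Γ e f).Rep fun γ => P γ.1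

instance : Target ℕ where
  IsDef {Γ} _ g := ∀ e, (∃ e', ∀ γ : Γ, Ctx.Bounded Γ e γ → g γ < (Ctx.size γ + 2) ^ e') ∧
    ∀ᶠ f in atTop, (Ctx.points Γ e f).RepG fun γ => g γ.1

instance (Δ : Type) [Ctx Δ] : Target Δ where
  IsDef {Γ} _ h := (∀ γ : Γ, Ctx.size (h γ) = Ctx.size γ ∧ Ctx.cst (h γ) = Ctx.cst γ ∧
    Ctx.word (h γ) = Ctx.word γ) ∧ ∀ i, Def fun γ => Ctx.val (h γ) i

/-- The context with one more variable, whose value is less than `g`. -/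
structure Ext {Γ : Type} (g : Γ → ℕ) where
  fst : Γ
  idx : ℕ
  lt : idx < g fst

instance {Γ : Type} [Ctx Γ] (g : Γ → ℕ) : Ctx (Ext g) where
  dim := Ctx.dim Γ + 1
  size p := Ctx.size p.1
  cst p := Ctx.cst p.1
  word p := Ctx.word p.1
  val p := Fin.snoc (Ctx.val p.1) p.2
  cst_zero p := Ctx.cst_zero p.1

instance {Γ : Type} [Ctx Γ] (P : Γ → Prop) : Ctx (Subtype P) where
  dim := Ctx.dim Γ
  size p := Ctx.size p.1
  cst p := Ctx.cst p.1
  word p := Ctx.word p.1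
  val p := Ctx.val p.1
  cst_zero p := Ctx.cst_zero p.1

section

variable {Γ Δ : Type} [Ctx Γ] [Ctx Δ]

theorem pow_le_pow_size (n : ℕ) {e e' : ℕ} (h : e ≤ e') : (n + 2) ^ e ≤ (n + 2) ^ e' :=
  Nat.pow_le_pow_right (by omega) h

theorem def_prop_iff {P : Γ → Prop} :
    Def P ↔ ∀ e, ∀ᶠ f in atTop, (Ctx.points Γ e f).Rep fun γ => P γ.1 := Iff.rfl

theorem def_nat_iff {g : Γ → ℕ} :
    Def g ↔ ∀ e, (∃ e', ∀ γ : Γ, Ctx.Bounded Γ e γ → g γ < (Ctx.size γ + 2) ^ e') ∧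
      ∀ᶠ f in atTop, (Ctx.points Γ e f).RepG fun γ => g γ.1 := Iff.rfl

theorem def_ctx_iff {h : Γ → Δ} : Def h ↔ (∀ γ : Γ, Ctx.size (h γ) = Ctx.size γ ∧
    Ctx.cst (h γ) = Ctx.cst γ ∧ Ctx.word (h γ) = Ctx.word γ) ∧
      ∀ i, Def fun γ => Ctx.val (h γ) i := Iff.rfl

/-- A finite family of definable functions is bounded by a single power. -/
theorem Def.exists_bound {v : ℕ} {g : Fin v → Γ → ℕ} (hg : ∀ j, Def (g j)) (e : ℕ) :
    ∃ e', ∀ j, ∀ γ : Γ, Ctx.Bounded Γ e γ → g j γ < (Ctx.size γ + 2) ^ e' := by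
  choose b hb using fun j => (def_nat_iff.1 (hg j) e).1
  exact ⟨Finset.univ.sup b, fun j γ hγ => (hb j γ hγ).trans_le
    (pow_le_pow_size _ (Finset.le_sup (Finset.mem_univ j)))⟩

/-- Substitution of definable functions in an atomic formula. -/
theorem Def.of_formula {v : ℕ} (φ : Formula 5 4 v) {g : Fin v → Γ → ℕ} (hg : ∀ j, Def (g j))
    {P : Γ → Prop} (hP : ∀ f γ O, (∀ j, g j γ < (Ctx.size γ + 2) ^ f) →
      (φ.Holds ((Ctx.size γ + 2) ^ f) (Ctx.cst γ) (Ctx.word γ) O (fun j => g j γ) ↔ P γ)) :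
    Def P := by
  rw [def_prop_iff]
  intro e
  obtain ⟨b, hb⟩ := Def.exists_bound hg e
  have h := eventually_all.2 fun j => (def_nat_iff.1 (hg j) e).2
  filter_upwards [h, eventually_ge_atTop b] with f hf hbf
  have hlt : ∀ j (γ : (Ctx.points Γ e f).pt), g j γ.1 < (Ctx.size γ.1 + 2) ^ f := fun j γ =>
    (hb j γ.1 γ.2).trans_le (pow_le_pow_size _ hbf)
  exact Points.Rep.subst (S := Ctx.points Γ e f) φ (fun j γ => g j γ.1) hf hlt fun γ O =>
    hP f γ.1 O fun j => hlt j γ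

theorem Def.congr {α : Type} [Target α] {f g : Γ → α} (hf : Def f) (h : ∀ γ, g γ = f γ) :
    Def g := by
  rwa [funext h]

theorem Def.congr_iff {P Q : Γ → Prop} (hP : Def P) (h : ∀ γ, Q γ ↔ P γ) : Def Q :=
  hP.congr fun γ => propext (h γ)

@[fun_prop]
theorem Def.not {P : Γ → Prop} (hP : Def P) : Def fun γ => ¬ P γ :=
  fun e => (hP e).mono fun _ h => h.not

@[fun_prop]
theorem Def.and {P Q : Γ → Prop} (hP : Def P) (hQ : Def Q) : Def fun γ => P γ ∧ Q γ := fun e => by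
  filter_upwards [hP e, hQ e] with f h h' using h.and h'

@[fun_prop]
theorem Def.or {P Q : Γ → Prop} (hP : Def P) (hQ : Def Q) : Def fun γ => P γ ∨ Q γ :=
  (hP.not.and hQ.not).not.congr_iff fun γ => by tauto

theorem Def.imp {P Q : Γ → Prop} (hP : Def P) (hQ : Def Q) : Def fun γ => P γ → Q γ :=
  (hP.not.or hQ).congr_iff fun γ => by tauto

@[fun_prop]
theorem Def.iff {P Q : Γ → Prop} (hP : Def P) (hQ : Def Q) : Def fun γ => P γ ↔ Q γ :=
  ((hP.imp hQ).and (hQ.imp hP)).congr_iff fun γ => by tauto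

/-! Variables and maps between contexts. -/

theorem Def.val (i : Fin (Ctx.dim Γ)) : Def fun γ : Γ => Ctx.val γ i := fun e =>
  ⟨⟨e, fun _ hγ => hγ i⟩, Eventually.of_forall fun f =>
    Points.RepG.var (S := Ctx.points Γ e f) i⟩

@[fun_prop]
theorem Def.id : Def fun γ : Γ => γ :=
  def_ctx_iff.2 ⟨fun _ => ⟨rfl, rfl, rfl⟩, fun i => Def.val i⟩

theorem Def.comp_prop {P : Δ → Prop} {h : Γ → Δ} (hP : Def P) (hh : Def h) :
    Def fun γ => P (h γ) := by
  obtain ⟨hs, hv⟩ := hh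
  rw [def_prop_iff]
  intro e
  obtain ⟨b, hb⟩ := Def.exists_bound hv e
  have h1 := eventually_all.2 fun j => (def_nat_iff.1 (hv j) e).2
  filter_upwards [h1, eventually_ge_atTop b, def_prop_iff.1 hP b] with f hf hbf hPf
  obtain ⟨φ, hφ⟩ := hPf
  refine Points.Rep.subst (S := Ctx.points Γ e f) φ (fun j γ => Ctx.val (h γ.1) j) hf
    (fun j γ => (hb j γ.1 γ.2).trans_le (pow_le_pow_size _ hbf)) fun γ O => ?_
  have := hφ ⟨h γ.1, fun j => by rw [(hs γ.1).1]; exact hb j γ.1 γ.2⟩ O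
  simpa only [Ctx.points, (hs γ.1).1, (hs γ.1).2.1, (hs γ.1).2.2] using this

theorem Def.comp_nat {g : Δ → ℕ} {h : Γ → Δ} (hg : Def g) (hh : Def h) :
    Def fun γ => g (h γ) := by
  obtain ⟨hs, hv⟩ := hh
  rw [def_nat_iff]
  intro e
  obtain ⟨b, hb⟩ := Def.exists_bound hv e
  have hb' : ∀ γ, Ctx.Bounded Γ e γ → Ctx.Bounded Δ b (h γ) := fun γ hγ j => by
    rw [(hs γ).1]; exact hb j γ hγ
  obtain ⟨⟨b', hgb⟩, hg⟩ := def_nat_iff.1 hg b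
  refine ⟨⟨b', fun γ hγ => by rw [← (hs γ).1]; exact hgb _ (hb' γ hγ)⟩, ?_⟩
  have h1 := eventually_all.2 fun j => (def_nat_iff.1 (hv j) e).2
  filter_upwards [h1, eventually_ge_atTop b, hg] with f hf hbf hgf
  obtain ⟨φ, hφ⟩ := hgf
  refine Points.Rep.subst (S := (Ctx.points Γ e f).snoc) φ
    (Fin.snoc (α := fun _ => (Ctx.points Γ e f).snoc.pt → ℕ)
      (fun j p => Ctx.val (h p.1.1) j) fun p => p.2.1) (fun j => ?_) (fun j p => ?_) fun p O => ?_
  · refine Fin.lastCases ?_ (fun j => ?_) j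
    · simpa using Points.RepG.last
    · simpa using (hf j).weaken
  · refine Fin.lastCases ?_ (fun j => ?_) j
    · rw [Fin.snoc_last]
      exact p.2.2
    · simpa using! (hb j p.1.1 p.1.2).trans_le (pow_le_pow_size _ hbf)
  · have e1 := (hs p.1.1).1
    have := hφ ⟨⟨h p.1.1, hb' _ p.1.2⟩, ⟨p.2.1, by
      simp only [Ctx.points, e1]; exact p.2.2⟩⟩ O
    refine Iff.trans (iff_of_eq ?_) this
    simp only [Ctx.points, Points.snoc, e1, (hs p.1.1).2.1, (hs p.1.1).2.2]
    congr 1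
    funext j
    refine Fin.lastCases ?_ (fun j => ?_) j <;> simp

theorem Def.comp_ctx {Ε : Type} [Ctx Ε] {g : Δ → Ε} {h : Γ → Δ} (hg : Def g) (hh : Def h) :
    Def fun γ => g (h γ) := by
  refine def_ctx_iff.2 ⟨fun γ => ?_, fun i => ?_⟩
  · obtain ⟨a, b, c⟩ := hg.1 (h γ)
    obtain ⟨a', b', c'⟩ := hh.1 γ
    exact ⟨a.trans a', b.trans b', c.trans c'⟩
  · exact (hg.2 i).comp_nat hh

/-- Targets for which definability is stable under substitution. -/
class LawfulTarget (α : Type) extends Target α where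
  comp : ∀ {Γ Δ : Type} [Ctx Γ] [Ctx Δ] {f : Δ → α} {h : Γ → Δ}, Def f → Def h →
    Def fun γ => f (h γ)

instance : LawfulTarget Prop := ⟨Def.comp_prop⟩
instance : LawfulTarget ℕ := ⟨Def.comp_nat⟩
instance (Ε : Type) [Ctx Ε] : LawfulTarget Ε := ⟨Def.comp_ctx⟩

@[fun_prop]
theorem Def.comp {α : Type} [LawfulTarget α] {f : Δ → α} {h : Γ → Δ} (hf : Def f) (hh : Def h) :
    Def fun γ => f (h γ) := LawfulTarget.comp hf hh

@[fun_prop]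
theorem Def.fst' {g : Γ → ℕ} : Def fun p : Ext g => p.1 := by
  refine def_ctx_iff.2 ⟨fun _ => ⟨rfl, rfl, rfl⟩, fun i => ?_⟩
  exact (Def.val (Γ := Ext g) (Fin.castSucc i)).congr fun p =>
    (Fin.snoc_castSucc (α := fun _ => ℕ) p.2 (Ctx.val p.1) i).symm

@[fun_prop]
theorem Def.idx' {g : Γ → ℕ} : Def fun p : Ext g => p.2 :=
  (Def.val (Γ := Ext g) (Fin.last _)).congr fun p =>
    (Fin.snoc_last (α := fun _ => ℕ) p.2 (Ctx.val p.1)).symm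

@[fun_prop]
theorem Def.fst {g : Δ → ℕ} {h : Γ → Ext g} (hh : Def h) : Def fun γ => (h γ).1 :=
  Def.fst'.comp hh

@[fun_prop]
theorem Def.idx {g : Δ → ℕ} {h : Γ → Ext g} (hh : Def h) : Def fun γ => (h γ).2 :=
  Def.idx'.comp hh

@[fun_prop]
theorem Def.mk {g : Δ → ℕ} {h : Γ → Δ} {i : Γ → ℕ} (hh : Def h) (hi : Def i)
    (hlt : ∀ γ, i γ < g (h γ)) : Def fun γ => (⟨h γ, i γ, hlt γ⟩ : Ext g) := by
  refine def_ctx_iff.2 ⟨fun γ => hh.1 γ, fun j => ?_⟩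
  refine Fin.lastCases ?_ (fun j => ?_) j
  · exact hi.congr fun γ => Fin.snoc_last (α := fun _ => ℕ) _ _
  · exact (hh.2 j).congr fun γ => Fin.snoc_castSucc (α := fun _ => ℕ) _ _ _

@[fun_prop]
theorem Def.val' {P : Δ → Prop} {h : Γ → Subtype P} (hh : Def h) : Def fun γ => (h γ).1 :=
  ⟨hh.1, hh.2⟩

@[fun_prop]
theorem Def.subtype_mk {P : Δ → Prop} {h : Γ → Δ} (hh : Def h) (hP : ∀ γ, P (h γ)) :
    Def fun γ => (⟨h γ, hP γ⟩ : Subtype P) :=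
  ⟨hh.1, hh.2⟩

end

/-! ### Arithmetic and bounded quantification -/

section

variable {Γ Δ : Type} [Ctx Γ] [Ctx Δ]

theorem Def.of_formula_nat {v : ℕ} (φ : Formula 5 4 (v + 1)) {g : Fin v → Γ → ℕ}
    (hg : ∀ j, Def (g j)) {G : Γ → ℕ}
    (hb : ∀ e, ∃ e', ∀ γ : Γ, Ctx.Bounded Γ e γ → G γ < (Ctx.size γ + 2) ^ e')
    (hP : ∀ f (γ : Γ) O, (∀ j, g j γ < (Ctx.size γ + 2) ^ f) → ∀ u < (Ctx.size γ + 2) ^ f,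
      (φ.Holds ((Ctx.size γ + 2) ^ f) (Ctx.cst γ) (Ctx.word γ) O
        (Fin.snoc (α := fun _ => ℕ) (fun j => g j γ) u) ↔ u = G γ)) :
    Def G := by
  rw [def_nat_iff]
  intro e
  refine ⟨hb e, ?_⟩
  obtain ⟨b, hb⟩ := Def.exists_bound hg e
  have h := eventually_all.2 fun j => (def_nat_iff.1 (hg j) e).2
  filter_upwards [h, eventually_ge_atTop b] with f hf hbf
  have hlt : ∀ j (γ : (Ctx.points Γ e f).pt), g j γ.1 < (Ctx.size γ.1 + 2) ^ f := fun j γ =>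
    (hb j γ.1 γ.2).trans_le (pow_le_pow_size _ hbf)
  refine Points.Rep.subst (S := (Ctx.points Γ e f).snoc) φ
    (Fin.snoc (α := fun _ => (Ctx.points Γ e f).snoc.pt → ℕ) (fun j p => g j p.1.1) fun p => p.2.1)
    (fun j => ?_) (fun j p => ?_) fun p O => ?_
  · refine Fin.lastCases ?_ (fun j => ?_) j
    · simpa using Points.RepG.last
    · simpa using (hf j).weaken
  · refine Fin.lastCases ?_ (fun j => ?_) j
    · rw [Fin.snoc_last]
      exact p.2.2
    · rw [Fin.snoc_castSucc]
      exact hlt j p.1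
  · refine Iff.trans (iff_of_eq ?_) (hP f p.1.1 O (fun j => hlt j p.1) p.2.1 p.2.2)
    simp only [Ctx.points, Points.snoc]
    congr 1
    funext j
    refine Fin.lastCases ?_ (fun j => ?_) j <;> simp

theorem Def.bound₂ {f g : Γ → ℕ} (hf : Def f) (hg : Def g) (e : ℕ) : ∃ e', ∀ γ : Γ,
    Ctx.Bounded Γ e γ → f γ < (Ctx.size γ + 2) ^ e' ∧ g γ < (Ctx.size γ + 2) ^ e' := by
  obtain ⟨b, hb⟩ := (def_nat_iff.1 hf e).1
  obtain ⟨b', hb'⟩ := (def_nat_iff.1 hg e).1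
  exact ⟨max b b', fun γ hγ => ⟨(hb γ hγ).trans_le (pow_le_pow_size _ (le_max_left _ _)),
    (hb' γ hγ).trans_le (pow_le_pow_size _ (le_max_right _ _))⟩⟩

@[fun_prop]
theorem Def.add {f g : Γ → ℕ} (hf : Def f) (hg : Def g) : Def fun γ => f γ + g γ := by
  refine Def.of_formula_nat (g := ![f, g]) (.add 0 1 2) (Fin.forall_fin_two.2 ⟨hf, hg⟩)
    (fun e => ?_) fun f' γ O _ u hu => ?_
  · obtain ⟨b, hb⟩ := hf.bound₂ hg e
    refine ⟨b + 1, fun γ hγ => ?_⟩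
    have := hb γ hγ
    rw [pow_succ]
    nlinarith [Nat.zero_le (Ctx.size γ), Nat.zero_le ((Ctx.size γ + 2) ^ b * Ctx.size γ)]
  · exact eq_comm

@[fun_prop]
theorem Def.mul {f g : Γ → ℕ} (hf : Def f) (hg : Def g) : Def fun γ => f γ * g γ := by
  refine Def.of_formula_nat (g := ![f, g]) (.mul 0 1 2) (Fin.forall_fin_two.2 ⟨hf, hg⟩)
    (fun e => ?_) fun f' γ O _ u hu => ?_
  · obtain ⟨b, hb⟩ := hf.bound₂ hg e
    refine ⟨b + b, fun γ hγ => ?_⟩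
    have := hb γ hγ
    rw [pow_add]
    exact Nat.mul_lt_mul'' this.1 this.2
  · exact eq_comm

@[fun_prop]
theorem Def.const (c : ℕ) : Def fun _ : Γ => c := by
  induction c with
  | zero =>
    refine Def.of_formula_nat (g := Fin.elim0) (.add 0 0 0) (fun j => j.elim0)
      (fun e => ⟨0, fun γ _ => by simp⟩) fun f' γ O _ u hu => ?_
    simp only [Formula.Holds, show (0 : Fin 1) = Fin.last 0 from rfl, Fin.snoc_last]
    omega
  | succ c ih =>
    refine ih.add (g := fun _ => 1) ?_
    refine Def.of_formula_nat (g := Fin.elim0) (.and (.mul 0 0 0) (.not (.add 0 0 0)))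
      (fun j => j.elim0) (fun e => ⟨1, fun γ _ => by rw [pow_one]; omega⟩) fun f' γ O _ u hu => ?_
    simp only [Formula.Holds, show (0 : Fin 1) = Fin.last 0 from rfl, Fin.snoc_last]
    constructor
    · rintro ⟨h1, h2⟩
      have : 0 < u := by omega
      exact Nat.eq_of_mul_eq_mul_left this (by omega)
    · rintro rfl
      simp

theorem Def.cst (c : Fin 5) (h : ∃ e, ∀ γ : Γ, Ctx.cst γ c < (Ctx.size γ + 2) ^ e) :
    Def fun γ : Γ => Ctx.cst γ c := by
  refine Def.of_formula_nat (g := Fin.elim0) (.const c 0) (fun j => j.elim0)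
      (fun e => h.imp fun _ h γ _ => h γ) fun f' _ O _ u hu => ?_
  simp only [Formula.Holds, show (0 : Fin 1) = Fin.last 0 from rfl, Fin.snoc_last]

@[fun_prop]
theorem Def.size : Def fun γ : Γ => Ctx.size γ :=
  (Def.cst 0 ⟨1, fun γ => by rw [Ctx.cst_zero, pow_one]; omega⟩).congr fun γ =>
      (Ctx.cst_zero γ).symm

@[fun_prop]
theorem Def.pow_const {f : Γ → ℕ} (hf : Def f) (e : ℕ) : Def fun γ => f γ ^ e := by
  induction e with
  | zero => simpa using Def.const 1
  | succ e ih => simpa only [pow_succ] using ih.mul hf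

@[fun_prop]
theorem Def.le {f g : Γ → ℕ} (hf : Def f) (hg : Def g) : Def fun γ => f γ ≤ g γ :=
  Def.of_formula (g := ![f, g]) (.le 0 1) (Fin.forall_fin_two.2 ⟨hf, hg⟩) fun _ _ _ _ => Iff.rfl

@[fun_prop]
theorem Def.lt {f g : Γ → ℕ} (hf : Def f) (hg : Def g) : Def fun γ => f γ < g γ :=
  (hg.le hf).not.congr_iff fun _ => not_le.symm

@[fun_prop]
theorem Def.eq {f g : Γ → ℕ} (hf : Def f) (hg : Def g) : Def fun γ => f γ = g γ :=
  Def.of_formula (g := ![f, g]) (.eq 0 1) (Fin.forall_fin_two.2 ⟨hf, hg⟩) fun _ _ _ _ => Iff.rfl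

@[fun_prop]
theorem Def.testBit {f g : Γ → ℕ} (hf : Def f) (hg : Def g) :
    Def fun γ => (f γ).testBit (g γ) = true :=
  Def.of_formula (g := ![f, g]) (.bit 0 1) (Fin.forall_fin_two.2 ⟨hf, hg⟩) fun _ _ _ _ => Iff.rfl

theorem Def.input {x : Fin 5 → Γ → ℕ} (hx : ∀ j, Def (x j)) :
    Def fun γ => Ctx.word γ fun j => x j γ :=
  Def.of_formula (.input fun j => j) hx fun _ _ _ _ => Iff.rfl

theorem Def.rep_idx_lt {g : Γ → ℕ} (hg : Def g) (e : ℕ) :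
    ∀ᶠ f in atTop, (Ctx.points Γ e f).snoc.Rep fun p => p.2.1 < g p.1.1 := by
  obtain ⟨⟨b, hb⟩, h⟩ := def_nat_iff.1 hg e
  filter_upwards [h, eventually_ge_atTop b] with f hf hbf
  exact Points.Rep.subst (S := (Ctx.points Γ e f).snoc) (.not (.le 1 0))
    ![fun p => p.2.1, fun p => g p.1.1] (Fin.forall_fin_two.2 ⟨Points.RepG.last, hf.weaken⟩)
    (Fin.forall_fin_two.2 ⟨fun p => p.2.2, fun p => (hb p.1.1 p.1.2).trans_le
      (pow_le_pow_size _ hbf)⟩) fun p O => by simp [Formula.Holds]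

theorem Ctx.Bounded.ext {g : Γ → ℕ} {e b : ℕ} {γ : Γ} (hγ : Ctx.Bounded Γ e γ)
    (hg : g γ < (Ctx.size γ + 2) ^ b) {u : ℕ} (hu : u < g γ) :
    Ctx.Bounded (Ext g) (max e b) ⟨γ, u, hu⟩ := fun j => by
  refine Fin.lastCases ?_ (fun j => ?_) j
  · exact (Fin.snoc_last (α := fun _ => ℕ) u (Ctx.val γ)).trans_lt
      ((hu.trans hg).trans_le (pow_le_pow_size _ (le_max_right _ _)))
  · exact (Fin.snoc_castSucc (α := fun _ => ℕ) u (Ctx.val γ) j).trans_lt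
      ((hγ j).trans_le (pow_le_pow_size _ (le_max_left _ _)))

/-- A predicate that is definable below `g` is definable in conjunction with the bound `g`. -/
theorem Def.rep_lt_and {g : Γ → ℕ} (hg : Def g) {P : Γ → ℕ → Prop}
    (hP : Def fun p : Ext g => P p.1 p.2) (e : ℕ) :
    ∀ᶠ f in atTop, (Ctx.points Γ e f).snoc.Rep fun p => p.2.1 < g p.1.1 ∧ P p.1.1 p.2.1 := by
  obtain ⟨⟨b, hb⟩, -⟩ := def_nat_iff.1 hg e
  filter_upwards [hg.rep_idx_lt e, def_prop_iff.1 hP (max e b)] with f ⟨φ, hφ⟩ ⟨ψ, hψ⟩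
  refine ⟨.and φ ψ, fun p O => (and_congr_left' (hφ p O)).trans ?_⟩
  refine and_congr_right fun hlt => ?_
  exact hψ ⟨⟨p.1.1, p.2.1, hlt⟩, p.1.2.ext (hb p.1.1 p.1.2) hlt⟩ O

theorem Def.bex {g : Γ → ℕ} (hg : Def g) {P : Γ → ℕ → Prop}
    (hP : Def fun p : Ext g => P p.1 p.2) : Def fun γ => ∃ u < g γ, P γ u := by
  rw [def_prop_iff]
  intro e
  obtain ⟨⟨b, hb⟩, -⟩ := def_nat_iff.1 hg e
  filter_upwards [hg.rep_lt_and hP e, eventually_ge_atTop b] with f hf hbf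
  refine (Points.Rep.ex (S := Ctx.points Γ e f) hf).congr fun γ => ?_
  constructor
  · rintro ⟨u, h1, h2⟩
    exact ⟨u.1, h1, h2⟩
  · rintro ⟨u, h1, h2⟩
    exact ⟨⟨u, h1.trans ((hb γ.1 γ.2).trans_le (pow_le_pow_size _ hbf))⟩, h1, h2⟩

theorem Def.ball {g : Γ → ℕ} (hg : Def g) {P : Γ → ℕ → Prop}
    (hP : Def fun p : Ext g => P p.1 p.2) : Def fun γ => ∀ u < g γ, P γ u :=
  (hg.bex (P := fun γ u => ¬ P γ u) hP.not).not.congr_iff fun γ => by simp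

/-- Substitution for the last variable. -/
theorem Def.at₁ {α : Type} [LawfulTarget α] {g : Δ → ℕ} {F : Δ → ℕ → α}
    (hF : Def fun p : Ext g => F p.1 p.2) {h : Γ → Δ} {i : Γ → ℕ} (hh : Def h) (hi : Def i)
    (hlt : ∀ γ, i γ < g (h γ)) : Def fun γ => F (h γ) (i γ) :=
  hF.comp (Def.mk hh hi hlt)

/-- Substitution for the last two variables. -/
theorem Def.at₂ {α : Type} [LawfulTarget α] {g : Δ → ℕ} {g' : Ext g → ℕ} {F : Δ → ℕ → ℕ → α}
    (hF : Def fun p : Ext g' => F p.1.1 p.1.2 p.2) {h : Γ → Δ} {i j : Γ → ℕ} (hh : Def h)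
    (hi : Def i) (hj : Def j) (hlt : ∀ γ, i γ < g (h γ)) (hlt' : ∀ γ, j γ < g' ⟨h γ, i γ, hlt γ⟩) :
    Def fun γ => F (h γ) (i γ) (j γ) :=
  hF.comp (Def.mk (Def.mk hh hi hlt) hj hlt')

/-- A function is definable if it is bounded by a definable function and its graph is definable. -/
theorem Def.of_graph {g B : Γ → ℕ} (hB : Def B) (hlt : ∀ γ, g γ < B γ)
    (hG : Def fun p : Ext B => p.2 = g p.1) : Def g := by
  rw [def_nat_iff]
  intro e
  obtain ⟨⟨b, hb⟩, -⟩ := def_nat_iff.1 hB e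
  refine ⟨⟨b, fun γ hγ => (hlt γ).trans (hb γ hγ)⟩, ?_⟩
  filter_upwards [hB.rep_lt_and (P := fun γ u => u = g γ) hG e] with f hf
  refine Points.Rep.congr hf fun p => ?_
  exact ⟨fun h => h.2, fun h => ⟨h ▸ hlt _, h⟩⟩

/-- A predicate that is definable on a definable subset of a context is definable in conjunction
with membership in the subset. -/
theorem Def.and_subtype {P : Γ → Prop} (hP : Def P) {Q : Γ → Prop}
    (hQ : Def fun p : Subtype P => Q p.1) : Def fun γ => P γ ∧ Q γ := by
  rw [def_prop_iff]
  intro e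
  filter_upwards [def_prop_iff.1 hP e, def_prop_iff.1 hQ e] with f ⟨φ, hφ⟩ ⟨ψ, hψ⟩
  refine ⟨.and φ ψ, fun γ O => (and_congr_left' (hφ γ O)).trans ?_⟩
  exact and_congr_right fun h => hψ ⟨⟨γ.1, h⟩, γ.2⟩ O

theorem Def.imp_subtype {P : Γ → Prop} (hP : Def P) {Q : Γ → Prop}
    (hQ : Def fun p : Subtype P => Q p.1) : Def fun γ => P γ → Q γ :=
  (hP.and_subtype (Q := fun γ => ¬ Q γ) hQ.not).not.congr_iff fun γ => by tauto

@[fun_prop]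
theorem Def.ite {P : Γ → Prop} {f g : Γ → ℕ} (hP : Def P) (hf : Def f) (hg : Def g)
    [∀ γ, Decidable (P γ)] : Def fun γ => if P γ then f γ else g γ := by
  refine Def.of_graph (B := fun γ => f γ + g γ + 1) (by fun_prop)
    (fun γ => by split_ifs <;> omega) ?_
  refine (((hP.comp Def.fst').and (Def.idx'.eq (hf.comp Def.fst'))).or
    ((hP.comp Def.fst').not.and (Def.idx'.eq (hg.comp Def.fst')))).congr_iff fun p => ?_
  split_ifs with h <;> simp [h]

/-- Extension by zero of a function that is definable on a definable subset. -/
theorem Def.ite_subtype {P : Γ → Prop} (hP : Def P) {f B : Γ → ℕ} (hB : Def B)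
    (hlt : ∀ γ, P γ → f γ < B γ) (hf : Def fun p : Subtype P => f p.1) [∀ γ, Decidable (P γ)] :
    Def fun γ => if P γ then f γ else 0 := by
  refine Def.of_graph (B := fun γ => B γ + 1) (by fun_prop) (fun γ => ?_) ?_
  · split_ifs with h
    · have := hlt γ h
      omega
    · omega
  have hP' : Def fun p : Ext (fun γ => B γ + 1) => P p.1 := hP.comp Def.fst'
  refine ((hP'.and_subtype (Q := fun p => p.2 = f p.1) ?_).or
    (hP'.not.and (Def.idx'.eq (Def.const 0)))).congr_iff fun p => ?_
  · refine Def.eq (by fun_prop) ?_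
    exact hf.comp (h := fun q : {p : Ext (fun γ => B γ + 1) // P p.1} => (⟨q.1.1, q.2⟩ : Subtype P))
      (Def.subtype_mk (by fun_prop) fun q => q.2)
  · split_ifs with h <;> simp [h]

@[fun_prop]
theorem Def.sub {f g : Γ → ℕ} (hf : Def f) (hg : Def g) : Def fun γ => f γ - g γ := by
  refine Def.of_graph (B := fun γ => f γ + 1) (by fun_prop) (fun γ => by omega) ?_
  have : Def fun p : Ext (fun γ => f γ + 1) =>
    (f p.1 ≤ g p.1 ∧ p.2 = 0) ∨ (g p.1 ≤ f p.1 ∧ p.2 + g p.1 = f p.1) := by fun_prop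
  exact this.congr_iff fun p => by omega

@[fun_prop]
theorem Def.div {f g : Γ → ℕ} (hf : Def f) (hg : Def g) : Def fun γ => f γ / g γ := by
  refine Def.of_graph (B := fun γ => f γ + 1) (by fun_prop)
    (fun γ => Nat.lt_succ_of_le (Nat.div_le_self _ _)) ?_
  have : Def fun p : Ext (fun γ => f γ + 1) => (g p.1 = 0 ∧ p.2 = 0) ∨
    (0 < g p.1 ∧ p.2 * g p.1 ≤ f p.1 ∧ f p.1 < (p.2 + 1) * g p.1) := by fun_prop
  refine this.congr_iff fun p => ?_
  rcases Nat.eq_zero_or_pos (g p.1) with h | h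
  · simp [h]
  · rw [eq_comm (a := p.2), Nat.div_eq_iff h]
    have : (p.2 + 1) * g p.1 = p.2 * g p.1 + g p.1 := by ring
    omega

@[fun_prop]
theorem Def.mod {f g : Γ → ℕ} (hf : Def f) (hg : Def g) : Def fun γ => f γ % g γ := by
  have : Def fun γ => f γ - g γ * (f γ / g γ) := by fun_prop
  exact this.congr fun γ => by
    have := Nat.div_add_mod (f γ) (g γ)
    omega

@[fun_prop]
theorem Def.bitLength {f : Γ → ℕ} (hf : Def f) : Def fun γ => (f γ).size := by
  refine Def.of_graph (B := fun γ => f γ + 1) (by fun_prop)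
    (fun γ => Nat.lt_succ_of_le (Nat.size_le.2 Nat.lt_two_pow_self)) ?_
  have h1 : Def fun p : Ext (fun γ => f γ + 1) =>
      ∀ t < f p.1, p.2 ≤ t → ¬ (f p.1).testBit t = true :=
    Def.ball (P := fun (p : Ext (fun γ => f γ + 1)) t => p.2 ≤ t → ¬ (f p.1).testBit t = true)
      (by fun_prop) (Def.imp (by fun_prop) (by fun_prop))
  have h2 : Def fun p : Ext (fun γ => f γ + 1) => p.2 = 0 ∨ (f p.1).testBit (p.2 - 1) = true := by
    fun_prop
  refine (h1.and h2).congr_iff fun p => ?_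
  have hle : ∀ s, (f p.1).size ≤ s ↔ ∀ t < f p.1, s ≤ t → ¬ (f p.1).testBit t = true := by
    intro s
    rw [Nat.size_le]
    constructor
    · intro h t _ ht
      simp [Nat.testBit_lt_two_pow (h.trans_le (Nat.pow_le_pow_right (by omega) ht))]
    · intro h
      refine Nat.lt_pow_two_of_testBit _ fun t ht => ?_
      by_cases htf : t < f p.1
      · simpa using h t htf ht
      · exact Nat.testBit_lt_two_pow (Nat.lt_two_pow_self.trans_le
          (Nat.pow_le_pow_right (by omega) (not_lt.1 htf)))
  constructor
  · intro h
    refine ⟨(hle _).1 h.ge, ?_⟩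
    by_contra! hc
    have : f p.1 < 2 ^ (p.2 - 1) := by
      refine Nat.lt_pow_two_of_testBit _ fun t ht => ?_
      rcases ht.eq_or_lt with h' | h'
      · rw [← h']; simpa using hc.2
      · exact Nat.testBit_lt_two_pow ((Nat.size_le.1 h.ge).trans_le
          (Nat.pow_le_pow_right (by omega) (by omega)))
    have := Nat.size_le.2 this
    omega
  · rintro ⟨h1, h2⟩
    refine le_antisymm ?_ ((hle _).2 h1)
    rcases h2 with h2 | h2
    · omega
    · by_contra! hc
      have : f p.1 < 2 ^ (p.2 - 1) := Nat.size_le.1 (by omega)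
      rw [Nat.testBit_lt_two_pow this] at h2
      exact absurd h2 (by simp)

@[fun_prop]
theorem Def.sqrt {f : Γ → ℕ} (hf : Def f) : Def fun γ => (f γ).sqrt := by
  refine Def.of_graph (B := fun γ => f γ + 1) (by fun_prop)
    (fun γ => Nat.lt_succ_of_le (Nat.sqrt_le_self _)) ?_
  have : Def fun p : Ext (fun γ => f γ + 1) =>
      p.2 * p.2 ≤ f p.1 ∧ f p.1 < (p.2 + 1) * (p.2 + 1) := by
    fun_prop
  refine this.congr_iff fun p => ?_
  rw [Nat.eq_sqrt]

end

/-! ### Polylogarithmic loops -/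

/-- The bit length of the size parameter. -/
def Ctx.len {Γ : Type} [Ctx Γ] (γ : Γ) : ℕ := (Ctx.size γ + 2).size

/-- `g` is polylogarithmic in the size parameter. -/
def Small {Γ : Type} [Ctx Γ] (g : Γ → ℕ) : Prop := ∃ e, ∀ γ, g γ ≤ Ctx.len γ ^ e

section

variable {Γ Δ : Type} [Ctx Γ] [Ctx Δ]

theorem Ctx.two_le_len (γ : Γ) : 2 ≤ Ctx.len γ :=
  Nat.lt_size.2 (by omega)

theorem Ctx.two_pow_len_le (γ : Γ) : 2 ^ Ctx.len γ ≤ (Ctx.size γ + 2) ^ 2 := by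
  have h : 2 ^ (Ctx.len γ - 1) ≤ Ctx.size γ + 2 :=
    Nat.lt_size.1 (by have := Ctx.two_le_len γ; unfold Ctx.len at *; omega)
  have h2 := Ctx.two_le_len γ
  calc 2 ^ Ctx.len γ = 2 ^ (Ctx.len γ - 1) * 2 := by
        rw [← pow_succ]; congr 1; omega
    _ ≤ (Ctx.size γ + 2) * (Ctx.size γ + 2) := Nat.mul_le_mul h (by omega)
    _ = _ := by ring

theorem Ctx.len_comp {h : Γ → Δ} (hh : Def h) (γ : Γ) : Ctx.len (h γ) = Ctx.len γ := by
  rw [Ctx.len, Ctx.len, (hh.1 γ).1]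

theorem Ctx.pow_len_mono (γ : Γ) {e e' : ℕ} (h : e ≤ e') : Ctx.len γ ^ e ≤ Ctx.len γ ^ e' :=
  Nat.pow_le_pow_right (by have := Ctx.two_le_len γ; omega) h

@[fun_prop]
theorem Def.len : Def fun γ : Γ => Ctx.len γ := by
  unfold Ctx.len
  fun_prop

theorem Small.mono {f g : Γ → ℕ} (hg : Small g) (h : ∀ γ, f γ ≤ g γ) : Small f :=
  hg.imp fun _ hg γ => (h γ).trans (hg γ)

theorem Small.comp {g : Δ → ℕ} (hg : Small g) {h : Γ → Δ} (hh : Def h) : Small fun γ => g (h γ) :=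
  hg.imp fun _ hg γ => by rw [← Ctx.len_comp hh]; exact hg _

theorem Small.len : Small fun γ : Γ => Ctx.len γ := ⟨1, fun γ => by simp⟩

theorem Small.const (c : ℕ) : Small fun _ : Γ => c :=
  ⟨c, fun γ => Nat.lt_two_pow_self.le.trans (Nat.pow_le_pow_left (Ctx.two_le_len γ) _)⟩

theorem Small.mul {f g : Γ → ℕ} (hf : Small f) (hg : Small g) : Small fun γ => f γ * g γ := by
  obtain ⟨a, ha⟩ := hf
  obtain ⟨b, hb⟩ := hg
  exact ⟨a + b, fun γ => by rw [pow_add]; exact Nat.mul_le_mul (ha γ) (hb γ)⟩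

theorem Small.add {f g : Γ → ℕ} (hf : Small f) (hg : Small g) : Small fun γ => f γ + g γ := by
  obtain ⟨a, ha⟩ := hf
  obtain ⟨b, hb⟩ := hg
  refine ⟨max a b + 1, fun γ => ?_⟩
  have h1 := (ha γ).trans (Ctx.pow_len_mono γ (le_max_left a b))
  have h2 := (hb γ).trans (Ctx.pow_len_mono γ (le_max_right a b))
  rw [pow_succ]
  nlinarith [Ctx.two_le_len γ]

theorem Small.idx {g : Γ → ℕ} (hg : Small g) : Small fun p : Ext g => p.2 :=
  hg.imp fun _ h p => p.3.le.trans (h p.1)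

theorem Def.two_pow_of_le {W : Γ → ℕ} (hW : Def W) {C : ℕ} (hC : ∀ γ, W γ ≤ C * Ctx.len γ) :
    Def fun γ => 2 ^ W γ := by
  have hlt : ∀ γ, 2 ^ W γ < (Ctx.size γ + 2) ^ (2 * C) + 1 := fun γ => by
    refine Nat.lt_succ_of_le ((Nat.pow_le_pow_right (by omega) (hC γ)).trans ?_)
    rw [mul_comm C, pow_mul, pow_mul]
    exact Nat.pow_le_pow_left (Ctx.two_pow_len_le γ) C
  refine Def.of_graph (B := fun γ => (Ctx.size γ + 2) ^ (2 * C) + 1) (by fun_prop) hlt ?_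
  have : Def fun p : Ext (fun γ : Γ => (Ctx.size γ + 2) ^ (2 * C) + 1) =>
      ∀ t < p.2 + W p.1 + 1, p.2.testBit t = true ↔ t = W p.1 :=
    Def.ball (g := fun p : Ext (fun γ : Γ => (Ctx.size γ + 2) ^ (2 * C) + 1) => p.2 + W p.1 + 1)
      (P := fun p t => p.2.testBit t = true ↔ t = W p.1)
      (by fun_prop) (by fun_prop)
  refine this.congr_iff fun p => ?_
  constructor
  · rintro h t _
    rw [h, Nat.testBit_two_pow]
    simp [eq_comm]
  · intro h
    refine Nat.eq_of_testBit_eq fun t => ?_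
    rw [Nat.testBit_two_pow, Bool.eq_iff_iff]
    by_cases ht : t < p.2 + W p.1 + 1
    · rw [h t ht]; simp [eq_comm]
    · rw [Nat.testBit_lt_two_pow (Nat.lt_two_pow_self.trans_le
        (Nat.pow_le_pow_right (by omega) (by omega : p.2 ≤ t)))]
      simp
      omega

/-- A definable function whose bits are definable. -/
theorem Def.of_testBit {g B : Γ → ℕ} (hB : Def B) (hle : ∀ γ, g γ ≤ B γ)
    (hG : Def fun p : Ext fun γ => B γ + 1 => (g p.1).testBit p.2 = true) : Def g := by
  refine Def.of_graph (B := fun γ => B γ + 1) (by fun_prop) (fun γ => Nat.lt_succ_of_le (hle γ)) ?_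
  have : Def fun p : Ext (fun γ => B γ + 1) =>
      ∀ t < B p.1 + 1, p.2.testBit t = true ↔ (g p.1).testBit t = true := by
    refine Def.ball (g := fun p : Ext (fun γ => B γ + 1) => B p.1 + 1)
      (P := fun p t => p.2.testBit t = true ↔ (g p.1).testBit t = true) (by fun_prop) ?_
    refine Def.iff (by fun_prop) ?_
    exact hG.comp (h := fun q : Ext (fun p : Ext (fun γ => B γ + 1) => B p.1 + 1) =>
      (⟨q.1.1, q.2, q.3⟩ : Ext (fun γ => B γ + 1))) (by fun_prop)
  refine this.congr_iff fun p => ⟨fun h t _ => by rw [h], fun h => ?_⟩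
  refine Nat.eq_of_testBit_eq fun t => ?_
  by_cases ht : t < B p.1 + 1
  · exact Bool.eq_iff_iff.2 (h t ht)
  · have hp : B p.1 < 2 ^ t := Nat.lt_two_pow_self.trans_le
      (Nat.pow_le_pow_right (by omega) (by omega))
    rw [Nat.testBit_lt_two_pow ((hle p.1).trans_lt hp),
      Nat.testBit_lt_two_pow ((Nat.le_of_lt_succ p.3).trans_lt hp)]

/-- The `j`-th digit of `c` in base `2 ^ W`. -/
def digit (W c j : ℕ) : ℕ := c / 2 ^ (W * j) % 2 ^ W

@[fun_prop]
theorem Def.digit {W c j : Γ → ℕ} (hW : Def W) (hc : Def c) (hj : Def j) :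
    Def fun γ => digit (W γ) (c γ) (j γ) := by
  refine Def.of_testBit hc (fun γ => (Nat.mod_le _ _).trans (Nat.div_le_self _ _)) ?_
  have : Def fun p : Ext (fun γ => c γ + 1) =>
    p.2 < W p.1 ∧ (c p.1).testBit (p.2 + W p.1 * j p.1) = true := by fun_prop
  refine this.congr_iff fun p => ?_
  rw [ACZero.digit, Nat.testBit_mod_two_pow, Nat.testBit_div_two_pow]
  simp

/-- Every sequence of digits is the sequence of digits of some number. -/
theorem exists_digit_eq (W m : ℕ) (x : ℕ → ℕ) (hx : ∀ j < m, x j < 2 ^ W) :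
    ∃ c < 2 ^ (W * m), ∀ j < m, digit W c j = x j := by
  induction m generalizing x with
  | zero => exact ⟨0, by simp, by simp⟩
  | succ m ih =>
    obtain ⟨c, hc, h⟩ := ih (fun j => x (j + 1)) fun j hj => hx _ (by omega)
    have h0 := hx 0 (by omega)
    refine ⟨x 0 + 2 ^ W * c, ?_, fun j hj => ?_⟩
    · have : 2 ^ (W * (m + 1)) = 2 ^ W * 2 ^ (W * m) := by ring
      rw [this]
      nlinarith
    · rcases j with - | j
      · simp [digit, Nat.mod_eq_of_lt h0]
      · rw [← h j (by omega), digit, digit, mul_add, mul_one, add_comm (W * j), pow_add,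
          ← Nat.div_div_eq_div_mul, Nat.add_mul_div_left _ _ (by positivity),
          Nat.div_eq_of_lt h0, zero_add]

/-- Primitive recursion on a state. -/
def recur (s₀ : ℕ) (F : ℕ → ℕ → ℕ) : ℕ → ℕ
  | 0 => s₀
  | j + 1 => F j (recur s₀ F j)

theorem recur_lt {s₀ B T : ℕ} {F : ℕ → ℕ → ℕ} (h₀ : s₀ < B)
    (hF : ∀ j < T, ∀ s < B, F j s < B) : ∀ j ≤ T, recur s₀ F j < B
  | 0, _ => h₀
  | j + 1, hj => hF j (by omega) _ (recur_lt h₀ hF j (by omega))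

/-- A loop whose whole history fits into logarithmically many bits is definable, because its
history can be guessed. -/
theorem Def.recur_of_le {T B s₀ W : Γ → ℕ} {F : Γ → ℕ → ℕ → ℕ} (hT : Def T) (hB : Def B)
    (hs₀ : Def s₀) (hW : Def W) {C : ℕ} (hC : ∀ γ, W γ * (T γ + 1) ≤ C * Ctx.len γ)
    (hBW : ∀ γ, B γ ≤ 2 ^ W γ) (h₀ : ∀ γ, s₀ γ < B γ)
    (hlt : ∀ γ, ∀ j < T γ, ∀ s < B γ, F γ j s < B γ)
    (hF : Def fun p : Ext (fun p : Ext T => B p.1) => F p.1.1 p.1.2 p.2) :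
    Def fun γ => recur (s₀ γ) (F γ) (T γ) := by
  refine Def.of_graph hB (fun γ => recur_lt (h₀ γ) (hlt γ) _ le_rfl) ?_
  have h2 : Def fun γ => 2 ^ (W γ * (T γ + 1)) := Def.two_pow_of_le (by fun_prop) hC
  have key : Def fun p : Ext B => ∃ c < 2 ^ (W p.1 * (T p.1 + 1)),
      ACZero.digit (W p.1) c 0 = s₀ p.1 ∧
      (∀ j < T p.1, ∃ s < B p.1, s = ACZero.digit (W p.1) c j ∧
        ACZero.digit (W p.1) c (j + 1) = F p.1 j s) ∧
      ACZero.digit (W p.1) c (T p.1) = p.2 := by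
    refine Def.bex (h2.comp Def.fst') (P := fun p c => ACZero.digit (W p.1) c 0 = s₀ p.1 ∧
      (∀ j < T p.1, ∃ s < B p.1, s = ACZero.digit (W p.1) c j ∧
        ACZero.digit (W p.1) c (j + 1) = F p.1 j s) ∧
      ACZero.digit (W p.1) c (T p.1) = p.2) ?_
    refine Def.and (by fun_prop) (Def.and ?_ (by fun_prop))
    refine Def.ball (by fun_prop) ?_
    refine Def.bex (by fun_prop) ?_
    refine Def.and (by fun_prop) (Def.eq (by fun_prop) ?_)
    exact Def.at₂ hF (by fun_prop) (by fun_prop) (by fun_prop) (fun q => q.1.3) (fun q => q.3)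
  refine key.congr_iff fun p => ?_
  constructor
  · intro h
    obtain ⟨c, hc, hd⟩ := exists_digit_eq (W p.1) (T p.1 + 1) (recur (s₀ p.1) (F p.1)) fun j hj =>
      (recur_lt (h₀ p.1) (hlt p.1) j (by omega)).trans_le (hBW p.1)
    refine ⟨c, hc, hd 0 (by omega), fun j hj => ?_, (hd _ (by omega)).trans h.symm⟩
    exact ⟨_, recur_lt (h₀ p.1) (hlt p.1) j hj.le, (hd j (by omega)).symm, hd (j + 1) (by omega)⟩
  · rintro ⟨c, -, h0, h1, h2⟩
    have : ∀ j ≤ T p.1, ACZero.digit (W p.1) c j = recur (s₀ p.1) (F p.1) j := by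
      intro j
      induction j with
      | zero => exact fun _ => h0
      | succ j ih =>
        intro hj
        obtain ⟨s, -, rfl, h⟩ := h1 j (by omega)
        rw [h, ih (by omega), recur]
    rw [← h2, this _ le_rfl]

theorem recur_congr {s₀ : ℕ} {F G : ℕ → ℕ → ℕ} {T : ℕ}
    (h : ∀ j < T, F j (recur s₀ G j) = G j (recur s₀ G j)) : ∀ j ≤ T, recur s₀ F j = recur s₀ G j
  | 0, _ => rfl
  | j + 1, hj => by rw [recur, recur_congr h j (by omega), h j (by omega), recur]

theorem recur_add (s₀ : ℕ) (F : ℕ → ℕ → ℕ) (m n : ℕ) :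
    recur s₀ F (m + n) = recur (recur s₀ F m) (fun j => F (m + j)) n := by
  induction n with
  | zero => rfl
  | succ n ih => rw [← add_assoc, recur, ih, recur]

theorem recur_mul (s₀ : ℕ) (F : ℕ → ℕ → ℕ) (m n : ℕ) :
    recur s₀ F (n * m) = recur s₀ (fun i s => recur s (fun j => F (i * m + j)) m) n := by
  induction n with
  | zero => simp [recur]
  | succ n ih => rw [Nat.succ_mul, recur_add, ih, recur]

theorem sq_le_two_mul_two_pow (m : ℕ) : m ^ 2 ≤ 2 * 2 ^ m := by
  induction m with
  | zero => simp
  | succ m ih =>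
    rcases lt_or_ge m 3 with h | h
    · interval_cases m <;> norm_num
    · rw [pow_succ 2 m]
      nlinarith

/-- The number of steps, or of factors, that are handled at once. -/
def Ctx.block (γ : Γ) : ℕ := (Ctx.len γ).sqrt + 1

@[fun_prop]
theorem Def.block : Def fun γ : Γ => Ctx.block γ := by
  unfold Ctx.block
  fun_prop

theorem Ctx.len_le_block_sq (γ : Γ) : Ctx.len γ ≤ Ctx.block γ ^ 2 := by
  rw [Ctx.block, sq]
  exact (Nat.lt_succ_sqrt _).le

theorem Ctx.block_le_len (γ : Γ) : Ctx.block γ ≤ Ctx.len γ := by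
  have := Ctx.two_le_len γ
  have h := Nat.sqrt_lt_self (n := Ctx.len γ) (by omega)
  unfold Ctx.block
  omega

theorem Ctx.len_lt_two_pow_size (γ : Γ) : Ctx.len γ < 2 ^ (Ctx.len γ).size := Nat.lt_size_self _

theorem Ctx.pow_len_le_two_pow (γ : Γ) (e : ℕ) : Ctx.len γ ^ e ≤ 2 ^ (e * (Ctx.len γ).size) := by
  rw [mul_comm, pow_mul]
  exact Nat.pow_le_pow_left (Ctx.len_lt_two_pow_size γ).le e

theorem Ctx.size_len_mul_le (γ : Γ) : (Ctx.len γ).size * (Ctx.block γ + 1) ≤ 4 * Ctx.len γ := by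
  have h2 := Ctx.two_le_len γ
  set L := Ctx.len γ
  set m := L.size with hm
  have hpos : 0 < m := Nat.size_pos.2 (by omega)
  have h1 : 2 ^ (m - 1) ≤ L := Nat.lt_size.1 (by omega)
  have h3 : m ^ 2 ≤ 4 * L := by
    have := sq_le_two_mul_two_pow m
    obtain ⟨j, hj⟩ : ∃ j, m = j + 1 := ⟨m - 1, by omega⟩
    rw [hj] at this h1 ⊢
    rw [pow_succ 2 j] at this
    simp only [add_tsub_cancel_right] at h1
    omega
  have h4 : L.sqrt ^ 2 ≤ L := Nat.sqrt_le' L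
  have h5 : m * L.sqrt ≤ 2 * L := by
    have : (m * L.sqrt) ^ 2 ≤ (2 * L) ^ 2 := by
      rw [mul_pow]
      nlinarith
    exact (Nat.pow_le_pow_iff_left (by omega)).1 this
  have h6 : m ≤ L := Nat.size_le.2 Nat.lt_two_pow_self
  change m * (L.sqrt + 1 + 1) ≤ 4 * L
  nlinarith

theorem Small.le_block_pow {T : Γ → ℕ} (hT : Small T) : ∃ R, ∀ γ, T γ ≤ Ctx.block γ ^ R := by
  obtain ⟨e, he⟩ := hT
  exact ⟨2 * e, fun γ => (he γ).trans (by
    rw [pow_mul]; exact Nat.pow_le_pow_left (Ctx.len_le_block_sq γ) e)⟩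

/-- Polylogarithmically many steps of a loop with a polylogarithmic state are definable. The loop is
split, to constant depth, into blocks of about the square root of logarithmically many steps. -/
theorem Def.recur {T B s₀ : Γ → ℕ} {F : Γ → ℕ → ℕ → ℕ} (hT : Def T) (hB : Def B)
    (hs₀ : Def s₀) (hTs : Small T) (hBs : Small B) (h₀ : ∀ γ, s₀ γ < B γ)
    (hlt : ∀ γ, ∀ j < T γ, ∀ s < B γ, F γ j s < B γ)
    (hF : Def fun p : Ext (fun p : Ext T => B p.1) => F p.1.1 p.1.2 p.2) :
    Def fun γ => recur (s₀ γ) (F γ) (T γ) := by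
  obtain ⟨R, hR⟩ := hTs.le_block_pow
  obtain ⟨e, he⟩ := hBs
  -- Beyond the last step the state is left unchanged.
  let G : Γ → ℕ → ℕ → ℕ := fun γ j s => if j < T γ then F γ j s else s
  have hG : ∀ γ j, ∀ s < B γ, G γ j s < B γ := fun γ j s hs => by
    simp only [G]
    split_ifs with h
    · exact hlt γ j h s hs
    · exact hs
  have main : ∀ r : ℕ, ∀ U : Γ → ℕ, Def U → Def fun p : Ext (fun p : Ext U => B p.1) =>
      ACZero.recur p.2 (fun j => G p.1.1 (p.1.2 + j)) (Ctx.block p ^ r) := by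
    intro r
    induction r with
    | zero =>
      intro U hU
      have h1 : Def fun p : Ext (fun p : Ext U => B p.1) =>
          if p.1.2 < T p.1.1 then F p.1.1 p.1.2 p.2 else 0 := by
        refine Def.ite_subtype (P := fun p : Ext (fun p : Ext U => B p.1) => p.1.2 < T p.1.1)
          (by fun_prop) (B := fun p => B p.1.1) (by fun_prop)
          (fun p h => hlt _ _ h _ p.3) ?_
        exact Def.at₂ hF (by fun_prop) (by fun_prop) (by fun_prop) (fun q => q.2) (fun q => q.1.3)
      have h2 : Def fun p : Ext (fun p : Ext U => B p.1) => if p.1.2 < T p.1.1 then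
          (if p.1.2 < T p.1.1 then F p.1.1 p.1.2 p.2 else 0) else p.2 :=
        Def.ite (by fun_prop) h1 (by fun_prop)
      refine h2.congr fun p => ?_
      simp only [pow_zero, ACZero.recur, G, add_zero]
      split_ifs <;> rfl
    | succ r ih =>
      intro U hU
      have h1 := ih (fun γ => U γ + Ctx.block γ * Ctx.block γ ^ r) (by fun_prop)
      have h2 := Def.recur_of_le (Γ := Ext (fun p : Ext U => B p.1)) (T := fun p => Ctx.block p)
        (B := fun p => B p.1.1) (s₀ := fun p => p.2) (W := fun p => e * (Ctx.len p).size)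
        (C := e * 4)
        (F := fun p i s => ACZero.recur s
          (fun j => G p.1.1 (p.1.2 + (i * Ctx.block p ^ r + j))) (Ctx.block p ^ r))
        (by fun_prop) (by fun_prop) (by fun_prop) (by fun_prop)
        (fun p => by
          rw [mul_assoc, mul_assoc]
          exact Nat.mul_le_mul_left _ (Ctx.size_len_mul_le p))
        (fun p => (he p.1.1).trans (Ctx.pow_len_le_two_pow p.1.1 e)) (fun p => p.3)
        (fun p i _ s hs => recur_lt hs (fun j _ s hs => hG _ _ s hs) _ le_rfl) ?_
      · refine h2.congr fun p => ?_
        rw [pow_succ', recur_mul]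
      · refine Def.congr (h1.comp (h := fun q =>
            (⟨⟨q.1.1.1.1, q.1.1.1.2 + q.1.2 * Ctx.block q ^ r, ?_⟩,
          q.2, q.3⟩ : Ext (fun p : Ext (fun γ => U γ + Ctx.block γ * Ctx.block γ ^ r) => B p.1)))
          ?_) fun q => ?_
        · have h3 := q.1.1.1.3
          have h4 : q.1.2 < Ctx.block q.1.1.1.1 := q.1.3
          change _ + _ * Ctx.block q.1.1.1.1 ^ r < _
          have : q.1.2 * Ctx.block q.1.1.1.1 ^ r ≤
            Ctx.block q.1.1.1.1 * Ctx.block q.1.1.1.1 ^ r := Nat.mul_le_mul_right _ h4.le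
          omega
        · fun_prop
        · simp only [add_assoc]
          rfl
  have h3 := (main R (fun _ => 1) (by fun_prop)).comp
      (h := fun γ => (⟨⟨γ, 0, by omega⟩, s₀ γ, h₀ γ⟩ :
    Ext (fun p : Ext (fun _ : Γ => 1) => B p.1))) (by fun_prop)
  refine h3.congr fun γ => ?_
  change _ = ACZero.recur (s₀ γ) (fun j => G γ (0 + j)) (Ctx.block γ ^ R)
  obtain ⟨d, hd⟩ := Nat.exists_eq_add_of_le (hR γ)
  have e1 : ∀ s d, ACZero.recur s (fun j => G γ (0 + (T γ + j))) d = s := fun s d => by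
    induction d with
    | zero => rfl
    | succ d ih => rw [ACZero.recur, ih]; simp [G]
  rw [hd, recur_add, e1]
  exact (recur_congr (fun j hj => by simp [G, hj]) _ le_rfl).symm

end

/-! ### Arithmetic modulo polylogarithmic numbers -/

section

variable {Γ Δ : Type} [Ctx Γ] [Ctx Δ]

/-- A family of residues is definable if its family of least nonnegative representatives is. -/
def DefZ {p : Γ → ℕ} (x : ∀ γ, ZMod (p γ)) : Prop := Def fun γ => (x γ).val

section

variable {p : Γ → ℕ}

theorem DefZ.comp {p : Δ → ℕ} {x : ∀ δ, ZMod (p δ)} (hx : DefZ x) {h : Γ → Δ} (hh : Def h) :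
    DefZ (p := fun γ => p (h γ)) fun γ => x (h γ) :=
  Def.comp (f := fun δ => (x δ).val) hx hh

theorem DefZ.natCast (hp : Def p) {f : Γ → ℕ} (hf : Def f) :
    DefZ fun γ => ((f γ : ℕ) : ZMod (p γ)) :=
  (hf.mod hp).congr fun _ => ZMod.val_natCast _ _

theorem DefZ.mul (hp : Def p) {x y : ∀ γ, ZMod (p γ)} (hx : DefZ x) (hy : DefZ y) :
    DefZ fun γ => x γ * y γ :=
  ((Def.mul hx hy).mod hp).congr fun _ => ZMod.val_mul _ _

theorem DefZ.ite {P : Γ → Prop} (hP : Def P) [∀ γ, Decidable (P γ)] {x y : ∀ γ, ZMod (p γ)}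
    (hx : DefZ x) (hy : DefZ y) : DefZ fun γ => if P γ then x γ else y γ :=
  (Def.ite hP hx hy).congr fun γ => by dsimp only; split_ifs <;> rfl

theorem DefZ.one (hp : Def p) : DefZ fun γ => (1 : ZMod (p γ)) := by
  simpa using DefZ.natCast hp (Def.const 1)

theorem DefZ.zero (hp : Def p) : DefZ fun γ => (0 : ZMod (p γ)) := by
  simpa using DefZ.natCast hp (Def.const 0)

variable [∀ γ, NeZero (p γ)]

theorem DefZ.add (hp : Def p) {x y : ∀ γ, ZMod (p γ)} (hx : DefZ x) (hy : DefZ y) :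
    DefZ fun γ => x γ + y γ :=
  ((Def.add hx hy).mod hp).congr fun _ => ZMod.val_add _ _

theorem DefZ.neg (hp : Def p) {x : ∀ γ, ZMod (p γ)} (hx : DefZ x) : DefZ fun γ => - x γ :=
  ((Def.sub hp hx).mod hp).congr fun _ => ZMod.neg_val' _

theorem DefZ.sub (hp : Def p) {x y : ∀ γ, ZMod (p γ)} (hx : DefZ x) (hy : DefZ y) :
    DefZ fun γ => x γ - y γ := by
  simpa only [sub_eq_add_neg] using hx.add hp (hy.neg hp)

theorem DefZ.eq {x y : ∀ γ, ZMod (p γ)} (hx : DefZ x) (hy : DefZ y) : Def fun γ => x γ = y γ :=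
  (Def.eq hx hy).congr_iff fun γ => (ZMod.val_injective (p γ)).eq_iff.symm

/-- Accumulation of an operation on residues, from `a` on. -/
theorem DefZ.fold {T : Γ → ℕ} (hT : Def T) (hTs : Small T) (hp : Def p) (hps : Small p)
    {a : ∀ γ, ZMod (p γ)} (ha : DefZ a) {x : ∀ γ, ℕ → ZMod (p γ)}
    (hx : DefZ (p := fun q : Ext T => p q.1) fun q => x q.1 q.2)
    (op : ∀ γ, ZMod (p γ) → ZMod (p γ) → ZMod (p γ)) (opN : ℕ → ℕ → ℕ)
    (hop : ∀ γ s y, (op γ s y).val = opN s.val y.val % p γ)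
    (hopN : ∀ {Δ : Type} [Ctx Δ] {f g : Δ → ℕ}, Def f → Def g → Def fun δ => opN (f δ) (g δ))
    {y : ∀ γ, ℕ → ZMod (p γ)} (h0 : ∀ γ, y γ 0 = a γ)
    (hs : ∀ γ j, y γ (j + 1) = op γ (y γ j) (x γ j)) : DefZ fun γ => y γ (T γ) := by
  have h := Def.recur (T := T) (B := p) (s₀ := fun γ => (a γ).val)
    (F := fun γ j s => opN s (x γ j).val % p γ) hT hp ha hTs hps (fun γ => ZMod.val_lt _)
    (fun γ j _ s _ => Nat.mod_lt _ (Nat.pos_of_ne_zero (NeZero.ne _))) ?_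
  · refine h.congr fun γ => ?_
    dsimp only
    generalize T γ = n
    induction n with
    | zero => simp [h0, ACZero.recur]
    | succ n ih => rw [hs, hop, ih, ACZero.recur]
  · refine Def.mod (hopN (by fun_prop) ?_) (by fun_prop)
    exact Def.comp (f := fun q : Ext T => (x q.1 q.2).val) hx Def.fst'

theorem DefZ.sum {T : Γ → ℕ} (hT : Def T) (hTs : Small T) (hp : Def p) (hps : Small p)
    {x : ∀ γ, ℕ → ZMod (p γ)} (hx : DefZ (p := fun q : Ext T => p q.1) fun q => x q.1 q.2) :
    DefZ fun γ => ∑ i ∈ Finset.range (T γ), x γ i :=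
  DefZ.fold hT hTs hp hps (DefZ.zero hp) hx (fun _ s y => s + y) (fun s y => s + y)
    (fun _ _ _ => ZMod.val_add _ _) (fun hf hg => hf.add hg)
    (y := fun γ n => ∑ i ∈ Finset.range n, x γ i) (fun _ => Finset.sum_range_zero _)
    (fun _ _ => Finset.sum_range_succ _ _)

theorem DefZ.prod {T : Γ → ℕ} (hT : Def T) (hTs : Small T) (hp : Def p) (hps : Small p)
    {x : ∀ γ, ℕ → ZMod (p γ)} (hx : DefZ (p := fun q : Ext T => p q.1) fun q => x q.1 q.2) :
    DefZ fun γ => ∏ i ∈ Finset.range (T γ), x γ i :=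
  DefZ.fold hT hTs hp hps (DefZ.one hp) hx (fun _ s y => s * y) (fun s y => s * y)
    (fun _ _ _ => ZMod.val_mul _ _) (fun hf hg => hf.mul hg)
    (y := fun γ n => ∏ i ∈ Finset.range n, x γ i) (fun _ => Finset.prod_range_zero _)
    (fun _ _ => Finset.prod_range_succ _ _)

theorem DefZ.pow {T : Γ → ℕ} (hT : Def T) (hTs : Small T) (hp : Def p) (hps : Small p)
    {x : ∀ γ, ZMod (p γ)} (hx : DefZ x) : DefZ fun γ => x γ ^ T γ := by
  have h : DefZ fun γ => ∏ i ∈ Finset.range (T γ), x γ := DefZ.prod hT hTs hp hps (hx.comp Def.fst')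
  simpa using h

end

theorem Def.sum {T B : Γ → ℕ} {f : Γ → ℕ → ℕ} (hT : Def T) (hTs : Small T) (hB : Def B)
    (hBs : Small B) (hlt : ∀ γ, ∀ i < T γ, f γ i ≤ B γ) (hf : Def fun q : Ext T => f q.1 q.2) :
    Def fun γ => ∑ i ∈ Finset.range (T γ), f γ i := by
  have hp : Def fun γ => T γ * B γ + 1 := by fun_prop
  have h : DefZ fun γ => ∑ i ∈ Finset.range (T γ), ((f γ i : ℕ) : ZMod (T γ * B γ + 1)) :=
    DefZ.sum hT hTs hp ((hTs.mul hBs).add (Small.const 1))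
      (DefZ.natCast (hp.comp Def.fst') hf)
  refine Def.congr h fun γ => ?_
  dsimp only
  rw [← Nat.cast_sum, ZMod.val_natCast, Nat.mod_eq_of_lt]
  refine Nat.lt_succ_of_le ?_
  simpa using Finset.sum_le_card_nsmul (Finset.range (T γ)) (f γ) (B γ)
    fun i hi => hlt γ i (Finset.mem_range.1 hi)

end

/-! ### Numbers with polylogarithmically many bits -/

section

variable {Γ Δ : Type} [Ctx Γ] [Ctx Δ]

/-- A number with polylogarithmically many bits, which are definable. -/
def Big (x : Γ → ℕ) : Prop := ∃ e, (∀ γ, x γ < 2 ^ Ctx.len γ ^ e) ∧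
  Def fun p : Ext (fun γ => Ctx.len γ ^ e) => (x p.1).testBit p.2 = true

theorem Big.congr {x y : Γ → ℕ} (hx : Big x) (h : ∀ γ, y γ = x γ) : Big y := by
  rwa [funext h]

theorem Big.testBit {x t : Γ → ℕ} (hx : Big x) (ht : Def t) :
    Def fun γ => (x γ).testBit (t γ) = true := by
  obtain ⟨e, hlt, h⟩ := hx
  have : Def fun γ => ∃ u < Ctx.len γ ^ e, (x γ).testBit u = true ∧ u = t γ :=
    Def.bex (by fun_prop) (Def.and h (by fun_prop))
  refine this.congr_iff fun γ => ⟨fun h => ⟨_, ?_, h, rfl⟩, ?_⟩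
  · by_contra! hc
    rw [Nat.testBit_lt_two_pow ((hlt γ).trans_le (Nat.pow_le_pow_right (by omega) hc))] at h
    exact absurd h (by simp)
  · rintro ⟨u, -, h, rfl⟩
    exact h

theorem Big.comp {x : Δ → ℕ} (hx : Big x) {h : Γ → Δ} (hh : Def h) : Big fun γ => x (h γ) := by
  obtain ⟨e, hlt, hb⟩ := hx
  refine ⟨e, fun γ => by rw [← Ctx.len_comp hh]; exact hlt _, ?_⟩
  refine Def.at₁ (F := fun δ t => (x δ).testBit t = true) hb (by fun_prop) (by fun_prop) fun p => ?_
  rw [Ctx.len_comp hh]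
  exact p.3

theorem Big.exists_bound {x : Γ → ℕ} (hx : Big x) : ∃ T : Γ → ℕ, Def T ∧ Small T ∧
    ∀ γ, x γ < 2 ^ T γ := by
  obtain ⟨e, hlt, -⟩ := hx
  exact ⟨fun γ => Ctx.len γ ^ e, by fun_prop, ⟨e, fun _ => le_rfl⟩, hlt⟩

theorem Big.of_testBit {x T : Γ → ℕ} (hT : Small T) (hlt : ∀ γ, x γ < 2 ^ T γ)
    (h : ∀ e, Def fun p : Ext (fun γ : Γ => Ctx.len γ ^ e) => (x p.1).testBit p.2 = true) :
    Big x := by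
  obtain ⟨e, he⟩ := hT
  exact ⟨e, fun γ => (hlt γ).trans_le (Nat.pow_le_pow_right (by omega) (he γ)), h e⟩

theorem Big.of_def {x T : Γ → ℕ} (hx : Def x) (hT : Small T) (hlt : ∀ γ, x γ < 2 ^ T γ) : Big x :=
  Big.of_testBit hT hlt fun e => by fun_prop

theorem Big.of_small {x : Γ → ℕ} (hx : Def x) (hs : Small x) : Big x :=
  Big.of_def hx hs fun _ => Nat.lt_two_pow_self

theorem Big.const (c : ℕ) : Big fun _ : Γ => c := Big.of_small (Def.const c) (Small.const c)

theorem Big.ite {x y : Γ → ℕ} (hx : Big x) (hy : Big y) {P : Γ → Prop} (hP : Def P)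
    [∀ γ, Decidable (P γ)] : Big fun γ => if P γ then x γ else y γ := by
  obtain ⟨T, -, hT, hxT⟩ := hx.exists_bound
  obtain ⟨T', -, hT', hyT⟩ := hy.exists_bound
  refine Big.of_testBit (hT.add hT') (fun γ => ?_) fun e => ?_
  · split_ifs
    · exact (hxT γ).trans_le (Nat.pow_le_pow_right (by omega) (by omega))
    · exact (hyT γ).trans_le (Nat.pow_le_pow_right (by omega) (by omega))
  · have h1 : Def fun p : Ext (fun γ : Γ => Ctx.len γ ^ e) => (P p.1 ∧ (x p.1).testBit p.2 = true) ∨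
        (¬ P p.1 ∧ (y p.1).testBit p.2 = true) :=
      ((hP.comp Def.fst').and ((hx.comp Def.fst').testBit Def.idx')).or
        ((hP.comp Def.fst').not.and ((hy.comp Def.fst').testBit Def.idx'))
    refine h1.congr_iff fun p => ?_
    split_ifs with h <;> simp [h]

/-- The carry into position `t` when the numbers `x i`, `i < M`, are added. -/
theorem recur_carry (x : ℕ → ℕ) (M t : ℕ) :
    recur 0 (fun t s => (s + ∑ i ∈ Finset.range M, if (x i).testBit t = true then 1 else 0) / 2) t =
      (∑ i ∈ Finset.range M, x i % 2 ^ t) / 2 ^ t := by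
  induction t with
  | zero => simp [recur, Nat.mod_one]
  | succ t ih =>
    rw [recur, ih, pow_succ, ← Nat.div_div_eq_div_mul]
    congr 1
    have : ∀ i, x i % (2 ^ t * 2) =
        x i % 2 ^ t + 2 ^ t * if (x i).testBit t = true then 1 else 0 := by
      intro i
      rw [Nat.mod_mul, Nat.testBit_eq_decide_div_mod_eq]
      congr 2
      have := Nat.mod_two_eq_zero_or_one (x i / 2 ^ t)
      rcases this with h | h <;> simp [h]
    rw [Finset.sum_congr rfl fun i _ => this i, Finset.sum_add_distrib, ← Finset.mul_sum,
      Nat.add_mul_div_left _ _ (by positivity)]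

theorem testBit_sum (x : ℕ → ℕ) (M t : ℕ) : (∑ i ∈ Finset.range M, x i).testBit t = true ↔
    ((∑ i ∈ Finset.range M, x i % 2 ^ t) / 2 ^ t +
      ∑ i ∈ Finset.range M, if (x i).testBit t = true then 1 else 0) % 2 = 1 := by
  rw [Nat.testBit_eq_decide_div_mod_eq, decide_eq_true_iff]
  have h1 : ∑ i ∈ Finset.range M, x i =
      ∑ i ∈ Finset.range M, x i % 2 ^ t + 2 ^ t * ∑ i ∈ Finset.range M, x i / 2 ^ t := by
    rw [Finset.mul_sum, ← Finset.sum_add_distrib]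
    exact Finset.sum_congr rfl fun i _ => (Nat.mod_add_div _ _).symm
  conv_lhs => rw [h1, Nat.add_mul_div_left _ _ (by positivity), Nat.add_mod, Finset.sum_nat_mod]
  have h2 : ∀ i, x i / 2 ^ t % 2 = if (x i).testBit t = true then 1 else 0 := by
    intro i
    rw [Nat.testBit_eq_decide_div_mod_eq]
    rcases Nat.mod_two_eq_zero_or_one (x i / 2 ^ t) with h | h <;> simp [h]
  simp only [h2]
  rw [← Nat.add_mod]

/-- Iterated addition: the carries are computed by a loop, from the lowest position on. -/
theorem Big.sum {M : Γ → ℕ} {x : Γ → ℕ → ℕ} (hM : Def M) (hMs : Small M)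
    (hx : Big fun p : Ext M => x p.1 p.2) : Big fun γ => ∑ i ∈ Finset.range (M γ), x γ i := by
  have hx₀ := hx
  obtain ⟨e, hlt, -⟩ := hx₀
  refine Big.of_testBit (T := fun γ => M γ + Ctx.len γ ^ e) (hMs.add ⟨e, fun _ => le_rfl⟩)
    (fun γ => ?_) fun e' => ?_
  · have h1 : ∑ i ∈ Finset.range (M γ), x γ i ≤ M γ * 2 ^ Ctx.len γ ^ e := by
      simpa using Finset.sum_le_card_nsmul (Finset.range (M γ)) (x γ) (2 ^ Ctx.len γ ^ e)
        fun i hi => (hlt ⟨γ, i, Finset.mem_range.1 hi⟩).le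
    rw [pow_add]
    exact h1.trans_lt (Nat.mul_lt_mul_of_pos_right Nat.lt_two_pow_self (by positivity))
  have hcol : ∀ {Δ : Type} [Ctx Δ] (h : Δ → Γ) (t : Δ → ℕ), Def h → Def t → Def fun δ =>
      ∑ i ∈ Finset.range (M (h δ)), if (x (h δ) i).testBit (t δ) = true then 1 else 0 := by
    intro Δ _ h t hh ht
    refine Def.sum (hM.comp hh) (hMs.comp hh) (Def.const 1) (Small.const 1)
      (fun _ i _ => by split_ifs <;> omega) ?_
    refine Def.ite ?_ (by fun_prop) (by fun_prop)
    have hx' : Big fun q : Ext (fun δ => M (h δ)) => x (h q.1) q.2 :=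
      Big.comp (x := fun p : Ext M => x p.1 p.2) hx
          (h := fun q : Ext (fun δ => M (h δ)) => ⟨h q.1, q.2, q.3⟩)
        (Def.mk (by fun_prop) (by fun_prop) _)
    exact hx'.testBit (by fun_prop)
  have hcarry : Def fun p : Ext (fun γ : Γ => Ctx.len γ ^ e') => ACZero.recur 0 (fun t s =>
      (s + ∑ i ∈ Finset.range (M p.1), if (x p.1 i).testBit t = true then 1 else 0) / 2) p.2 := by
    refine Def.recur (B := fun p => M p.1 + 1) (s₀ := fun _ => 0) (by fun_prop) (by fun_prop)
      (by fun_prop) (Small.idx ⟨e', fun _ => le_rfl⟩)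
      ((hMs.comp Def.fst').add (Small.const 1)) (fun _ => by omega) (fun p t _ s hs => ?_) ?_
    · have : ∑ i ∈ Finset.range (M p.1), (if (x p.1 i).testBit t = true then 1 else 0) ≤ M p.1 := by
        refine (Finset.sum_le_card_nsmul _ _ 1 fun i _ => by split_ifs <;> omega).trans ?_
        simp
      omega
    · have h := hcol (Δ := Ext (fun p : Ext (fun p : Ext (fun γ : Γ => Ctx.len γ ^ e') => p.2) =>
        M p.1.1 + 1)) (fun q => q.1.1.1) (fun q => q.1.2) (by fun_prop) (by fun_prop)
      exact (Def.add (by fun_prop) h).div (Def.const 2)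
  have h3 := hcol (Δ := Ext (fun γ : Γ => Ctx.len γ ^ e')) (fun p => p.1) (fun p => p.2)
    (by fun_prop) (by fun_prop)
  refine (((hcarry.add h3).mod (Def.const 2)).eq (Def.const 1)).congr_iff fun p => ?_
  rw [recur_carry, testBit_sum]

theorem Big.at₁ {g : Δ → ℕ} {x : Δ → ℕ → ℕ}
    (hx : Big fun p : Ext g => x p.1 p.2) {h : Γ → Δ} {i : Γ → ℕ} (hh : Def h) (hi : Def i)
    (hlt : ∀ γ, i γ < g (h γ)) : Big fun γ => x (h γ) (i γ) :=
  hx.comp (Def.mk hh hi hlt)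

theorem Big.add {x y : Γ → ℕ} (hx : Big x) (hy : Big y) : Big fun γ => x γ + y γ := by
  have : Big fun γ => ∑ i ∈ Finset.range 2, if i = 0 then x γ else y γ :=
    Big.sum (M := fun _ => 2) (Def.const 2) (Small.const 2)
      ((hx.comp Def.fst').ite (hy.comp Def.fst') (by fun_prop))
  simpa [Finset.sum_range_succ] using this

theorem Big.mul_two_pow {x i : Γ → ℕ} (hx : Big x) (hi : Def i) (his : Small i) :
    Big fun γ => x γ * 2 ^ i γ := by
  obtain ⟨T, -, hT, hlt⟩ := hx.exists_bound
  refine Big.of_testBit (T := fun γ => T γ + i γ) (hT.add his) (fun γ => ?_) fun e => ?_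
  · rw [pow_add]
    exact Nat.mul_lt_mul_of_pos_right (hlt γ) (by positivity)
  · have : Def fun p : Ext (fun γ : Γ => Ctx.len γ ^ e) =>
        i p.1 ≤ p.2 ∧ (x p.1).testBit (p.2 - i p.1) = true :=
      Def.and (by fun_prop) ((hx.comp Def.fst').testBit (by fun_prop))
    refine this.congr_iff fun p => ?_
    rw [mul_comm, Nat.testBit_two_pow_mul]
    simp

theorem sum_testBit_two_pow (y T : ℕ) :
    ∑ i ∈ Finset.range T, (if y.testBit i = true then 2 ^ i else 0) = y % 2 ^ T := by
  induction T with
  | zero => simp [Nat.mod_one]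
  | succ T ih =>
    rw [Finset.sum_range_succ, ih, pow_succ, Nat.mod_mul, Nat.testBit_eq_decide_div_mod_eq]
    rcases Nat.mod_two_eq_zero_or_one (y / 2 ^ T) with h | h <;> simp [h]

theorem Big.mul {x y : Γ → ℕ} (hx : Big x) (hy : Big y) : Big fun γ => x γ * y γ := by
  obtain ⟨T, hTd, hT, hlt⟩ := hy.exists_bound
  have : Big fun γ => ∑ i ∈ Finset.range (T γ),
      if (y γ).testBit i = true then x γ * 2 ^ i else 0 :=
    Big.sum hTd hT (Big.ite ((hx.comp Def.fst').mul_two_pow (by fun_prop) hT.idx) (Big.const 0)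
      ((hy.comp Def.fst').testBit (by fun_prop)))
  refine this.congr fun γ => ?_
  conv_lhs => rw [← Nat.mod_eq_of_lt (hlt γ), ← sum_testBit_two_pow, Finset.mul_sum]
  exact Finset.sum_congr rfl fun i _ => by split_ifs <;> simp

theorem lt_iff_testBit {x y T : ℕ} (hx : x < 2 ^ T) (hy : y < 2 ^ T) : x < y ↔
    ∃ t < T, ¬ x.testBit t = true ∧ y.testBit t = true ∧
      ∀ s < T, t < s → (x.testBit s = true ↔ y.testBit s = true) := by
  have hbit : ∀ s, T ≤ s → x.testBit s = y.testBit s := fun s hs => by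
    have hp : 2 ^ T ≤ 2 ^ s := Nat.pow_le_pow_right (by omega) hs
    rw [Nat.testBit_lt_two_pow (hx.trans_le hp), Nat.testBit_lt_two_pow (hy.trans_le hp)]
  constructor
  · intro h
    obtain ⟨t, ht, hmax⟩ := Nat.exists_most_significant_bit
      (n := x ^^^ y) (fun h' => h.ne (Nat.xor_eq_zero_iff.1 h'))
    have hsame : ∀ s, t < s → x.testBit s = y.testBit s := fun s hs => by
      have := hmax s hs
      simpa [Nat.testBit_xor] using this
    rw [Nat.testBit_xor] at ht
    have htT : t < T := by
      by_contra! hc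
      rw [hbit t hc] at ht
      simp at ht
    refine ⟨t, htT, ?_⟩
    cases hxt : x.testBit t <;> cases hyt : y.testBit t <;> simp [hxt, hyt] at ht
    · exact ⟨by simp, by simp, fun s _ hs => by rw [hsame s hs]⟩
    · exact absurd (Nat.lt_of_testBit t hyt hxt fun s hs => (hsame s hs).symm) (by omega)
  · rintro ⟨t, htT, h1, h2, h3⟩
    refine Nat.lt_of_testBit t (by simpa using h1) h2 fun s hs => ?_
    by_cases hsT : s < T
    · exact Bool.eq_iff_iff.2 (h3 s hsT hs)
    · exact hbit s (by omega)

theorem Big.exists_bound₂ {x y : Γ → ℕ} (hx : Big x) (hy : Big y) : ∃ T : Γ → ℕ, Def T ∧ Small T ∧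
    ∀ γ, x γ < 2 ^ T γ ∧ y γ < 2 ^ T γ := by
  obtain ⟨T, hTd, hT, hxT⟩ := hx.exists_bound
  obtain ⟨T', hTd', hT', hyT⟩ := hy.exists_bound
  exact ⟨fun γ => T γ + T' γ, by fun_prop, hT.add hT', fun γ =>
    ⟨(hxT γ).trans_le (Nat.pow_le_pow_right (by omega) (Nat.le_add_right _ _)),
      (hyT γ).trans_le (Nat.pow_le_pow_right (by omega) (Nat.le_add_left _ _))⟩⟩

theorem Big.lt {x y : Γ → ℕ} (hx : Big x) (hy : Big y) : Def fun γ => x γ < y γ := by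
  obtain ⟨T, hTd, hT, hlt⟩ := hx.exists_bound₂ hy
  have : Def fun γ => ∃ t < T γ, ¬ (x γ).testBit t = true ∧ (y γ).testBit t = true ∧
      ∀ s < T γ, t < s → ((x γ).testBit s = true ↔ (y γ).testBit s = true) := by
    refine Def.bex hTd (Def.and ((hx.comp Def.fst').testBit Def.idx').not
      (Def.and ((hy.comp Def.fst').testBit Def.idx') (Def.ball (by fun_prop) ?_)))
    exact Def.imp (by fun_prop) (Def.iff ((hx.comp (Def.fst Def.fst')).testBit Def.idx')
      ((hy.comp (Def.fst Def.fst')).testBit Def.idx'))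
  exact this.congr_iff fun γ => lt_iff_testBit (hlt γ).1 (hlt γ).2

theorem Big.le {x y : Γ → ℕ} (hx : Big x) (hy : Big y) : Def fun γ => x γ ≤ y γ :=
  (hy.lt hx).not.congr_iff fun _ => not_lt.symm

/-- Subtraction, by addition of the two's complement. -/
theorem Big.sub {x y : Γ → ℕ} (hx : Big x) (hy : Big y) (hle : ∀ γ, y γ ≤ x γ) :
    Big fun γ => x γ - y γ := by
  obtain ⟨T, hTd, hT, hlt⟩ := hx.exists_bound₂ hy
  have hc : Big fun γ => 2 ^ T γ - (y γ + 1) := by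
    refine Big.of_testBit hT (fun γ => by have := (hlt γ).2; omega) fun e => ?_
    have : Def fun p : Ext (fun γ : Γ => Ctx.len γ ^ e) =>
        p.2 < T p.1 ∧ ¬ (y p.1).testBit p.2 = true :=
      Def.and (by fun_prop) ((hy.comp Def.fst').testBit Def.idx').not
    refine this.congr_iff fun p => ?_
    rw [Nat.testBit_two_pow_sub_succ (hlt p.1).2]
    simp
  have hs := (hx.add hc).add (Big.const 1)
  refine Big.of_testBit hT (fun γ => lt_of_le_of_lt (Nat.sub_le _ _) (hlt γ).1) fun e => ?_
  have : Def fun p : Ext (fun γ : Γ => Ctx.len γ ^ e) => p.2 < T p.1 ∧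
      (x p.1 + (2 ^ T p.1 - (y p.1 + 1)) + 1).testBit p.2 = true :=
    Def.and (by fun_prop) ((hs.comp Def.fst').testBit Def.idx')
  refine this.congr_iff fun p => ?_
  have h1 := hlt p.1
  have h2 := hle p.1
  rw [show x p.1 + (2 ^ T p.1 - (y p.1 + 1)) + 1 = 2 ^ T p.1 + (x p.1 - y p.1) by omega]
  by_cases h : p.2 < T p.1
  · simp [h, Nat.testBit_two_pow_add_gt h]
  · rw [Nat.testBit_lt_two_pow (x := x p.1 - y p.1) ((by omega : _ < 2 ^ T p.1).trans_le
      (Nat.pow_le_pow_right (by omega) (not_lt.1 h)))]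
    simp [h]

theorem Big.natCast {x p : Γ → ℕ} (hx : Big x) [∀ γ, NeZero (p γ)] (hp : Def p) (hps : Small p) :
    DefZ fun γ => ((x γ : ℕ) : ZMod (p γ)) := by
  obtain ⟨T, hTd, hT, hlt⟩ := hx.exists_bound
  have : DefZ fun γ => ∑ i ∈ Finset.range (T γ),
      if (x γ).testBit i = true then ((2 : ℕ) : ZMod (p γ)) ^ i else 0 :=
    DefZ.sum hTd hT hp hps (DefZ.ite ((hx.comp Def.fst').testBit Def.idx')
      (DefZ.pow (by fun_prop) hT.idx (hp.comp Def.fst') (hps.comp Def.fst')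
        (DefZ.natCast (hp.comp Def.fst') (Def.const 2))) (DefZ.zero (hp.comp Def.fst')))
  refine Def.congr this fun γ => ?_
  dsimp only
  conv_lhs => rw [← Nat.mod_eq_of_lt (hlt γ), ← sum_testBit_two_pow]
  push_cast
  rfl

end

/-! ### Small primes and coefficient extraction -/

theorem two_pow_le_pow_primesLE (n : ℕ) : 2 ^ n ≤ (n + 1) ^ ((Nat.primesLE n).card + 1) := by
  refine (Chebyshev.two_pow_le_mul_lcmUpto n).trans ?_
  rw [pow_succ, mul_comm]
  refine Nat.mul_le_mul_right _ ?_
  rw [Nat.lcmUpto_eq_prod_pow_log, ← Finset.prod_const]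
  refine Finset.prod_le_prod' fun p hp => ?_
  have := Nat.one_lt_of_mem_primesLE hp
  have := Nat.le_of_mem_primesLE hp
  exact (Nat.pow_log_le_self p (by omega)).trans (by omega)

/-- The moduli for computations with `L ^ a` bits. -/
def moduli (L a κ : ℕ) : Finset ℕ := {q ∈ Finset.range (L ^ κ) | q.Prime ∧ L ^ a < q}

theorem mem_moduli {L a κ q : ℕ} : q ∈ moduli L a κ ↔ q < L ^ κ ∧ q.Prime ∧ L ^ a < q := by
  simp [moduli]

/-- By Chebyshev's lower bound for the number of primes, polynomially large moduli suffice. -/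
theorem exists_moduli (a : ℕ) : ∃ κ, ∀ L, 2 ≤ L → 2 ^ L ^ a ≤ ∏ q ∈ moduli L a κ, q := by
  refine ⟨2 * a + 12, fun L hL => ?_⟩
  set κ := 2 * a + 12 with hκ
  set n := L ^ κ - 1 with hn
  have hpos : 0 < L ^ κ := by positivity
  have h1 : 2 ^ n ≤ 2 ^ (L * κ * ((Nat.primesLE n).card + 1)) := by
    refine (two_pow_le_pow_primesLE n).trans ?_
    rw [pow_mul]
    refine Nat.pow_le_pow_left ?_ _
    rw [pow_mul, show n + 1 = L ^ κ by omega]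
    exact Nat.pow_le_pow_left Nat.lt_two_pow_self.le _
  have h2 : n ≤ L * κ * ((Nat.primesLE n).card + 1) := (Nat.pow_le_pow_iff_right (by omega)).1 h1
  have h3 : L * κ * (2 * L ^ a + 2) ≤ n := by
    have e1 : 1 ≤ L ^ a := Nat.one_le_pow _ _ (by omega)
    have e2 : κ + 1 ≤ L ^ (a + 8) := by
      calc κ + 1 = 2 * a + 13 := by omega
        _ ≤ 2 ^ (a + 8) := by
          have : a < 2 ^ a := Nat.lt_two_pow_self
          rw [pow_add]
          omega
        _ ≤ _ := Nat.pow_le_pow_left hL _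
    have e3 : 2 * L ^ a + 2 ≤ L ^ (a + 2) := by
      have : 4 ≤ L ^ 2 := by nlinarith
      rw [pow_add]
      nlinarith
    have e4 : L * κ * (2 * L ^ a + 2) + 1 ≤ L * (κ + 1) * L ^ (a + 2) := by
      have : 0 < L * L ^ (a + 2) := by positivity
      calc L * κ * (2 * L ^ a + 2) + 1 ≤ L * κ * L ^ (a + 2) + L * L ^ (a + 2) :=
            Nat.add_le_add (Nat.mul_le_mul_left _ e3) this
        _ = _ := by ring
    have e5 : L * (κ + 1) * L ^ (a + 2) ≤ L ^ κ := by
      calc L * (κ + 1) * L ^ (a + 2) ≤ L * L ^ (a + 8) * L ^ (a + 2) :=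
            Nat.mul_le_mul_right _ (Nat.mul_le_mul_left _ e2)
        _ = L ^ (2 * a + 11) := by ring
        _ ≤ L ^ κ := Nat.pow_le_pow_right (by omega) (by omega)
    omega
  have h4 : 2 * L ^ a + 1 ≤ (Nat.primesLE n).card := by
    have h5 := h3.trans h2
    have : 0 < L * κ := by positivity
    have := Nat.le_of_mul_le_mul_left h5 this
    omega
  have h6 : Nat.primesLE n ⊆ moduli L a κ ∪ Finset.range (L ^ a + 1) := fun q hq => by
    rw [Nat.mem_primesLE] at hq
    rw [Finset.mem_union, mem_moduli, Finset.mem_range]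
    by_cases h : L ^ a < q
    · exact Or.inl ⟨by omega, hq.2, h⟩
    · exact Or.inr (by omega)
  have h7 : L ^ a ≤ (moduli L a κ).card := by
    have := (Finset.card_le_card h6).trans (Finset.card_union_le _ _)
    rw [Finset.card_range] at this
    omega
  calc 2 ^ L ^ a ≤ 2 ^ (moduli L a κ).card := Nat.pow_le_pow_right (by omega) h7
    _ ≤ ∏ q ∈ moduli L a κ, q := by
      rw [← Finset.prod_const]
      exact Finset.prod_le_prod' fun q hq => (mem_moduli.1 hq).2.1.two_le

theorem modEq_prod_primes {S : Finset ℕ} (hS : ∀ q ∈ S, q.Prime) {x y : ℕ}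
    (h : ∀ q ∈ S, x ≡ y [MOD q]) : x ≡ y [MOD ∏ q ∈ S, q] := by
  rw [Nat.modEq_iff_dvd]
  have : (∏ q ∈ S, (q : ℤ)) ∣ (y : ℤ) - x :=
    Finset.prod_dvd_of_coprime (fun q hq q' hq' hne => Nat.isCoprime_iff_coprime.2
      ((Nat.coprime_primes (hS q hq) (hS q' hq')).2 hne)) fun q hq => Nat.modEq_iff_dvd.1 (h q hq)
  rwa [Nat.cast_prod]

theorem ZMod.sum_range_pow {q : ℕ} [Fact q.Prime] {j : ℕ} (hj : 0 < j) :
    ∑ v ∈ Finset.range q, (v : ZMod q) ^ j = if q - 1 ∣ j then -1 else 0 := by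
  classical
  have h := FiniteField.sum_pow_units (ZMod q) j
  rw [ZMod.card] at h
  rw [← h]
  have h1 : ∑ v ∈ Finset.range q, (v : ZMod q) ^ j = ∑ x : ZMod q, x ^ j := by
    refine Finset.sum_nbij' (fun v => (v : ZMod q)) (fun x => x.val) (by simp) ?_ ?_
      (by simp) (by simp)
    · exact fun x _ => Finset.mem_range.2 (ZMod.val_lt x)
    · exact fun v hv => ZMod.val_cast_of_lt (Finset.mem_range.1 hv)
  rw [h1, ← Finset.sum_subset (Finset.subset_univ ({0}ᶜ : Finset (ZMod q)))]
  · symm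
    refine Finset.sum_bij (fun x _ => (x : ZMod q)) (fun x _ => by simp)
      (fun x _ y _ h => Units.ext h) (fun x hx => ?_) (fun _ _ => rfl)
    exact ⟨Units.mk0 x (by simpa using hx), by simp, rfl⟩
  · intro x _ hx
    have : x = 0 := by simpa using hx
    rw [this, zero_pow hj.ne']

/-- Coefficients of a polynomial over a prime field of large order are power sums of its values. -/
theorem coeff_eq_neg_sum_eval {q : ℕ} [Fact q.Prime] (f : (ZMod q)[X]) (hf : f.natDegree < q - 1)
    {t : ℕ} (ht : t < q - 1) :
    f.coeff t = -∑ v ∈ Finset.range q, (v : ZMod q) ^ (q - 1 - t) * f.eval (v : ZMod q) := by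
  have h1 : ∀ v : ZMod q, v ^ (q - 1 - t) * f.eval v =
      ∑ s ∈ Finset.range (q - 1), f.coeff s * v ^ (q - 1 - t + s) := fun v => by
    rw [eval_eq_sum_range' hf, Finset.mul_sum]
    exact Finset.sum_congr rfl fun s _ => by ring
  simp only [h1]
  rw [Finset.sum_comm]
  simp only [← Finset.mul_sum]
  rw [Finset.sum_eq_single t]
  · rw [ZMod.sum_range_pow (by omega), if_pos (by rw [Nat.sub_add_cancel ht.le])]
    simp
  · intro s hs hst
    rw [Finset.mem_range] at hs
    rw [ZMod.sum_range_pow (by omega), if_neg, mul_zero]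
    rintro ⟨c, hc⟩
    have : c = 1 := by
      rcases c with - | - | c
      · omega
      · rfl
      · have : 2 * (q - 1) ≤ (q - 1) * (c + 1 + 1) := by nlinarith
        omega
    subst this
    omega
  · intro h
    exact absurd (Finset.mem_range.2 ht) h

/-! ### Iterated multiplication -/

section

variable {Γ Δ : Type} [Ctx Γ] [Ctx Δ]

@[fun_prop]
theorem Def.prime {f : Γ → ℕ} (hf : Def f) : Def fun γ => (f γ).Prime := by
  have : Def fun γ => 2 ≤ f γ ∧ ∀ a < f γ, ∀ b < f γ, a * b ≠ f γ := by
    refine Def.and (by fun_prop) (Def.ball hf (Def.ball (by fun_prop) (Def.not ?_)))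
    fun_prop
  refine this.congr_iff fun γ => ?_
  rw [Nat.prime_def]
  refine and_congr_right fun h2 => ⟨fun h a ha b hb hab => ?_, fun h m hm => ?_⟩
  · rcases h a ⟨b, hab.symm⟩ with rfl | rfl
    · omega
    · omega
  · obtain ⟨b, hb⟩ := hm
    by_contra! hc
    have hpos : 0 < m * b := by omega
    have hm0 : 0 < m := Nat.pos_of_mul_pos_right hpos
    have hb0 : 0 < b := Nat.pos_of_mul_pos_left hpos
    refine h m ?_ b ?_ hb.symm
    · exact lt_of_le_of_ne (Nat.le_of_dvd (by omega) ⟨b, hb⟩) hc.2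
    · rw [hb]
      nlinarith [show 2 ≤ m by omega]

/-- The context with one more variable, which is one of the moduli. -/
abbrev ExtPrime (Γ : Type) [Ctx Γ] (a κ : ℕ) : Type :=
  {p : Ext (fun γ : Γ => Ctx.len γ ^ κ) // p.2.Prime ∧ Ctx.len p.1 ^ a < p.2}

instance {a κ : ℕ} (m : ExtPrime Γ a κ) : Fact m.1.2.Prime := ⟨m.2.1⟩

theorem ExtPrime.small {a κ : ℕ} : Small fun m : ExtPrime Γ a κ => m.1.2 :=
  ⟨κ, fun m => m.1.3.le⟩

/-- A number with logarithmically many bits can be guessed if its residues modulo small primes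
are known. -/
theorem Def.of_residues {x B : Γ → ℕ} {a κ : ℕ} (hB : Def B) (hlt : ∀ γ, x γ < B γ)
    (hprod : ∀ γ : Γ, B γ ≤ ∏ q ∈ moduli (Ctx.len γ) a κ, q)
    (hx : DefZ fun m : ExtPrime Γ a κ => (x m.1.1 : ZMod m.1.2)) : Def x := by
  refine Def.of_graph hB hlt ?_
  have : Def fun p : Ext B => ∀ q < Ctx.len p.1 ^ κ, q.Prime ∧ Ctx.len p.1 ^ a < q →
      p.2 % q = x p.1 % q := by
    refine Def.ball (by fun_prop) (Def.imp_subtype (by fun_prop) (Def.eq (by fun_prop) ?_))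
    have := Def.comp (f := fun m : ExtPrime Γ a κ => (x m.1.1 : ZMod m.1.2).val) hx
      (h := fun r : {p : Ext (fun p : Ext B => Ctx.len p.1 ^ κ) //
          p.2.Prime ∧ Ctx.len p.1.1 ^ a < p.2} =>
        ⟨⟨r.1.1.1, r.1.2, r.1.3⟩, r.2⟩) (Def.subtype_mk (Def.mk (by fun_prop) (by fun_prop) _) _)
    simpa only [ZMod.val_natCast] using this
  refine this.congr_iff fun p => ⟨fun h q _ _ => by rw [h], fun h => ?_⟩
  have h1 : p.2 ≡ x p.1 [MOD ∏ q ∈ moduli (Ctx.len p.1) a κ, q] :=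
    modEq_prod_primes (fun q hq => (ACZero.mem_moduli.1 hq).2.1) fun q hq =>
      h q (ACZero.mem_moduli.1 hq).1 (ACZero.mem_moduli.1 hq).2
  exact h1.eq_of_lt_of_lt (p.3.trans_le (hprod p.1)) ((hlt p.1).trans_le (hprod p.1))

/-- Extension of a number that is definable on a definable subset of a context. -/
theorem Big.ite_subtype {P : Γ → Prop} (hP : Def P) {x y : Γ → ℕ}
    (hx : Big fun p : Subtype P => x p.1) (hy : Big y) [∀ γ, Decidable (P γ)] :
    Big fun γ => if P γ then x γ else y γ := by
  obtain ⟨T, -, ⟨c, hc⟩, hyT⟩ := hy.exists_bound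
  have hx₀ := hx
  obtain ⟨e, hlt, -⟩ := hx₀
  refine Big.of_testBit (T := fun γ => Ctx.len γ ^ e + Ctx.len γ ^ c)
    (Small.add ⟨e, fun _ => le_rfl⟩ ⟨c, fun _ => le_rfl⟩) (fun γ => ?_) fun e => ?_
  · split_ifs with h
    · exact (hlt ⟨γ, h⟩).trans_le (Nat.pow_le_pow_right (by omega) (Nat.le_add_right _ _))
    · exact (hyT γ).trans_le (Nat.pow_le_pow_right (by omega)
        ((hc γ).trans (Nat.le_add_left _ _)))
  · have hP' : Def fun p : Ext (fun γ : Γ => Ctx.len γ ^ e) => P p.1 := hP.comp Def.fst'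
    have h1 := (hP'.and_subtype (Q := fun p => (x p.1).testBit p.2 = true) (Big.testBit
      (Big.comp hx (h := fun q : {p : Ext (fun γ : Γ => Ctx.len γ ^ e) // P p.1} =>
        (⟨q.1.1, q.2⟩ : Subtype P)) (Def.subtype_mk (by fun_prop) _)) (by fun_prop))).or
      (hP'.not.and ((hy.comp Def.fst').testBit Def.idx'))
    refine h1.congr_iff fun p => ?_
    split_ifs with h <;> simp [h]

/-- The product of the polynomials whose coefficients are the lowest `T` bits of the `x i`. -/
noncomputable def bitPoly (R : Type) [CommSemiring R] (x : ℕ → ℕ) (T M : ℕ) : R[X] :=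
  ∏ i ∈ Finset.range M, ∑ s ∈ Finset.range T, if (x i).testBit s = true then X ^ s else 0

theorem natDegree_bitPoly (R : Type) [CommSemiring R] (x : ℕ → ℕ) (T M : ℕ) :
    (bitPoly R x T M).natDegree ≤ M * T := by
  refine (natDegree_prod_le _ _).trans ?_
  refine (Finset.sum_le_card_nsmul _ _ T fun i _ => ?_).trans (by simp)
  refine natDegree_sum_le_of_forall_le _ _ fun s hs => ?_
  split_ifs
  · exact (natDegree_X_pow_le s).trans (Finset.mem_range.1 hs).le
  · simp

theorem map_bitPoly {R R' : Type} [CommSemiring R] [CommSemiring R'] (f : R →+* R') (x : ℕ → ℕ)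
    (T M : ℕ) : (bitPoly R x T M).map f = bitPoly R' x T M := by
  simp only [bitPoly, Polynomial.map_prod, Polynomial.map_sum]
  refine Finset.prod_congr rfl fun i _ => Finset.sum_congr rfl fun s _ => ?_
  split_ifs <;> simp

theorem eval_bitPoly {R : Type} [CommSemiring R] (x : ℕ → ℕ) (T M : ℕ) (v : R) :
    (bitPoly R x T M).eval v =
      ∏ i ∈ Finset.range M, ∑ s ∈ Finset.range T, if (x i).testBit s = true then v ^ s else 0 := by
  simp only [bitPoly, eval_prod, eval_finsetSum]
  refine Finset.prod_congr rfl fun i _ => Finset.sum_congr rfl fun s _ => ?_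
  split_ifs <;> simp

theorem coeff_bitPoly_le (x : ℕ → ℕ) (T M t : ℕ) : (bitPoly ℕ x T M).coeff t ≤ T ^ M := by
  calc (bitPoly ℕ x T M).coeff t ≤ (bitPoly ℕ x T M).eval 1 := by
        by_cases ht : t ∈ (bitPoly ℕ x T M).support
        · rw [eval_eq_sum, Polynomial.sum]
          simpa using Finset.single_le_sum (f := fun e => (bitPoly ℕ x T M).coeff e * 1 ^ e)
            (fun _ _ => Nat.zero_le _) ht
        · rw [notMem_support_iff.1 ht]
          exact Nat.zero_le _
    _ ≤ ∏ _i ∈ Finset.range M, T := by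
        rw [eval_bitPoly]
        refine Finset.prod_le_prod' fun i _ => ?_
        refine (Finset.sum_le_card_nsmul _ _ 1 fun s _ => by split_ifs <;> simp).trans (by simp)
    _ = T ^ M := by simp

/-- Iterated multiplication of at most `Ctx.block` numbers. The factors are read as polynomials
with coefficients zero and one. The product of these polynomials has coefficients with
logarithmically many bits, which are known modulo small primes. -/
theorem Big.prod_of_le_block {M : Γ → ℕ} {x : Γ → ℕ → ℕ} (hM : Def M) (hMb : ∀ γ, M γ ≤ Ctx.block γ)
    (hx : Big fun p : Ext M => x p.1 p.2) : Big fun γ => ∏ i ∈ Finset.range (M γ), x γ i := by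
  have hx₀ := hx
  obtain ⟨e, hlt, -⟩ := hx₀
  let T : Γ → ℕ := fun γ => Ctx.len γ ^ e
  have hT : Def T := by fun_prop
  have hTs : Small T := ⟨e, fun _ => le_rfl⟩
  have hMs : Small M := ⟨1, fun γ => by rw [pow_one]; exact (hMb γ).trans (Ctx.block_le_len γ)⟩
  let D : Γ → ℕ := fun γ => M γ * T γ + 1
  have hD : Def D := by fun_prop
  have hDs : Small D := (hMs.mul hTs).add (Small.const 1)
  -- the size of the coefficients
  have hcoeff : ∀ γ t, (bitPoly ℕ (x γ) (T γ) (M γ)).coeff t < 2 ^ (e * 4 * Ctx.len γ + 1) := by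
    intro γ t
    refine ((coeff_bitPoly_le _ _ _ _).trans ?_).trans_lt
        (Nat.pow_lt_pow_right (by omega) (Nat.lt_succ_self _))
    calc T γ ^ M γ ≤ (2 ^ (e * (Ctx.len γ).size)) ^ M γ :=
          Nat.pow_le_pow_left (Ctx.pow_len_le_two_pow γ e) _
      _ = 2 ^ (e * ((Ctx.len γ).size * M γ)) := by rw [← pow_mul, mul_assoc]
      _ ≤ 2 ^ (e * 4 * Ctx.len γ) := by
        refine Nat.pow_le_pow_right (by omega) ?_
        rw [mul_assoc]
        refine Nat.mul_le_mul_left _ ((Nat.mul_le_mul_left _ ?_).trans (Ctx.size_len_mul_le γ))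
        have := hMb γ
        omega
  have hC : Small fun γ : Γ => e * 4 * Ctx.len γ + 1 + (D γ + 2) :=
    (((Small.const (e * 4)).mul Small.len).add (Small.const 1)).add (hDs.add (Small.const 2))
  obtain ⟨a, ha⟩ := hC
  obtain ⟨κ, hκ⟩ := exists_moduli a
  have hc : Def fun p : Ext D => (bitPoly ℕ (x p.1) (T p.1) (M p.1)).coeff p.2 := by
    refine Def.of_residues (B := fun p => 2 ^ (e * 4 * Ctx.len p + 1)) (a := a) (κ := κ)
      (Def.two_pow_of_le (C := e * 4 + 1) (by fun_prop) fun p => ?_) (fun p => hcoeff p.1 p.2)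
      (fun p => ?_) ?_
    · have := Ctx.two_le_len p
      nlinarith
    · refine le_trans ?_ (hκ _ (Ctx.two_le_len p))
      refine Nat.pow_le_pow_right (by omega) (le_trans ?_ (ha p.1))
      exact Nat.le_add_right _ _
    · let q : ExtPrime (Ext D) a κ → ℕ := fun m => m.1.2
      have hq : Def q := by fun_prop
      have hqs : Small q := ExtPrime.small
      have h : DefZ fun m : ExtPrime (Ext D) a κ => -∑ v ∈ Finset.range m.1.2,
          (v : ZMod m.1.2) ^ (m.1.2 - 1 - m.1.1.2) * ∏ i ∈ Finset.range (M m.1.1.1),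
            ∑ s ∈ Finset.range (T m.1.1.1),
              if (x m.1.1.1 i).testBit s = true then (v : ZMod m.1.2) ^ s else 0 := by
        refine DefZ.neg hq (DefZ.sum hq hqs hq hqs ?_)
        have hq' : Def fun r : Ext (fun m : ExtPrime (Ext D) a κ => m.1.2) => q r.1 := by fun_prop
        have hqs' : Small fun r : Ext (fun m : ExtPrime (Ext D) a κ => m.1.2) => q r.1 :=
          hqs.comp Def.fst'
        refine DefZ.mul hq' (DefZ.pow (by fun_prop)
            (hqs'.mono fun r => (Nat.sub_le _ _).trans (Nat.sub_le _ _))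
          hq' hqs'
          (DefZ.natCast hq' (by fun_prop))) ?_
        refine DefZ.prod (by fun_prop) (hMs.comp (by fun_prop)) hq' hqs' ?_
        refine DefZ.sum (by fun_prop) (hTs.comp (by fun_prop)) (hq'.comp Def.fst')
          (hqs'.comp Def.fst') ?_
        refine DefZ.ite (Big.testBit ?_ (by fun_prop)) (DefZ.pow (by fun_prop)
          (Small.idx (hTs.comp (by fun_prop))) ?_ ?_ (DefZ.natCast ?_ (by fun_prop))) (DefZ.zero ?_)
        · exact Big.at₁ (x := x) hx (by fun_prop) (by fun_prop) fun r => r.1.3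
        · exact hq'.comp (Def.fst Def.fst')
        · exact hqs'.comp (Def.fst Def.fst')
        · exact hq'.comp (Def.fst Def.fst')
        · exact hq'.comp (Def.fst Def.fst')
      refine Def.congr h fun m => ?_
      have hm : Ctx.len m.1.1.1 ^ a < m.1.2 := m.2.2
      have h1 : e * 4 * Ctx.len m.1.1.1 + 1 + (D m.1.1.1 + 2) ≤ Ctx.len m.1.1.1 ^ a := ha m.1.1.1
      have h3 := m.1.1.3
      have h4 : D m.1.1.1 < m.1.2 - 1 := by omega
      have key := coeff_eq_neg_sum_eval (q := m.1.2)
        (bitPoly (ZMod m.1.2) (x m.1.1.1) (T m.1.1.1) (M m.1.1.1))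
        ((natDegree_bitPoly _ _ _ _).trans_lt (by simp only [D] at h4; omega))
        (t := m.1.1.2) (by omega)
      simp only [eval_bitPoly] at key
      dsimp only
      rw [← key, ← map_bitPoly (Nat.castRingHom (ZMod m.1.2)), coeff_map]
      rfl
  have hsum : Big fun γ => ∑ t ∈ Finset.range (D γ),
      (bitPoly ℕ (x γ) (T γ) (M γ)).coeff t * 2 ^ t := by
    refine Big.sum hD hDs (Big.mul_two_pow (Big.of_def hc
      (T := fun p => e * 4 * Ctx.len p + 1) ?_ fun p => hcoeff p.1 p.2) (by fun_prop) hDs.idx)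
    exact ((Small.const (e * 4)).mul Small.len).add (Small.const 1)
  refine hsum.congr fun γ => ?_
  have h1 := eval_bitPoly (x γ) (T γ) (M γ) (2 : ℕ)
  rw [eval_eq_sum_range' (Nat.lt_succ_of_le (natDegree_bitPoly ℕ (x γ) (T γ) (M γ)))] at h1
  rw [h1]
  refine Finset.prod_congr rfl fun i hi => ?_
  rw [sum_testBit_two_pow]
  exact (Nat.mod_eq_of_lt (hlt ⟨γ, i, Finset.mem_range.1 hi⟩)).symm

theorem prod_range_mul {α : Type} [CommMonoid α] (f : ℕ → α) (n m : ℕ) :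
    ∏ i ∈ Finset.range (n * m), f i =
      ∏ j ∈ Finset.range n, ∏ i ∈ Finset.range m, f (j * m + i) := by
  induction n with
  | zero => simp
  | succ n ih => rw [Nat.succ_mul, Finset.prod_range_add, ih, Finset.prod_range_succ]

/-- Iterated multiplication, in constantly many rounds. -/
theorem Big.prod {M : Γ → ℕ} {x : Γ → ℕ → ℕ} (hM : Def M) (hMs : Small M)
    (hx : Big fun p : Ext M => x p.1 p.2) : Big fun γ => ∏ i ∈ Finset.range (M γ), x γ i := by
  obtain ⟨R, hR⟩ := hMs.le_block_pow
  have main : ∀ (r : ℕ) {Δ : Type} [Ctx Δ] (h : Δ → Γ) (s : Δ → ℕ), Def h → Def s →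
      Big fun δ => ∏ i ∈ Finset.range (Ctx.block δ ^ r),
        if s δ + i < M (h δ) then x (h δ) (s δ + i) else 1 := by
    intro r
    induction r with
    | zero =>
      intro Δ _ h s hh hs
      have := Big.ite_subtype (P := fun δ => s δ < M (h δ)) (x := fun δ => x (h δ) (s δ))
          (by fun_prop)
        (Big.at₁ (Γ := {δ // s δ < M (h δ)}) (x := x) hx (h := fun p => h p.1) (i := fun p => s p.1)
          (by fun_prop) (by fun_prop) fun p => p.2) (Big.const 1)
      simpa using this
    | succ r ih =>
      intro Δ _ h s hh hs
      have h1 := Big.prod_of_le_block (M := fun δ : Δ => Ctx.block δ)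
        (x := fun δ j => ∏ i ∈ Finset.range (Ctx.block δ ^ r),
          if s δ + j * Ctx.block δ ^ r + i < M (h δ)
            then x (h δ) (s δ + j * Ctx.block δ ^ r + i) else 1)
        (by fun_prop) (fun δ => le_rfl)
        (ih (fun p : Ext (fun δ : Δ => Ctx.block δ) => h p.1)
          (fun p => s p.1 + p.2 * Ctx.block p.1 ^ r) (by fun_prop) (by fun_prop))
      refine h1.congr fun δ => ?_
      rw [pow_succ', prod_range_mul]
      simp only [add_assoc]
  refine (main R (fun γ => γ) (fun _ => 0) (by fun_prop) (by fun_prop)).congr fun γ => ?_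
  obtain ⟨d, hd⟩ := Nat.exists_eq_add_of_le (hR γ)
  rw [hd, Finset.prod_range_add]
  rw [Finset.prod_eq_one (s := Finset.range d) fun i _ => by simp, mul_one]
  exact Finset.prod_congr rfl fun i hi => by simp [Finset.mem_range.1 hi]

end

/-! ### Chinese remaindering -/

section

variable {Γ Δ : Type} [Ctx Γ] [Ctx Δ]

theorem moduli_prime {L a κ : ℕ} : ∀ q ∈ moduli L a κ, q.Prime := fun _ hq => (mem_moduli.1 hq).2.1

/-- The coefficient of the Chinese remainder representation of `x` at the modulus `r`. -/
noncomputable def crtCoeff (S : Finset ℕ) (x r : ℕ) : ℕ :=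
  ((x : ZMod r) * (((∏ q ∈ S.erase r, q : ℕ) : ZMod r))⁻¹).val

theorem cast_prod_erase_ne_zero {S : Finset ℕ} (hS : ∀ q ∈ S, q.Prime) {r : ℕ} [Fact r.Prime] :
    ((∏ q ∈ S.erase r, q : ℕ) : ZMod r) ≠ 0 := by
  rw [Nat.cast_prod, Finset.prod_ne_zero_iff]
  intro q hq h
  rw [Finset.mem_erase] at hq
  rw [ZMod.natCast_eq_zero_iff] at h
  exact hq.1 ((Nat.prime_dvd_prime_iff_eq Fact.out (hS q hq.2)).1 h).symm

theorem eq_crtCoeff_iff {S : Finset ℕ} (hS : ∀ q ∈ S, q.Prime) {r : ℕ} [Fact r.Prime] {x u : ℕ}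
    (hu : u < r) :
    u = crtCoeff S x r ↔ (u : ZMod r) * ((∏ q ∈ S.erase r, q : ℕ) : ZMod r) = x := by
  have h0 := cast_prod_erase_ne_zero hS (r := r)
  rw [← eq_mul_inv_iff_mul_eq₀ h0, crtCoeff]
  constructor
  · intro h
    rw [h, ZMod.natCast_zmod_val]
  · intro h
    rw [← h, ZMod.val_cast_of_lt hu]

theorem crtCoeff_lt {S : Finset ℕ} {r x : ℕ} [Fact r.Prime] : crtCoeff S x r < r := ZMod.val_lt _

theorem sum_crtCoeff_mod {S : Finset ℕ} (hS : ∀ q ∈ S, q.Prime) {x : ℕ} (hx : x < ∏ q ∈ S, q) :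
    (∑ r ∈ S, crtCoeff S x r * ∏ q ∈ S.erase r, q) % ∏ q ∈ S, q = x := by
  rw [← Nat.mod_eq_of_lt hx]
  refine modEq_prod_primes hS fun r hr => ?_
  have : Fact r.Prime := ⟨hS r hr⟩
  rw [Nat.mod_eq_of_lt hx, ← ZMod.natCast_eq_natCast_iff, Nat.cast_sum,
    Finset.sum_eq_single_of_mem r hr]
  · rw [Nat.cast_mul]
    exact (eq_crtCoeff_iff hS crtCoeff_lt).1 rfl
  · intro r' hr' hne
    rw [ZMod.natCast_eq_zero_iff]
    exact Dvd.dvd.mul_left (Finset.dvd_prod_of_mem _ (Finset.mem_erase.2 ⟨hne.symm, hr⟩)) _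

theorem sum_crtCoeff_div_le {S : Finset ℕ} (hS : ∀ q ∈ S, q.Prime) (x : ℕ) :
    (∑ r ∈ S, crtCoeff S x r * ∏ q ∈ S.erase r, q) / ∏ q ∈ S, q ≤ S.card := by
  refine Nat.div_le_of_le_mul ?_
  rw [mul_comm, ← smul_eq_mul]
  refine Finset.sum_le_card_nsmul _ _ _ fun r hr => ?_
  have : Fact r.Prime := ⟨hS r hr⟩
  rw [← Finset.mul_prod_erase S _ hr]
  exact Nat.mul_le_mul_right _ crtCoeff_lt.le

/-- A number whose residues modulo small primes are definable has definable bits. -/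
theorem Big.of_residues {x : Γ → ℕ} (a κ : ℕ)
    (hlt : ∀ γ, x γ < ∏ q ∈ moduli (Ctx.len γ) a κ, q)
    (hx : DefZ fun m : ExtPrime Γ a κ => (x m.1.1 : ZMod m.1.2)) : Big x := by
  have hK : Def fun γ : Γ => Ctx.len γ ^ κ := by fun_prop
  have hKs : Small fun γ : Γ => Ctx.len γ ^ κ := ⟨κ, fun _ => le_rfl⟩
  have hP : Big fun γ : Γ => ∏ q ∈ moduli (Ctx.len γ) a κ, q := by
    have : Big fun γ : Γ => ∏ q ∈ Finset.range (Ctx.len γ ^ κ),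
        if q.Prime ∧ Ctx.len γ ^ a < q then q else 1 :=
      Big.prod hK hKs (Big.ite (Big.of_small (by fun_prop) hKs.idx) (Big.const 1) (by fun_prop))
    exact this.congr fun γ => by rw [moduli, Finset.prod_filter]
  have hC : Big fun m : ExtPrime Γ a κ => ∏ q ∈ (moduli (Ctx.len m.1.1) a κ).erase m.1.2, q := by
    have : Big fun m : ExtPrime Γ a κ => ∏ q ∈ Finset.range (Ctx.len m.1.1 ^ κ),
        if (q.Prime ∧ Ctx.len m.1.1 ^ a < q) ∧ ¬ q = m.1.2 then q else 1 :=
      Big.prod (by fun_prop) (hKs.comp (h := fun m : ExtPrime Γ a κ => m.1.1) (by fun_prop))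
        (Big.ite (Big.of_small (by fun_prop) (Small.idx
            (hKs.comp (h := fun m : ExtPrime Γ a κ => m.1.1)
          (by fun_prop)))) (Big.const 1) (by fun_prop))
    refine this.congr fun m => ?_
    rw [← Finset.prod_filter, ← Finset.filter_filter, ← Finset.filter_ne']
    rfl
  have hq : Def fun m : ExtPrime Γ a κ => m.1.2 := by fun_prop
  have hu : Def fun m : ExtPrime Γ a κ =>
      crtCoeff (moduli (Ctx.len m.1.1) a κ) (x m.1.1) m.1.2 := by
    refine Def.of_graph hq (fun m => crtCoeff_lt) ?_
    have : Def fun p : Ext fun m : ExtPrime Γ a κ => m.1.2 => (p.2 : ZMod p.1.1.2) *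
        ((∏ q ∈ (moduli (Ctx.len p.1.1.1) a κ).erase p.1.1.2, q : ℕ) : ZMod p.1.1.2) =
          (x p.1.1.1 : ZMod p.1.1.2) := by
      have hq' : Def fun p : Ext fun m : ExtPrime Γ a κ => m.1.2 => p.1.1.2 := by fun_prop
      refine DefZ.eq (DefZ.mul hq' (DefZ.natCast hq' (by fun_prop)) ?_) (DefZ.comp hx Def.fst')
      exact DefZ.comp (hC.natCast hq ExtPrime.small) Def.fst'
    exact this.congr_iff fun p => eq_crtCoeff_iff moduli_prime p.3
  have hS : Big fun γ : Γ => ∑ r ∈ moduli (Ctx.len γ) a κ,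
      crtCoeff (moduli (Ctx.len γ) a κ) (x γ) r * ∏ q ∈ (moduli (Ctx.len γ) a κ).erase r, q := by
    have : Big fun γ : Γ => ∑ r ∈ Finset.range (Ctx.len γ ^ κ),
        if r.Prime ∧ Ctx.len γ ^ a < r then crtCoeff (moduli (Ctx.len γ) a κ) (x γ) r *
          ∏ q ∈ (moduli (Ctx.len γ) a κ).erase r, q else 0 := by
      refine Big.sum hK hKs (Big.ite_subtype (P := fun p : Ext (fun γ : Γ => Ctx.len γ ^ κ) =>
        p.2.Prime ∧ Ctx.len p.1 ^ a < p.2) (x := fun p =>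
          crtCoeff (moduli (Ctx.len p.1) a κ) (x p.1) p.2 * ∏ q ∈ (moduli (Ctx.len p.1) a κ).erase p.2, q) (by fun_prop) ?_ (Big.const 0))
      exact Big.mul (Big.of_small hu (ExtPrime.small.mono fun m => crtCoeff_lt.le)) hC
    exact this.congr fun γ => by rw [← Finset.sum_filter]; rfl
  generalize hS' : (fun γ : Γ => ∑ r ∈ moduli (Ctx.len γ) a κ,
      crtCoeff (moduli (Ctx.len γ) a κ) (x γ) r *
        ∏ q ∈ (moduli (Ctx.len γ) a κ).erase r, q) = S at hS
  generalize hP' : (fun γ : Γ => ∏ q ∈ moduli (Ctx.len γ) a κ, q) = P at hP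
  have hmod : ∀ γ, S γ % P γ = x γ := fun γ => by
    rw [← hS', ← hP']
    exact sum_crtCoeff_mod moduli_prime (hlt γ)
  have hdiv : ∀ γ, S γ / P γ < Ctx.len γ ^ κ + 1 := fun γ => by
    rw [← hS', ← hP']
    refine Nat.lt_succ_of_le ((sum_crtCoeff_div_le moduli_prime _).trans ?_)
    exact (Finset.card_filter_le _ _).trans (by simp)
  have hpos : ∀ γ, 0 < P γ := fun γ => by rw [← hP']; exact (Nat.zero_le _).trans_lt (hlt γ)
  have hr : Def fun γ => S γ / P γ := by
    refine Def.of_graph (B := fun γ => Ctx.len γ ^ κ + 1) (by fun_prop) hdiv ?_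
    have hi : Big fun p : Ext (fun γ : Γ => Ctx.len γ ^ κ + 1) => p.2 :=
      Big.of_small (by fun_prop) (Small.idx (hKs.add (Small.const 1)))
    have h1 := ((hi.mul (hP.comp Def.fst')).le (hS.comp Def.fst')).and
      ((hS.comp Def.fst').lt ((hi.add (Big.const 1)).mul (hP.comp Def.fst')))
    refine h1.congr_iff fun p => ?_
    rw [eq_comm, Nat.div_eq_iff (hpos _)]
    have := hpos p.1
    rw [Nat.add_mul, one_mul]
    omega
  have hr' : Big fun γ => S γ / P γ :=
    Big.of_small hr ((hKs.add (Small.const 1)).mono fun γ => (hdiv γ).le)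
  refine (hS.sub (hr'.mul hP) fun γ => Nat.div_mul_le_self _ _).congr fun γ => ?_
  rw [← hmod γ]
  have := Nat.div_add_mod' (S γ) (P γ)
  omega

end

/-! ### Powers of matrices over prime fields -/

section

variable {F : Type} [Field F] {l : ℕ}

/-- `N / D` is the generating function of the entries `(a, b)` of the powers of `M`, in the sense
that `N z / D z` is the entry `a` of the solution of `(1 - z M) x = e_b` for all `z`. -/
def IsResolvent (M : Matrix (Fin l) (Fin l) F) (a b : Fin l) (N D : F[X]) : Prop :=
  D.coeff 0 = 1 ∧ ∀ (z : F) (x : Fin l → F),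
    (∀ i, x i - z * ∑ j, M i j * x j = if i = b then 1 else 0) → N.eval z = D.eval z * x a

/-- The matrix `1 - X M`. -/
noncomputable def oneSubXMul (M : Matrix (Fin l) (Fin l) F) : Matrix (Fin l) (Fin l) F[X] :=
  1 - (X : F[X]) • M.map C

theorem oneSubXMul_map_eval (M : Matrix (Fin l) (Fin l) F) (z : F) :
    (evalRingHom z).mapMatrix (oneSubXMul M) = 1 - z • M := by
  ext i j
  by_cases h : i = j <;> simp [oneSubXMul, h] <;> ring

theorem eval_det_oneSubXMul (M : Matrix (Fin l) (Fin l) F) (z : F) :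
    (oneSubXMul M).det.eval z = (1 - z • M).det := by
  rw [← oneSubXMul_map_eval, ← RingHom.map_det]
  rfl

theorem eval_adjugate_oneSubXMul (M : Matrix (Fin l) (Fin l) F) (z : F) (a b : Fin l) :
    ((oneSubXMul M).adjugate a b).eval z = (1 - z • M).adjugate a b := by
  rw [← oneSubXMul_map_eval, ← RingHom.map_adjugate]
  rfl

theorem coeff_zero_det_oneSubXMul (M : Matrix (Fin l) (Fin l) F) :
    (oneSubXMul M).det.coeff 0 = 1 := by
  rw [coeff_zero_eq_eval_zero, eval_det_oneSubXMul]
  simp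

theorem natDegree_det_oneSubXMul_le (M : Matrix (Fin l) (Fin l) F) :
    (oneSubXMul M).det.natDegree ≤ l := by
  have h := natDegree_det_X_add_C_le (-M) 1
  have hM : oneSubXMul M = (X : F[X]) • (-M).map C + (1 : Matrix (Fin l) (Fin l) F).map C := by
    refine Matrix.ext fun i j => ?_
    by_cases h : i = j <;> simp [oneSubXMul, h, sub_eq_neg_add]
  rwa [Fintype.card_fin, ← hM] at h

theorem natDegree_adjugate_oneSubXMul_le (M : Matrix (Fin l) (Fin l) F) (a b : Fin l) :
    ((oneSubXMul M).adjugate a b).natDegree ≤ l := by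
  have h := natDegree_det_X_add_C_le ((-M).updateRow b 0)
    ((1 : Matrix (Fin l) (Fin l) F).updateRow b (Pi.single a 1))
  have hM : (oneSubXMul M).updateRow b (Pi.single a 1) = (X : F[X]) • ((-M).updateRow b 0).map C +
      ((1 : Matrix (Fin l) (Fin l) F).updateRow b (Pi.single a 1)).map C := by
    refine Matrix.ext fun i j => ?_
    by_cases hi : i = b
    · subst hi
      by_cases hj : j = a
      · subst hj; simp
      · simp [hj]
    · by_cases h : i = j
      · subst h; simp [oneSubXMul, hi, sub_eq_neg_add]
      · simp [oneSubXMul, h, hi]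
  rwa [Fintype.card_fin, ← hM, ← Matrix.adjugate_apply] at h

theorem oneSub_mulVec_eq_iff (M : Matrix (Fin l) (Fin l) F) (b : Fin l) (z : F) (x : Fin l → F) :
    (∀ i, x i - z * ∑ j, M i j * x j = if i = b then 1 else 0) ↔
      (1 - z • M).mulVec x = Pi.single b 1 := by
  rw [Matrix.sub_mulVec, Matrix.one_mulVec, Matrix.smul_mulVec, funext_iff]
  refine forall_congr' fun i => ?_
  simp only [Pi.sub_apply, Pi.smul_apply, smul_eq_mul, Pi.single_apply]
  rfl

theorem adjugate_eq_of_mulVec_eq {A : Matrix (Fin l) (Fin l) F} {a b : Fin l} {x : Fin l → F}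
    (h : A.mulVec x = Pi.single b 1) : A.adjugate a b = A.det * x a := by
  have h1 : A.adjugate.mulVec (A.mulVec x) = A.det • x := by
    rw [Matrix.mulVec_mulVec, Matrix.adjugate_mul, Matrix.smul_mulVec, Matrix.one_mulVec]
  rw [h] at h1
  have h2 := congrFun h1 a
  simpa using h2

/-- Cramer's rule. -/
theorem isResolvent_adjugate_det (M : Matrix (Fin l) (Fin l) F) (a b : Fin l) :
    IsResolvent M a b ((oneSubXMul M).adjugate a b) (oneSubXMul M).det := by
  refine ⟨coeff_zero_det_oneSubXMul M, fun z x hx => ?_⟩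
  rw [oneSub_mulVec_eq_iff] at hx
  rw [eval_adjugate_oneSubXMul, eval_det_oneSubXMul, adjugate_eq_of_mulVec_eq hx]

/-- Over a field with more than `3 l` elements, the quotient `N / D` is determined. -/
theorem IsResolvent.mul_det_eq [Fintype F] (hF : 3 * l < Fintype.card F)
    {M : Matrix (Fin l) (Fin l) F} {a b : Fin l} {N D : F[X]} (h : IsResolvent M a b N D)
    (hN : N.natDegree ≤ l) (hD : D.natDegree ≤ l) :
    N * (oneSubXMul M).det = D * (oneSubXMul M).adjugate a b := by
  set D' := (oneSubXMul M).det with hD'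
  set N' := (oneSubXMul M).adjugate a b with hN'
  have hD'l : D'.natDegree ≤ l := natDegree_det_oneSubXMul_le M
  have hN'l : N'.natDegree ≤ l := natDegree_adjugate_oneSubXMul_le M a b
  have hz : (N * D' - D * N') * D' = 0 := by
    refine eq_zero_of_natDegree_lt_card_of_eval_eq_zero _ (f := fun z : F => z)
      Function.injective_id (fun z => ?_) ?_
    · rw [eval_mul, eval_sub, eval_mul, eval_mul]
      by_cases h0 : D'.eval z = 0
      · rw [h0, mul_zero]
      · have hdet : IsUnit (1 - z • M).det := by
          rw [← eval_det_oneSubXMul]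
          exact isUnit_iff_ne_zero.2 h0
        set x := (1 - z • M)⁻¹.mulVec (Pi.single b 1) with hx
        have hx' : (1 - z • M).mulVec x = Pi.single b 1 := by
          rw [hx, Matrix.mulVec_mulVec, Matrix.mul_nonsing_inv _ hdet, Matrix.one_mulVec]
        rw [h.2 z x ((oneSub_mulVec_eq_iff M b z x).2 hx'), hN', eval_adjugate_oneSubXMul,
          adjugate_eq_of_mulVec_eq hx', hD', eval_det_oneSubXMul]
        ring
    · have h1 : (N * D').natDegree ≤ 2 * l := natDegree_mul_le.trans (by omega)
      have h2 : (D * N').natDegree ≤ 2 * l := natDegree_mul_le.trans (by omega)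
      refine lt_of_le_of_lt (natDegree_mul_le.trans (Nat.add_le_add
        ((natDegree_sub_le _ _).trans (max_le h1 h2)) hD'l)) ?_
      omega
  have hne : D' ≠ 0 := fun h0 => by
    have := coeff_zero_det_oneSubXMul M
    rw [← hD', h0] at this
    simp at this
  exact sub_eq_zero.1 ((mul_eq_zero.1 hz).resolve_right hne)

/-- The entries of a matrix power are coefficients of the expansion of `N / D` as a power series,
in which `1 / D` is expanded as a geometric series. -/
theorem IsResolvent.coeff_eq [Fintype F] (hF : 3 * l < Fintype.card F)
    {M : Matrix (Fin l) (Fin l) F} {a b : Fin l} {N D : F[X]} (h : IsResolvent M a b N D)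
    (hN : N.natDegree ≤ l) (hD : D.natDegree ≤ l) (e : ℕ) :
    (N * ∑ j ∈ Finset.range (e + 1), (1 - D) ^ j).coeff e = (M ^ e) a b := by
  have hND := h.mul_det_eq hF hN hD
  set D' := (oneSubXMul M).det with hD'
  set N' := (oneSubXMul M).adjugate a b with hN'
  have hpow : ∀ i : ℕ, ((X : F[X]) • M.map C) ^ i = (X : F[X]) ^ i • (M ^ i).map C := fun i => by
    rw [_root_.smul_pow]
    congr 1
    exact (map_pow (C : F →+* F[X]).mapMatrix M i).symm
  let G : Matrix (Fin l) (Fin l) F[X] := ∑ i ∈ Finset.range (e + 1), ((X : F[X]) • M.map C) ^ i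
  have hG : oneSubXMul M * G = 1 - ((X : F[X]) • M.map C) ^ (e + 1) := mul_neg_geom_sum _ _
  have hGe : (G a b).coeff e = (M ^ e) a b := by
    simp only [G, hpow, Matrix.sum_apply, Matrix.smul_apply, Matrix.map_apply, smul_eq_mul,
      finsetSum_coeff, coeff_X_pow_mul', coeff_C]
    rw [Finset.sum_eq_single e]
    · simp
    · intro i hi hne
      rw [Finset.mem_range] at hi
      rw [if_pos (by omega), if_neg (by omega)]
    · simp
  have h1 : X ^ (e + 1) ∣ D' * G a b - N' := by
    have h2 : D' • G = (oneSubXMul M).adjugate -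
        (X : F[X]) ^ (e + 1) • ((oneSubXMul M).adjugate * (M ^ (e + 1)).map C) := by
      have := congrArg (fun A => (oneSubXMul M).adjugate * A) hG
      simp only [← mul_assoc, Matrix.adjugate_mul, mul_sub, mul_one, hpow, Matrix.smul_mul,
        Matrix.one_mul, Matrix.mul_smul] at this
      exact this
    have h3 := congrFun (congrFun h2 a) b
    simp only [Matrix.smul_apply, Matrix.sub_apply, smul_eq_mul] at h3
    rw [h3]
    exact ⟨-((oneSubXMul M).adjugate * (M ^ (e + 1)).map C) a b, by ring⟩
  have h4 : X ^ (e + 1) ∣ D * G a b - N := by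
    have hcop : IsCoprime (X ^ (e + 1)) D' := by
      refine IsCoprime.pow_left ((irreducible_X.coprime_iff_not_dvd).2 fun hd => ?_)
      rw [X_dvd_iff, coeff_zero_det_oneSubXMul] at hd
      exact one_ne_zero hd
    refine hcop.dvd_of_dvd_mul_left ?_
    have : D' * (D * G a b - N) = D * (D' * G a b - N') := by linear_combination -hND
    rw [this]
    exact Dvd.dvd.mul_left h1 D
  have h5 : X ^ (e + 1) ∣ (1 - D) ^ (e + 1) := by
    refine pow_dvd_pow_of_dvd ?_ _
    rw [X_dvd_iff, coeff_sub, h.1]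
    simp
  have h6 : D * ∑ j ∈ Finset.range (e + 1), (1 - D) ^ j = 1 - (1 - D) ^ (e + 1) := by
    have := mul_neg_geom_sum (1 - D) (e + 1)
    rwa [sub_sub_cancel] at this
  have h7 : X ^ (e + 1) ∣ N * ∑ j ∈ Finset.range (e + 1), (1 - D) ^ j - G a b := by
    have : N * ∑ j ∈ Finset.range (e + 1), (1 - D) ^ j - G a b =
        -(D * G a b - N) * ∑ j ∈ Finset.range (e + 1), (1 - D) ^ j - G a b * (1 - D) ^ (e + 1) := by
      linear_combination G a b * h6
    rw [this]
    exact dvd_sub (Dvd.dvd.mul_right (dvd_neg.2 h4) _) (Dvd.dvd.mul_left h5 _)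
  have h8 := X_pow_dvd_iff.1 h7 e (Nat.lt_succ_self e)
  rw [coeff_sub, sub_eq_zero] at h8
  rw [h8, hGe]

end

/-- The polynomial of degree at most `l` whose coefficients are the digits of `c` modulo `p`. -/
noncomputable def codePoly (p W c l : ℕ) : (ZMod p)[X] :=
  ∑ t ∈ Finset.range (l + 1), C (digit W c t : ZMod p) * X ^ t

/-- The value at `z` of the polynomial with code `c`. -/
def evalCode {p : ℕ} (W c l : ℕ) (z : ZMod p) : ZMod p :=
  ∑ t ∈ Finset.range (l + 1), (digit W c t : ZMod p) * z ^ t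

theorem eval_codePoly {p : ℕ} (W c l : ℕ) (z : ZMod p) :
    (codePoly p W c l).eval z = evalCode W c l z := by
  simp [codePoly, evalCode, eval_finsetSum]

theorem natDegree_codePoly_le (p W c l : ℕ) : (codePoly p W c l).natDegree ≤ l := by
  refine natDegree_sum_le_of_forall_le _ _ fun t ht => ?_
  exact (natDegree_C_mul_X_pow_le _ _).trans (Nat.lt_succ_iff.1 (Finset.mem_range.1 ht))

theorem coeff_zero_codePoly (p W c l : ℕ) : (codePoly p W c l).coeff 0 = digit W c 0 := by
  rw [coeff_zero_eq_eval_zero, eval_codePoly, evalCode, Finset.sum_range_succ']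
  simp

theorem exists_digit_cast_eq {p W : ℕ} [NeZero p] (hW : p ≤ 2 ^ W) (m : ℕ) (x : ℕ → ZMod p) :
    ∃ c < 2 ^ (W * m), ∀ j < m, (digit W c j : ZMod p) = x j := by
  obtain ⟨c, hc, h⟩ := exists_digit_eq W m (fun j => (x j).val)
    fun j _ => (ZMod.val_lt _).trans_le hW
  exact ⟨c, hc, fun j hj => by rw [h j hj, ZMod.natCast_zmod_val]⟩

/-- Every polynomial of degree at most `l` has a code with `W * (l + 1)` bits. -/
theorem exists_codePoly_eq {p W l : ℕ} [NeZero p] (hW : p ≤ 2 ^ W) (f : (ZMod p)[X])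
    (hf : f.natDegree ≤ l) : ∃ c < 2 ^ (W * (l + 1)), codePoly p W c l = f := by
  obtain ⟨c, hc, h⟩ := exists_digit_cast_eq hW (l + 1) f.coeff
  refine ⟨c, hc, ?_⟩
  rw [codePoly, f.as_sum_range' (l + 1) (Nat.lt_succ_of_le hf)]
  exact Finset.sum_congr rfl fun t ht => by
    rw [h t (Finset.mem_range.1 ht), ← C_mul_X_pow_eq_monomial]

/-- The condition `IsResolvent`, with polynomials and vectors given by codes. -/
def CodeResolvent {p : ℕ} (B : ℕ → ℕ → ZMod p) (W l a b N D : ℕ) : Prop :=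
  (digit W D 0 : ZMod p) = 1 ∧ ∀ z < p, ∀ x < 2 ^ (W * (l + 1)),
    (∀ i < l, (digit W x i : ZMod p) - z * ∑ j ∈ Finset.range l, B i j * (digit W x j : ZMod p) =
      if i = b then 1 else 0) →
    evalCode W N l (z : ZMod p) = evalCode W D l (z : ZMod p) * (digit W x a : ZMod p)

theorem codeResolvent_iff {p W l : ℕ} [Fact p.Prime] (hW : p ≤ 2 ^ W) (B : ℕ → ℕ → ZMod p)
    (a b : Fin l) (N D : ℕ) : CodeResolvent B W l a b N D ↔
      IsResolvent (Matrix.of fun i j : Fin l => B i j) a b (codePoly p W N l)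
          (codePoly p W D l) := by
  rw [CodeResolvent, IsResolvent, coeff_zero_codePoly]
  refine and_congr_right fun _ => ⟨fun h z x hx => ?_, fun h z _ x _ hx => ?_⟩
  · obtain ⟨c, hc, hcx⟩ := exists_digit_cast_eq hW (l + 1)
      fun i => if hi : i < l then x ⟨i, hi⟩ else 0
    have hcx' : ∀ i : Fin l, (digit W c i : ZMod p) = x i := fun i => by
      rw [hcx i (by omega), dif_pos i.2]
    have := h z.val (ZMod.val_lt z) c hc fun i hi => by
      have h1 := hx ⟨i, hi⟩
      rw [Finset.sum_range, ZMod.natCast_zmod_val, hcx' ⟨i, hi⟩]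
      simp only [hcx', Matrix.of_apply, Fin.ext_iff] at h1 ⊢
      exact h1
    rw [eval_codePoly, eval_codePoly, ← hcx' a]
    rwa [ZMod.natCast_zmod_val] at this
  · rw [← eval_codePoly, ← eval_codePoly]
    refine h z (fun i => (digit W x i : ZMod p)) fun i => ?_
    have h1 := hx i i.2
    rw [Finset.sum_range] at h1
    simp only [Matrix.of_apply, Fin.ext_iff]
    exact h1

theorem natDegree_mul_geom_sum_le {F : Type} [Field F] {N D : F[X]} {l : ℕ} (hN : N.natDegree ≤ l)
    (hD : D.natDegree ≤ l) (e : ℕ) :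
    (N * ∑ j ∈ Finset.range (e + 1), (1 - D) ^ j).natDegree ≤ l + l * e := by
  refine natDegree_mul_le.trans (Nat.add_le_add hN ?_)
  refine natDegree_sum_le_of_forall_le _ _ fun j hj => ?_
  refine natDegree_pow_le.trans ?_
  have h1 : (1 - D).natDegree ≤ l := (natDegree_sub_le _ _).trans (by simpa using hD)
  rw [mul_comm]
  exact Nat.mul_le_mul h1 (Nat.lt_succ_iff.1 (Finset.mem_range.1 hj))

/-- The entries of a power of a matrix, in terms of guessed codes of polynomials. -/
theorem eq_matrix_pow_iff {p W l e : ℕ} [Fact p.Prime] (hW : p ≤ 2 ^ W)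
    (hlarge : 3 * l + l * e + e + 2 < p) (B : ℕ → ℕ → ZMod p) (a b : Fin l) (y : ZMod p) :
    y = ((Matrix.of fun i j : Fin l => B i j) ^ e) a b ↔
    ∃ N < 2 ^ (W * (l + 1)), ∃ D < 2 ^ (W * (l + 1)), CodeResolvent B W l a b N D ∧
      y = -∑ v ∈ Finset.range p, (v : ZMod p) ^ (p - 1 - e) * (evalCode W N l (v : ZMod p) *
        ∑ j ∈ Finset.range (e + 1), (1 - evalCode W D l (v : ZMod p)) ^ j) := by
  have key : ∀ N D, CodeResolvent B W l a b N D →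
      -∑ v ∈ Finset.range p, (v : ZMod p) ^ (p - 1 - e) * (evalCode W N l (v : ZMod p) *
        ∑ j ∈ Finset.range (e + 1), (1 - evalCode W D l (v : ZMod p)) ^ j) =
      ((Matrix.of fun i j : Fin l => B i j) ^ e) a b := fun N D h => by
    have hN := natDegree_codePoly_le p W N l
    have hD := natDegree_codePoly_le p W D l
    rw [← ((codeResolvent_iff hW B a b N D).1 h).coeff_eq (by rw [ZMod.card]; omega) hN hD,
      coeff_eq_neg_sum_eval _ ((natDegree_mul_geom_sum_le hN hD e).trans_lt (by omega)) (by omega)]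
    simp [eval_codePoly, eval_finsetSum]
  constructor
  · intro h
    obtain ⟨N, hN, hN'⟩ := exists_codePoly_eq hW _
      (natDegree_adjugate_oneSubXMul_le (Matrix.of fun i j : Fin l => B i j) a b)
    obtain ⟨D, hD, hD'⟩ := exists_codePoly_eq hW _
      (natDegree_det_oneSubXMul_le (Matrix.of fun i j : Fin l => B i j))
    have hres : CodeResolvent B W l a b N D := by
      rw [codeResolvent_iff hW, hN', hD']
      exact isResolvent_adjugate_det _ a b
    exact ⟨N, hN, D, hD, hres, h.trans (key N D hres).symm⟩
  · rintro ⟨N, -, D, -, h, rfl⟩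
    exact key N D h

section

variable {Γ Δ : Type} [Ctx Γ] [Ctx Δ] {p : Γ → ℕ} [∀ γ, NeZero (p γ)]

theorem DefZ.evalCode {W c l : Γ → ℕ} {z : ∀ γ, ZMod (p γ)} (hp : Def p) (hps : Small p)
    (hW : Def W) (hc : Def c) (hl : Def l) (hls : Small l) (hz : DefZ z) :
    DefZ fun γ => evalCode (W γ) (c γ) (l γ) (z γ) := by
  have hl1 : Small fun γ => l γ + 1 := hls.add (Small.const 1)
  have hp' : Def fun r : Ext (fun γ => l γ + 1) => p r.1 := by fun_prop
  exact DefZ.sum (by fun_prop) hl1 hp hps (DefZ.mul hp' (DefZ.natCast hp' (by fun_prop))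
    (DefZ.pow (by fun_prop) hl1.idx hp' (hps.comp Def.fst') (hz.comp Def.fst')))

end

section

variable {Γ : Type} [Ctx Γ] {p : Γ → ℕ} [∀ γ, NeZero (p γ)]

/-- The condition on a vector, given by its code `x`, to solve `(1 - z B) x = e_b`. -/
theorem Def.linearSystem {W l b x : Γ → ℕ} {B : ∀ γ, ℕ → ℕ → ZMod (p γ)} {z : ∀ γ, ZMod (p γ)}
    (hp : Def p) (hps : Small p) (hW : Def W) (hl : Def l) (hls : Small l) (hb : Def b)
    (hx : Def x) (hz : DefZ z)
    (hB : DefZ (p := fun q : Ext (fun q : Ext l => l q.1) => p q.1.1) fun q => B q.1.1 q.1.2 q.2) :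
    Def fun γ => ∀ i < l γ, (ACZero.digit (W γ) (x γ) i : ZMod (p γ)) -
      z γ * ∑ j ∈ Finset.range (l γ), B γ i j * (ACZero.digit (W γ) (x γ) j : ZMod (p γ)) =
        if i = b γ then 1 else 0 := by
  refine Def.ball hl ?_
  have h1 : Def fun q : Ext l => q.1 := Def.fst'
  have hp1 : Def fun q : Ext l => p q.1 := hp.comp h1
  have hl1 : Def fun q : Ext l => l q.1 := hl.comp h1
  have hp2 : Def fun q : Ext (fun q : Ext l => l q.1) => p q.1.1 := hp1.comp Def.fst'
  refine DefZ.eq (DefZ.sub hp1 (DefZ.natCast hp1 (by fun_prop)) (DefZ.mul hp1 (hz.comp h1)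
    (DefZ.sum hl1 (hls.comp h1) hp1 (hps.comp h1)
      (DefZ.mul hp2 hB (DefZ.natCast hp2 (by fun_prop))))))
    (DefZ.ite (by fun_prop) (DefZ.one hp1) (DefZ.zero hp1))

theorem Def.codeResolvent {W l a b N D : Γ → ℕ} {B : ∀ γ, ℕ → ℕ → ZMod (p γ)} (hp : Def p)
    (hps : Small p) (hW : Def W) (hl : Def l) (hls : Small l) {C : ℕ}
    (hC : ∀ γ, W γ * (l γ + 1) ≤ C * Ctx.len γ) (ha : Def a) (hb : Def b) (hN : Def N) (hD : Def D)
    (hB : DefZ (p := fun q : Ext (fun q : Ext l => l q.1) => p q.1.1) fun q => B q.1.1 q.1.2 q.2) :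
    Def fun γ => CodeResolvent (B γ) (W γ) (l γ) (a γ) (b γ) (N γ) (D γ) := by
  have h2 : Def fun γ => 2 ^ (W γ * (l γ + 1)) := Def.two_pow_of_le (by fun_prop) hC
  have h1 : Def fun q : Ext p => q.1 := Def.fst'
  have h2' : Def fun q : Ext p => 2 ^ (W q.1 * (l q.1 + 1)) := h2.comp h1
  have hh : Def fun r : Ext (fun q : Ext p => 2 ^ (W q.1 * (l q.1 + 1))) => r.1.1 :=
    h1.comp Def.fst'
  have hq := hp.comp hh
  have hqs := hps.comp hh
  have hlq := hl.comp hh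
  have hls' := hls.comp hh
  have hz := DefZ.natCast hq (f := fun r => r.1.2) (Def.idx (Def.fst'))
  refine Def.and (DefZ.eq (DefZ.natCast hp (by fun_prop)) (DefZ.one hp)) ?_
  refine Def.ball hp (Def.ball h2' (Def.imp ?_ ?_))
  · refine Def.linearSystem
      (l := fun r : Ext (fun q : Ext p => 2 ^ (W q.1 * (l q.1 + 1))) => l r.1.1) hq hqs (hW.comp hh) hlq hls' (hb.comp hh) (by fun_prop) hz ?_
    exact Def.at₂ (F := fun γ i j => (B γ i j).val) hB
      (hh.comp (Def.fst Def.fst')) (Def.idx Def.fst') (Def.idx Def.id) (fun r => r.1.3) fun r => r.3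
  · exact DefZ.eq (DefZ.evalCode hq hqs (hW.comp hh) (hN.comp hh) hlq hls' hz)
      (DefZ.mul hq (DefZ.evalCode hq hqs (hW.comp hh) (hD.comp hh) hlq hls' hz)
        (DefZ.natCast hq (Def.digit (hW.comp hh) (by fun_prop) (ha.comp hh))))

theorem DefZ.geom_sum {e : Γ → ℕ} {x : ∀ γ, ZMod (p γ)} (hp : Def p) (hps : Small p) (he : Def e)
    (hes : Small e) (hx : DefZ x) : DefZ fun γ => ∑ j ∈ Finset.range (e γ + 1), x γ ^ j := by
  have hes' : Small fun γ => e γ + 1 := hes.add (Small.const 1)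
  have h1 : Def fun q : Ext (fun γ => e γ + 1) => q.1 := Def.fst'
  exact DefZ.sum (by fun_prop) hes' hp hps
    (DefZ.pow (by fun_prop) hes'.idx (hp.comp h1) (hps.comp h1) (hx.comp h1))

/-- Extraction of a coefficient of the polynomial with values `x` by interpolation at all
residues. -/
theorem DefZ.coeff {e : Γ → ℕ} {x : ∀ γ, ℕ → ZMod (p γ)} (hp : Def p) (hps : Small p) (he : Def e)
    (hx : DefZ (p := fun q : Ext p => p q.1) fun q => x q.1 q.2) :
    DefZ fun γ => -∑ v ∈ Finset.range (p γ), (v : ZMod (p γ)) ^ (p γ - 1 - e γ) * x γ v := by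
  have h1 : Def fun q : Ext p => q.1 := Def.fst'
  have hp1 := hp.comp h1
  exact DefZ.neg hp (DefZ.sum hp hps hp hps (DefZ.mul hp1 (DefZ.pow (by fun_prop)
    ((hps.comp h1).mono fun s => (Nat.sub_le _ _).trans (Nat.sub_le _ _)) hp1 (hps.comp h1)
    (DefZ.natCast hp1 (by fun_prop))) hx))

end

/-- Powers of matrices whose rows have logarithmically many bits are definable modulo small
primes: vectors, and the polynomials `N` and `D` of `IsResolvent`, fit into logarithmically many
bits, and so can be quantified over. -/
theorem DefZ.matrix_pow {Γ : Type} [Ctx Γ] {p l e a b : Γ → ℕ} [∀ γ, Fact (p γ).Prime] (hp : Def p)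
    (hps : Small p) (hl : Def l) {C : ℕ} (hC : ∀ γ, (Ctx.len γ).size * (l γ + 1) ≤ C * Ctx.len γ)
    (he : Def e) (hes : Small e) (ha : Def a) (hb : Def b) (hal : ∀ γ, a γ < l γ)
    (hbl : ∀ γ, b γ < l γ) (hlarge : ∀ γ, 3 * l γ + l γ * e γ + e γ + 2 < p γ)
    {B : ∀ γ, ℕ → ℕ → ZMod (p γ)}
    (hB : DefZ (p := fun q : Ext (fun q : Ext l => l q.1) => p q.1.1) fun q => B q.1.1 q.1.2 q.2) :
    DefZ fun γ => ((Matrix.of fun i j : Fin (l γ) => B γ i j) ^ e γ) ⟨a γ, hal γ⟩ ⟨b γ, hbl γ⟩ := by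
  have hps₀ := hps
  obtain ⟨κ, hκ⟩ := hps₀
  have hls : Small l := by
    refine Small.mono (g := fun γ => C * Ctx.len γ) ((Small.const C).mul Small.len) fun γ => ?_
    have h1 : 0 < (Ctx.len γ).size := Nat.size_pos.2 (by have := Ctx.two_le_len γ; omega)
    exact le_trans (by nlinarith) (hC γ)
  obtain ⟨W, hWdef⟩ : ∃ W : Γ → ℕ, W = fun γ => κ * (Ctx.len γ).size := ⟨_, rfl⟩
  have hW : Def W := by rw [hWdef]; fun_prop
  have hpW : ∀ γ, p γ ≤ 2 ^ W γ := fun γ => by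
    rw [hWdef]; exact (hκ γ).trans (Ctx.pow_len_le_two_pow γ κ)
  have hWl : ∀ γ, W γ * (l γ + 1) ≤ κ * C * Ctx.len γ := fun γ => by
    simp only [hWdef]
    rw [mul_assoc, mul_assoc]
    exact Nat.mul_le_mul_left _ (hC γ)
  obtain ⟨Q, hQdef⟩ : ∃ Q : Γ → ℕ, Q = fun γ => 2 ^ (W γ * (l γ + 1)) := ⟨_, rfl⟩
  have hQ : Def Q := by rw [hQdef]; exact Def.two_pow_of_le (by fun_prop) hWl
  refine Def.of_graph hp (fun γ => ZMod.val_lt _) ?_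
  have h1 : Def fun y : Ext p => y.1 := Def.fst'
  have hh : Def fun r : Ext (fun r : Ext (fun y : Ext p => Q y.1) => Q r.1.1) => r.1.1.1 :=
    h1.comp (Def.fst Def.fst')
  have hq := hp.comp hh
  have hqs := hps.comp hh
  have key : Def fun y : Ext p => ∃ N < Q y.1, ∃ D < Q y.1,
      CodeResolvent (B y.1) (W y.1) (l y.1) (a y.1) (b y.1) N D ∧
      ((y.2 : ℕ) : ZMod (p y.1)) = -∑ v ∈ Finset.range (p y.1),
        (v : ZMod (p y.1)) ^ (p y.1 - 1 - e y.1) * (ACZero.evalCode (W y.1) N (l y.1) (v : ZMod (p y.1)) * ∑ j ∈ Finset.range (e y.1 + 1),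
          (1 - ACZero.evalCode (W y.1) D (l y.1) (v : ZMod (p y.1))) ^ j) := by
    refine Def.bex (hQ.comp h1) (Def.bex (hQ.comp (Def.fst Def.fst')) (Def.and ?_ ?_))
    · refine Def.codeResolvent
        (p := fun r : Ext (fun r : Ext (fun y : Ext p => Q y.1) => Q r.1.1) => p r.1.1.1)
        (B := fun r => B r.1.1.1) hq hqs (hW.comp hh) (hl.comp hh) (hls.comp hh) (C := κ * C)
        (fun r => hWl r.1.1.1) (ha.comp hh) (hb.comp hh) (by fun_prop) (by fun_prop) ?_
      exact Def.at₂ (F := fun γ i j => (B γ i j).val) hB (hh.comp (Def.fst Def.fst'))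
        (Def.idx Def.fst') (Def.idx Def.id) (fun r => r.1.3) fun r => r.3
    · refine DefZ.eq (DefZ.natCast hq (by fun_prop)) (DefZ.coeff hq hqs (he.comp hh) ?_)
      have hh' := hh.comp (Def.fst' (g := fun r => p r.1.1.1))
      have hq' := hp.comp hh'
      have hqs' := hps.comp hh'
      have hv := DefZ.natCast hq' (f := fun r => r.2) (Def.idx Def.id)
      exact DefZ.mul hq' (DefZ.evalCode hq' hqs' (hW.comp hh') (by fun_prop) (hl.comp hh')
        (hls.comp hh') hv) (DefZ.geom_sum hq' hqs' (he.comp hh') (hes.comp hh')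
          (DefZ.sub hq' (DefZ.one hq') (DefZ.evalCode hq' hqs' (hW.comp hh') (by fun_prop)
            (hl.comp hh') (hls.comp hh') hv)))
  rw [hQdef] at key
  refine key.congr_iff fun y => ?_
  rw [← eq_matrix_pow_iff (hpW y.1) (hlarge y.1) (B y.1) ⟨a y.1, hal y.1⟩ ⟨b y.1, hbl y.1⟩]
  refine ⟨fun h => ?_, fun h => (ZMod.val_cast_of_lt y.3).symm.trans (congrArg ZMod.val h)⟩
  exact (congrArg (Nat.cast (R := ZMod (p y.1))) h).trans (ZMod.natCast_zmod_val _)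

/-! ### Growth of the parameters -/

theorem exists_forall_le_mul {f g : ℕ → ℕ} (hg : ∀ n, 1 ≤ g n)
    (h : (fun n => (f n : ℝ)) =O[atTop] fun n => (g n : ℝ)) : ∃ C, ∀ n, f n ≤ C * g n := by
  obtain ⟨c, hc⟩ := h.bound
  obtain ⟨N, hN⟩ := eventually_atTop.1 hc
  refine ⟨⌈c⌉₊ + ∑ i ∈ Finset.range N, f i, fun n => ?_⟩
  rcases lt_or_ge n N with hn | hn
  · calc f n ≤ ∑ i ∈ Finset.range N, f i :=
          Finset.single_le_sum (fun i _ => Nat.zero_le (f i)) (Finset.mem_range.2 hn)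
      _ ≤ ⌈c⌉₊ + ∑ i ∈ Finset.range N, f i := Nat.le_add_left _ _
      _ ≤ _ := Nat.le_mul_of_pos_right _ (hg n)
  · have h1 := hN n hn
    simp only [Real.norm_natCast] at h1
    have h2 : (f n : ℝ) ≤ ((⌈c⌉₊ * g n : ℕ) : ℝ) := by
      push_cast
      exact h1.trans (mul_le_mul_of_nonneg_right (Nat.le_ceil c) (Nat.cast_nonneg _))
    exact (Nat.cast_le.1 h2).trans (Nat.mul_le_mul_right _ (Nat.le_add_right _ _))

theorem log_le_size (n : ℕ) : Real.log n ≤ (n + 2).size := by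
  rcases Nat.eq_zero_or_pos n with rfl | hn
  · simp
  have h1 : (n : ℝ) ≤ 2 ^ (n + 2).size := by
    exact_mod_cast (Nat.le_add_right n 2).trans (Nat.lt_size_self _).le
  calc Real.log n ≤ Real.log (2 ^ (n + 2).size) := Real.log_le_log (by exact_mod_cast hn) h1
    _ = (n + 2).size * Real.log 2 := Real.log_pow _ _
    _ ≤ (n + 2).size * 1 := mul_le_mul_of_nonneg_left
        (Real.log_two_lt_d9.le.trans (by norm_num)) (Nat.cast_nonneg _)
    _ = _ := mul_one _

theorem log_isBigO_size :
    (fun n : ℕ => Real.log n) =O[atTop] fun n => (((n + 2).size : ℕ) : ℝ) := by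
  refine IsBigO.of_bound 1 (Eventually.of_forall fun n => ?_)
  rw [Real.norm_of_nonneg (Real.log_natCast_nonneg n), Real.norm_natCast, one_mul]
  exact log_le_size n

theorem size_le_log {m : ℕ} (hm : 0 < m) : (m.size : ℝ) ≤ 1 + 2 * Real.log m := by
  have hs : 0 < m.size := Nat.size_pos.2 hm
  have h1 : 2 ^ (m.size - 1) ≤ m := Nat.lt_size.1 (by omega)
  have h2 : ((m.size - 1 : ℕ) : ℝ) * Real.log 2 ≤ Real.log m := by
    rw [← Real.log_pow]
    exact Real.log_le_log (by positivity) (by exact_mod_cast h1)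
  have h3 := Real.log_two_gt_d9
  rw [Nat.cast_sub hs] at h2
  push_cast at h2
  have h4 : (1 : ℝ) ≤ m.size := by exact_mod_cast hs
  nlinarith

theorem size_size_isBigO : (fun n : ℕ => (((n + 2).size.size : ℕ) : ℝ)) =O[atTop]
    fun n : ℕ => Real.log (Real.log n) := by
  have hlog : Tendsto (fun n : ℕ => Real.log (n : ℝ)) atTop atTop :=
    Real.tendsto_log_atTop.comp tendsto_natCast_atTop_atTop
  have hloglog := Real.tendsto_log_atTop.comp hlog
  refine IsBigO.of_bound 5 ?_
  filter_upwards [eventually_ge_atTop 2, hlog.eventually_ge_atTop 5,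
    hloglog.eventually_ge_atTop 1] with n hn h5 h1
  rw [Function.comp_apply] at h1
  rw [Real.norm_natCast, Real.norm_of_nonneg (by linarith)]
  have hL : (((n + 2).size : ℕ) : ℝ) ≤ Real.log n ^ 2 := by
    have h2 : Real.log ((n + 2 : ℕ) : ℝ) ≤ 2 * Real.log n := by
      rw [← Nat.cast_two (R := ℝ), ← Real.log_pow]
      exact Real.log_le_log (by positivity) (by exact_mod_cast (by nlinarith : n + 2 ≤ n ^ 2))
    have h3 := size_le_log (m := n + 2) (by omega)
    nlinarith
  have hLpos : 0 < (n + 2).size := Nat.size_pos.2 (by omega)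
  have h4 := size_le_log hLpos
  have h6 : Real.log ((n + 2).size : ℕ) ≤ 2 * Real.log (Real.log n) := by
    refine (Real.log_le_log (by exact_mod_cast hLpos) hL).trans_eq ?_
    rw [Real.log_pow, Nat.cast_two]
  linarith

/-- Polylogarithmic functions are bounded by powers of the length of `n`. -/
theorem exists_le_size_pow {f : ℕ → ℕ}
    (hf : ∃ C : ℕ, (fun n : ℕ => (f n : ℝ)) =O[atTop] fun n : ℕ => Real.log (n : ℝ) ^ C) :
    ∃ e, ∀ n, f n ≤ (n + 2).size ^ e := by
  obtain ⟨C, hC⟩ := hf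
  have h2 : ∀ n : ℕ, 2 ≤ (n + 2).size := fun n => Nat.lt_size.2 (by omega)
  obtain ⟨c, hc⟩ := exists_forall_le_mul (g := fun n => (n + 2).size ^ C)
    (fun n => Nat.one_le_pow _ _ (by have := h2 n; omega))
    (by simpa using hC.trans (log_isBigO_size.pow C))
  refine ⟨c + C, fun n => (hc n).trans ?_⟩
  rw [pow_add]
  exact Nat.mul_le_mul_right _ (Nat.lt_two_pow_self.le.trans (Nat.pow_le_pow_left (h2 n) c))

/-- Numbers below `log n / log log n` of words of length `log log n` have `log n` bits in total. -/
theorem exists_size_mul_le {l : ℕ → ℕ} (hl : (fun n : ℕ => (l n : ℝ)) =O[atTop]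
      fun n : ℕ => Real.log (n : ℝ) / Real.log (Real.log (n : ℝ))) :
    ∃ C, ∀ n, (n + 2).size.size * (l n + 1) ≤ C * (n + 2).size := by
  have hpos : ∀ n : ℕ, 1 ≤ (n + 2).size := fun n => Nat.size_pos.2 (by omega)
  have h1 : (fun n => (((n + 2).size.size * l n : ℕ) : ℝ)) =O[atTop]
      fun n => (((n + 2).size : ℕ) : ℝ) := by
    refine (IsBigO.trans ?_ log_isBigO_size)
    have h2 := size_size_isBigO.mul hl
    refine (h2.congr_left fun n => by push_cast; rfl).trans_eventuallyEq ?_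
    have hlog : Tendsto (fun n : ℕ => Real.log (n : ℝ)) atTop atTop :=
      Real.tendsto_log_atTop.comp tendsto_natCast_atTop_atTop
    filter_upwards [(Real.tendsto_log_atTop.comp hlog).eventually_ge_atTop 1] with n hn
    rw [Function.comp_apply] at hn
    exact mul_div_cancel₀ _ (by linarith)
  obtain ⟨C, hC⟩ := exists_forall_le_mul hpos h1
  refine ⟨C + 1, fun n => ?_⟩
  have h2 : (n + 2).size.size ≤ (n + 2).size := Nat.size_le.2 Nat.lt_two_pow_self
  have := hC n
  nlinarith

/-! ### Sums of powers over a common denominator -/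

theorem abs_coeff_mul_le {p q : ℤ[X]} {N H : ℤ} {δ : ℕ} (hp : ∀ s, |p.coeff s| ≤ N)
    (hq : ∀ s, |q.coeff s| ≤ H) (hδ : q.natDegree < δ) (m : ℕ) :
    |(p * q).coeff m| ≤ δ * (N * H) := by
  have hN : 0 ≤ N := (abs_nonneg _).trans (hp 0)
  have hH : 0 ≤ H := (abs_nonneg _).trans (hq 0)
  rw [q.as_sum_range' δ hδ, Finset.mul_sum, finsetSum_coeff]
  refine (Finset.abs_sum_le_sum_abs _ _).trans ?_
  refine (Finset.sum_le_card_nsmul _ _ (N * H) fun t _ => ?_).trans_eq (by simp)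
  rw [← C_mul_X_pow_eq_monomial, mul_left_comm, coeff_C_mul, coeff_mul_X_pow', abs_mul, mul_comm N]
  refine mul_le_mul (hq t) ?_ (abs_nonneg _) hH
  split_ifs
  · exact hp _
  · simpa using hN

section

variable {l : ℕ}

theorem abs_coeff_matrix_pow_le {M : Matrix (Fin l) (Fin l) ℤ[X]} {H : ℤ} {δ : ℕ}
    (hM : ∀ i j s, |(M i j).coeff s| ≤ H) (hδ : ∀ i j, (M i j).natDegree < δ) (e : ℕ) (i j : Fin l)
    (m : ℕ) : |((M ^ e) i j).coeff m| ≤ (l * δ * H) ^ e := by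
  induction e generalizing j m with
  | zero =>
    rw [pow_zero, pow_zero, Matrix.one_apply]
    split_ifs
    · rw [coeff_one]
      split_ifs <;> simp
    · simp
  | succ e ih =>
    rw [pow_succ, Matrix.mul_apply, finsetSum_coeff]
    refine (Finset.abs_sum_le_sum_abs _ _).trans ((Finset.sum_le_card_nsmul _ _ _ fun u _ =>
      abs_coeff_mul_le (ih u) (hM u j) (hδ u j) m).trans_eq ?_)
    simp only [Finset.card_univ, Fintype.card_fin, nsmul_eq_mul]
    ring

theorem natDegree_matrix_pow_le {R : Type} [CommRing R] {M : Matrix (Fin l) (Fin l) R[X]} {δ : ℕ}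
    (hδ : ∀ i j, (M i j).natDegree ≤ δ) (e : ℕ) (i j : Fin l) :
    ((M ^ e) i j).natDegree ≤ e * δ := by
  induction e generalizing j with
  | zero =>
    rw [pow_zero, Matrix.one_apply]
    split_ifs <;> simp
  | succ e ih =>
    rw [pow_succ, Matrix.mul_apply]
    refine natDegree_sum_le_of_forall_le _ _ fun u _ => natDegree_mul_le.trans ?_
    rw [Nat.succ_mul]
    exact Nat.add_le_add (ih u) (hδ u j)

/-- The sum of the first powers of `M / D`, multiplied by `D ^ k`. -/
noncomputable def clearedSum {R : Type} [CommRing R] (D : R) (M : Matrix (Fin l) (Fin l) R[X])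
    (k : ℕ) : Matrix (Fin l) (Fin l) R[X] :=
  ∑ s ∈ Finset.range (k + 1), C (D ^ (k - s)) • M ^ s

theorem clearedSum_apply {R : Type} [CommRing R] (D : R) (M : Matrix (Fin l) (Fin l) R[X]) (k : ℕ)
    (i j : Fin l) :
    clearedSum D M k i j = ∑ s ∈ Finset.range (k + 1), C (D ^ (k - s)) * (M ^ s) i j := by
  simp [clearedSum, Matrix.sum_apply]

theorem clearedSum_smul {R : Type} [CommRing R] (D : R) (M : Matrix (Fin l) (Fin l) R[X]) (k : ℕ) :
    clearedSum D (C D • M) k = C (D ^ k) • ∑ s ∈ Finset.range (k + 1), M ^ s := by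
  rw [clearedSum, Finset.smul_sum]
  refine Finset.sum_congr rfl fun s hs => ?_
  rw [_root_.smul_pow, smul_smul, ← C_pow, ← C_mul, pow_sub_mul_pow]
  exact Nat.lt_succ_iff.1 (Finset.mem_range.1 hs)

theorem clearedSum_map {R S : Type} [CommRing R] [CommRing S] (f : R →+* S) (D : R)
    (M : Matrix (Fin l) (Fin l) R[X]) (k : ℕ) (i j : Fin l) :
    (clearedSum D M k i j).map f = clearedSum (f D) ((mapRingHom f).mapMatrix M) k i j := by
  rw [clearedSum_apply, clearedSum_apply, Polynomial.map_sum]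
  refine Finset.sum_congr rfl fun s _ => ?_
  rw [Polynomial.map_mul, map_C, map_pow f, ← map_pow (mapRingHom f).mapMatrix]
  rfl

theorem eval_clearedSum {R : Type} [CommRing R] (D : R) (M : Matrix (Fin l) (Fin l) R[X]) (k : ℕ)
    (i j : Fin l) (v : R) : (clearedSum D M k i j).eval v =
      ∑ s ∈ Finset.range (k + 1), D ^ (k - s) * (((evalRingHom v).mapMatrix M) ^ s) i j := by
  rw [clearedSum_apply, eval_finsetSum]
  refine Finset.sum_congr rfl fun s _ => ?_
  rw [eval_mul, eval_C, ← map_pow]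
  rfl

theorem natDegree_clearedSum_le {R : Type} [CommRing R] {D : R} {M : Matrix (Fin l) (Fin l) R[X]}
    {δ : ℕ} (hδ : ∀ i j, (M i j).natDegree ≤ δ) (k : ℕ) (i j : Fin l) :
    (clearedSum D M k i j).natDegree ≤ k * δ := by
  rw [clearedSum_apply]
  refine natDegree_sum_le_of_forall_le _ _ fun s hs => (natDegree_C_mul_le _ _).trans ?_
  exact (natDegree_matrix_pow_le hδ s i j).trans
    (Nat.mul_le_mul_right _ (Nat.lt_succ_iff.1 (Finset.mem_range.1 hs)))

theorem abs_coeff_clearedSum_lt {D : ℕ} {M : Matrix (Fin l) (Fin l) ℤ[X]} {δ T T' k : ℕ}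
    (hD : D ≤ 2 ^ T) (hM : ∀ i j s, |(M i j).coeff s| ≤ 2 ^ T') (hδ : ∀ i j, (M i j).natDegree < δ)
    (i j : Fin l) (m : ℕ) :
    |(clearedSum (D : ℤ) M k i j).coeff m| < 2 ^ (k + 1 + (T * k + (l + δ + T') * k)) := by
  rw [clearedSum_apply, finsetSum_coeff]
  have hl : (l * δ * 2 ^ T' : ℤ) ≤ 2 ^ (l + δ + T') := by
    rw [pow_add, pow_add]
    have h1 : (l : ℤ) ≤ 2 ^ l := by exact_mod_cast Nat.lt_two_pow_self.le
    have h2 : (δ : ℤ) ≤ 2 ^ δ := by exact_mod_cast Nat.lt_two_pow_self.le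
    gcongr
  refine ((Finset.abs_sum_le_sum_abs _ _).trans (Finset.sum_le_card_nsmul _ _
    (2 ^ (T * k + (l + δ + T') * k)) fun s hs => ?_)).trans_lt ?_
  · rw [coeff_C_mul, abs_mul, pow_add]
    have hs' : s ≤ k := Nat.lt_succ_iff.1 (Finset.mem_range.1 hs)
    have hD' : (D : ℤ) ≤ 2 ^ T := by exact_mod_cast hD
    refine mul_le_mul ?_ ?_ (abs_nonneg _) (by positivity)
    · rw [abs_of_nonneg (by positivity)]
      calc (D : ℤ) ^ (k - s) ≤ (2 ^ T) ^ (k - s) := by gcongr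
        _ = 2 ^ (T * (k - s)) := (pow_mul _ _ _).symm
        _ ≤ _ := pow_le_pow_right₀ (by norm_num) (Nat.mul_le_mul_left _ (Nat.sub_le _ _))
    · calc _ ≤ (l * δ * 2 ^ T' : ℤ) ^ s := abs_coeff_matrix_pow_le hM hδ s i j m
        _ ≤ (2 ^ (l + δ + T')) ^ s := by gcongr
        _ = 2 ^ ((l + δ + T') * s) := (pow_mul _ _ _).symm
        _ ≤ _ := pow_le_pow_right₀ (by norm_num) (Nat.mul_le_mul_left _ hs')
  · rw [Finset.card_range, nsmul_eq_mul, pow_add 2 (k + 1)]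
    refine mul_lt_mul_of_pos_right ?_ (by positivity)
    exact_mod_cast Nat.lt_two_pow_self

end

/-- The common denominator of the fractions with denominators `β i j m`. -/
def denominator (l d : ℕ) (β : ℕ → ℕ → ℕ → ℕ) : ℕ :=
  ∏ i ∈ Finset.range l, ∏ j ∈ Finset.range l, ∏ m ∈ Finset.range (d + 1), β i j m

/-- The product of the denominators of all fractions but one. -/
def cofactor (l d : ℕ) (β : ℕ → ℕ → ℕ → ℕ) (i j m : ℕ) : ℕ :=
  denominator l d fun i' j' m' => if i' = i ∧ j' = j ∧ m' = m then 1 else β i' j' m'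

theorem mul_cofactor {l d : ℕ} (β : ℕ → ℕ → ℕ → ℕ) {i j m : ℕ} (hi : i < l) (hj : j < l)
    (hm : m < d + 1) : β i j m * cofactor l d β i j m = denominator l d β := by
  have h : ∀ γ : ℕ → ℕ → ℕ → ℕ, denominator l d γ =
      ∏ c ∈ Finset.range l ×ˢ (Finset.range l ×ˢ Finset.range (d + 1)), γ c.1 c.2.1 c.2.2 :=
    fun γ => by
    simp only [denominator, Finset.prod_product]
  have hc : (i, j, m) ∈ Finset.range l ×ˢ (Finset.range l ×ˢ Finset.range (d + 1)) := by
    simp [hi, hj, Nat.lt_succ_iff.1 hm]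
  rw [cofactor, h, h, ← Finset.mul_prod_erase _ _ hc, ← Finset.mul_prod_erase _ _ hc]
  simp only [and_self, if_true, one_mul]
  congr 1
  refine Finset.prod_congr rfl fun c hc => if_neg fun h => (Finset.mem_erase.1 hc).1 ?_
  rw [← h.1, ← h.2.1, ← h.2.2]

/-- `X` times the matrix with entries `∑ m, c i j m * X ^ m`. -/
noncomputable def shiftedMatrix {R : Type} [CommRing R] (l d : ℕ) (c : ℕ → ℕ → ℕ → R) :
    Matrix (Fin l) (Fin l) R[X] :=
  Matrix.of fun i j => X * ∑ m ∈ Finset.range (d + 1), C (c i j m) * X ^ m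

theorem map_shiftedMatrix {R S : Type} [CommRing R] [CommRing S] (f : R →+* S) (l d : ℕ)
    (c : ℕ → ℕ → ℕ → R) : (mapRingHom f).mapMatrix (shiftedMatrix l d c) =
      shiftedMatrix l d fun i j m => f (c i j m) := by
  refine Matrix.ext fun i j => ?_
  simp [shiftedMatrix, Polynomial.map_sum]

theorem eval_shiftedMatrix {R : Type} [CommRing R] (l d : ℕ) (c : ℕ → ℕ → ℕ → R) (v : R) :
    (evalRingHom v).mapMatrix (shiftedMatrix l d c) =
      Matrix.of fun i j : Fin l => v * ∑ m ∈ Finset.range (d + 1), c i j m * v ^ m := by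
  refine Matrix.ext fun i j => ?_
  simp [shiftedMatrix, eval_finsetSum]

theorem natDegree_shiftedMatrix_le {R : Type} [CommRing R] (l d : ℕ) (c : ℕ → ℕ → ℕ → R)
    (i j : Fin l) : (shiftedMatrix l d c i j).natDegree ≤ d + 1 := by
  rw [shiftedMatrix, Matrix.of_apply, add_comm d 1]
  refine natDegree_mul_le.trans (Nat.add_le_add natDegree_X_le ?_)
  refine natDegree_sum_le_of_forall_le _ _ fun t ht => ?_
  exact (natDegree_C_mul_X_pow_le _ _).trans (by rw [Finset.mem_range] at ht; omega)

theorem coeff_shiftedMatrix {l d : ℕ} (c : ℕ → ℕ → ℕ → ℤ) {H : ℤ} (hH : 0 ≤ H)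
    (hc : ∀ i < l, ∀ j < l, ∀ m < d + 1, |c i j m| ≤ H) (i j : Fin l) (s : ℕ) :
    |(shiftedMatrix l d c i j).coeff s| ≤ H := by
  rw [shiftedMatrix, Matrix.of_apply]
  rcases s with - | s
  · simpa using hH
  · simp only [coeff_X_mul, finsetSum_coeff, coeff_C_mul, coeff_X_pow, mul_ite, mul_one, mul_zero,
      Finset.sum_ite_eq, Finset.mem_range]
    split_ifs with h
    · exact hc i i.2 j j.2 s h
    · simpa using hH

/-! ### Definability of the numerators -/

/-- The residue of a coefficient of a cleared sum, in terms of powers of the values of the matrix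
at all residues. -/
theorem cast_coeff_clearedSum {q : ℕ} [Fact q.Prime] (l d k D : ℕ) (P N : ℕ → ℕ → ℕ → ℕ)
    (a b : Fin l) (m : ℕ) (hk : k * (d + 1) < q - 1) (hm : m < q - 1) :
    (((clearedSum (D : ℤ) (shiftedMatrix l d fun i j t =>
      (P i j t : ℤ) - N i j t) k a b).coeff m : ℤ) : ZMod q) = -∑ v ∈ Finset.range q, (v : ZMod q) ^ (q - 1 - m) *
        ∑ s ∈ Finset.range (k + 1), (D : ZMod q) ^ (k - s) * ((Matrix.of fun i j : Fin l =>
          (v : ZMod q) * ∑ t ∈ Finset.range (d + 1),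
            ((P i j t : ZMod q) - N i j t) * (v : ZMod q) ^ t) ^ s) a b := by
  have h1 := coeff_map (Int.castRingHom (ZMod q)) (p := clearedSum (D : ℤ)
    (shiftedMatrix l d fun i j t => (P i j t : ℤ) - N i j t) k a b) m
  rw [eq_intCast] at h1
  rw [← h1, clearedSum_map, map_shiftedMatrix, coeff_eq_neg_sum_eval _ ((natDegree_clearedSum_le
    (natDegree_shiftedMatrix_le l d _) k a b).trans_lt hk) hm]
  simp only [eval_clearedSum, eval_shiftedMatrix]
  simp

section

variable {Γ Δ : Type} [Ctx Γ] [Ctx Δ]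

/-- The context with three more variables `i, j, m` which name an entry of an `l × l` matrix and a
coefficient of a polynomial of degree `d`. -/
abbrev Cells (l d : Γ → ℕ) : Type := Ext fun q : Ext (fun p : Ext l => l p.1) => d q.1.1 + 1

theorem Def.cell_fst {l d : Γ → ℕ} : Def fun c : Cells l d => c.1.1.1 :=
  Def.fst (Def.fst Def.fst')

theorem Def.at_cell {α : Type} [LawfulTarget α] {l d : Δ → ℕ} {F : Δ → ℕ → ℕ → ℕ → α}
    (hF : Def fun c : Cells l d => F c.1.1.1 c.1.1.2 c.1.2 c.2) {h : Γ → Δ} {i j m : Γ → ℕ}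
    (hh : Def h) (hi : Def i) (hj : Def j) (hm : Def m) (hil : ∀ γ, i γ < l (h γ))
    (hjl : ∀ γ, j γ < l (h γ)) (hmd : ∀ γ, m γ < d (h γ) + 1) :
    Def fun γ => F (h γ) (i γ) (j γ) (m γ) :=
  Def.comp hF (h := fun γ => ⟨⟨⟨h γ, i γ, hil γ⟩, j γ, hjl γ⟩, m γ, hmd γ⟩)
    (Def.mk (Def.mk (Def.mk hh hi hil) hj _) hm _)

theorem Big.at_cell {l d : Δ → ℕ} {x : Δ → ℕ → ℕ → ℕ → ℕ}
    (hx : Big fun c : Cells l d => x c.1.1.1 c.1.1.2 c.1.2 c.2) {h : Γ → Δ} {i j m : Γ → ℕ}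
    (hh : Def h) (hi : Def i) (hj : Def j) (hm : Def m) (hil : ∀ γ, i γ < l (h γ))
    (hjl : ∀ γ, j γ < l (h γ)) (hmd : ∀ γ, m γ < d (h γ) + 1) :
    Big fun γ => x (h γ) (i γ) (j γ) (m γ) :=
  Big.comp hx (h := fun γ => ⟨⟨⟨h γ, i γ, hil γ⟩, j γ, hjl γ⟩, m γ, hmd γ⟩)
    (Def.mk (Def.mk (Def.mk hh hi hil) hj _) hm _)

theorem Big.comp_cell {l d : Δ → ℕ} {x : Δ → ℕ → ℕ → ℕ → ℕ}
    (hx : Big fun c : Cells l d => x c.1.1.1 c.1.1.2 c.1.2 c.2) {h : Γ → Δ} (hh : Def h) :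
    Big fun c : Cells (fun γ => l (h γ)) (fun γ => d (h γ)) =>
      x (h c.1.1.1) c.1.1.2 c.1.2 c.2 :=
  Big.at_cell hx (hh.comp (Def.fst (Def.fst Def.fst'))) (Def.idx (Def.fst Def.fst'))
    (Def.idx Def.fst') Def.idx' (fun c => c.1.1.3) (fun c => c.1.3) fun c => c.3

theorem Big.denominator {l d : Γ → ℕ} (hl : Def l) (hls : Small l) (hd : Def d) (hds : Small d)
    {β : Γ → ℕ → ℕ → ℕ → ℕ} (hβ : Big fun c : Cells l d => β c.1.1.1 c.1.1.2 c.1.2 c.2) :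
    Big fun γ => denominator (l γ) (d γ) (β γ) := by
  have h1 : Def fun p : Ext l => p.1 := Def.fst'
  have h2 : Def fun q : Ext (fun p : Ext l => l p.1) => q.1.1 := Def.fst Def.fst'
  exact Big.prod hl hls (Big.prod (hl.comp h1) (hls.comp h1)
    (Big.prod ((hd.comp h2).add (Def.const 1)) ((hds.comp h2).add (Small.const 1)) hβ))

theorem Big.cofactor {l d i j m : Γ → ℕ} (hl : Def l) (hls : Small l) (hd : Def d) (hds : Small d)
    (hi : Def i) (hj : Def j) (hm : Def m) {β : Γ → ℕ → ℕ → ℕ → ℕ}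
    (hβ : Big fun c : Cells l d => β c.1.1.1 c.1.1.2 c.1.2 c.2) :
    Big fun γ => cofactor (l γ) (d γ) (β γ) (i γ) (j γ) (m γ) := by
  have h1 : Def fun c : Cells l d => c.1.1.1 := Def.fst (Def.fst Def.fst')
  refine Big.denominator hl hls hd hds (Big.ite (Big.const 1) hβ (Def.and ?_ (Def.and ?_ ?_)))
  · exact (Def.idx (Def.fst Def.fst')).eq (hi.comp h1)
  · exact (Def.idx Def.fst').eq (hj.comp h1)
  · exact Def.idx'.eq (hm.comp h1)

theorem Big.truncSub {x y : Γ → ℕ} (hx : Big x) (hy : Big y) : Big fun γ => x γ - y γ := by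
  refine ((Big.ite hx hy (hy.le hx)).sub hy fun γ => ?_).congr fun γ => ?_
  · split_ifs with h
    · exact h
    · exact le_rfl
  · split_ifs with h
    · rfl
    · omega

/-- The coefficients of a cleared sum of powers are definable. They are reconstructed from their
residues, which in turn are interpolated from powers of matrices over prime fields. -/
theorem Big.clearedSum {l d k a b m : Γ → ℕ} (hl : Def l) (hls : Small l) {C : ℕ}
    (hC : ∀ γ, (Ctx.len γ).size * (l γ + 1) ≤ C * Ctx.len γ) (hd : Def d) (hds : Small d)
    (hk : Def k) (hks : Small k) (ha : Def a) (hb : Def b) (hm : Def m) (hal : ∀ γ, a γ < l γ)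
    (hbl : ∀ γ, b γ < l γ) (hmk : ∀ γ, m γ ≤ k γ * (d γ + 1)) {D : Γ → ℕ} (hD : Big D)
    {P N : Γ → ℕ → ℕ → ℕ → ℕ} (hP : Big fun c : Cells l d => P c.1.1.1 c.1.1.2 c.1.2 c.2)
    (hN : Big fun c : Cells l d => N c.1.1.1 c.1.1.2 c.1.2 c.2) {Z : Γ → ℤ}
    (hZ : ∀ γ, Z γ = (clearedSum (D γ : ℤ) (shiftedMatrix (l γ) (d γ) fun i j t =>
      (P γ i j t : ℤ) - N γ i j t) (k γ) ⟨a γ, hal γ⟩ ⟨b γ, hbl γ⟩).coeff (m γ)) :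
    (Big fun γ => (Z γ).natAbs) ∧ Def fun γ => Z γ < 0 := by
  obtain ⟨T₁, hT₁d, hT₁, hDT⟩ := hD.exists_bound
  have hPN : ∃ e, ∀ γ, ∀ i < l γ, ∀ j < l γ, ∀ t < d γ + 1,
      |(P γ i j t : ℤ) - N γ i j t| ≤ 2 ^ Ctx.len γ ^ e := by
    obtain ⟨e, hP', -⟩ := hP
    obtain ⟨e', hN', -⟩ := hN
    refine ⟨max e e', fun γ i hi j hj t ht => ?_⟩
    have h1 := hP' ⟨⟨⟨γ, i, hi⟩, j, hj⟩, t, ht⟩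
    have h2 := hN' ⟨⟨⟨γ, i, hi⟩, j, hj⟩, t, ht⟩
    have h3 : P γ i j t < 2 ^ Ctx.len γ ^ max e e' := h1.trans_le
      (Nat.pow_le_pow_right (by omega) (Ctx.pow_len_mono γ (le_max_left _ _)))
    have h4 : N γ i j t < 2 ^ Ctx.len γ ^ max e e' := h2.trans_le
      (Nat.pow_le_pow_right (by omega) (Ctx.pow_len_mono γ (le_max_right _ _)))
    zify at h3 h4
    rw [abs_le]
    constructor <;> omega
  obtain ⟨e, he⟩ := hPN
  -- `T` bounds the bit lengths of the coefficients, see `abs_coeff_clearedSum_lt`.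
  obtain ⟨T, hTdef⟩ : ∃ T : Γ → ℕ, T = fun γ => k γ + 1 + (T₁ γ * k γ +
    (l γ + (d γ + 1 + 1) + Ctx.len γ ^ e) * k γ) := ⟨_, rfl⟩
  have hT : Def T := by rw [hTdef]; fun_prop
  have hTs : Small T := by
    rw [hTdef]
    exact (hks.add (Small.const 1)).add ((hT₁.mul hks).add (((hls.add ((hds.add (Small.const 1)).add
      (Small.const 1))).add ⟨e, fun _ => le_rfl⟩).mul hks))
  have hZT : ∀ γ, |Z γ| < 2 ^ T γ := fun γ => by
    rw [hZ, hTdef]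
    refine abs_coeff_clearedSum_lt (hDT γ).le (fun i j s => ?_) (fun i j => ?_) _ _ _
    · exact coeff_shiftedMatrix _ (by positivity) (he γ) i j s
    · exact Nat.lt_succ_of_le (natDegree_shiftedMatrix_le _ _ _ i j)
  -- The moduli exceed `L ^ A`, where `L` is the length. This has to leave room for the coefficients,
  -- for the interpolation in `X`, and for the powers of matrices.
  obtain ⟨A, hA⟩ : Small fun γ => T γ + 1 + (3 * l γ + l γ * k γ + k γ + 2 +
      (k γ * (d γ + 1) + 2)) :=
    (hTs.add (Small.const 1)).add ((((((Small.const 3).mul hls).add (hls.mul hks)).add hks).add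
      (Small.const 2)).add ((hks.mul (hds.add (Small.const 1))).add (Small.const 2)))
  obtain ⟨κ, hκ⟩ := exists_moduli A
  -- Adding `2 ^ T` makes the coefficients nonnegative.
  have hbig : Big fun γ => (Z γ + 2 ^ T γ).toNat := by
    refine Big.of_residues A κ (fun γ => ?_) ?_
    · refine lt_of_lt_of_le ?_ (hκ _ (Ctx.two_le_len γ))
      have h1 : 2 ^ (T γ + 1) ≤ 2 ^ Ctx.len γ ^ A :=
        Nat.pow_le_pow_right (by omega) ((Nat.le_add_right _ _).trans (hA γ))
      refine lt_of_lt_of_le ?_ h1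
      have h2 := abs_lt.1 (hZT γ)
      rw [pow_succ]
      zify
      rw [Int.toNat_of_nonneg (by linarith)]
      linarith
    · have h0 : Def fun r : ExtPrime Γ A κ => r.1.1 := by fun_prop
      have hq : Def fun r : ExtPrime Γ A κ => r.1.2 := by fun_prop
      have hqs : Small fun r : ExtPrime Γ A κ => r.1.2 := ExtPrime.small
      have h1 : Def fun r : Ext (fun r : ExtPrime Γ A κ => r.1.2) => r.1 := Def.fst'
      have h01 := h0.comp h1
      have hq1 := hq.comp h1
      have hqs1 := hqs.comp h1
      have hks1 : Small fun r : Ext (fun r : ExtPrime Γ A κ => r.1.2) => k r.1.1.1 + 1 :=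
        (hks.comp h01).add (Small.const 1)
      have h2 : Def fun r : Ext (fun r : Ext (fun r : ExtPrime Γ A κ => r.1.2) => k r.1.1.1 + 1) =>
        r.1 := Def.fst'
      have h02 := h01.comp h2
      have hq2 := hq1.comp h2
      have hqs2 := hqs1.comp h2
      have key : DefZ fun r : ExtPrime Γ A κ => (-∑ v ∈ Finset.range r.1.2,
          (v : ZMod r.1.2) ^ (r.1.2 - 1 - m r.1.1) * ∑ s ∈ Finset.range (k r.1.1 + 1),
            (D r.1.1 : ZMod r.1.2) ^ (k r.1.1 - s) * ((Matrix.of fun i j : Fin (l r.1.1) =>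
              (v : ZMod r.1.2) * ∑ t ∈ Finset.range (d r.1.1 + 1),
                ((P r.1.1 i j t : ZMod r.1.2) - N r.1.1 i j t) * (v : ZMod r.1.2) ^ t) ^ s)
                  ⟨a r.1.1, hal r.1.1⟩ ⟨b r.1.1, hbl r.1.1⟩) +
          ((2 ^ T r.1.1 : ℕ) : ZMod r.1.2) := by
        refine DefZ.add hq ?_ ?_
        · refine DefZ.coeff hq hqs (hm.comp h0)
            (DefZ.sum ((hk.comp h01).add (Def.const 1)) hks1 hq1 hqs1 (DefZ.mul hq2 (DefZ.pow ((hk.comp h02).sub Def.idx') ((hks.comp h02).mono fun _ =>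
              Nat.sub_le _ _) hq2 hqs2 ((hD.comp h02).natCast hq2 hqs2)) ?_))
          have h2' : Def fun r : Ext (fun r : Ext (fun r : Ext (fun r : Ext
              (fun r : ExtPrime Γ A κ => r.1.2) => k r.1.1.1 + 1) => l r.1.1.1.1) =>
                l r.1.1.1.1.1) => r.1.1 := Def.fst Def.fst'
          have h03 := h02.comp h2'
          have hq3 := hq2.comp h2'
          have hqs3 := hqs2.comp h2'
          have hv3 := DefZ.natCast hq3 (f := fun r => r.1.1.1.2) (by fun_prop)
          have hds3 := (hds.comp h03).add (Small.const 1)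
          refine DefZ.matrix_pow (p := fun r : Ext (fun r : Ext (fun r : ExtPrime Γ A κ => r.1.2) =>
              k r.1.1.1 + 1) => r.1.1.1.2) (B := fun r i j => (r.1.2 : ZMod r.1.1.1.2) *
              ∑ t ∈ Finset.range (d r.1.1.1.1 + 1), ((P r.1.1.1.1 i j t : ZMod r.1.1.1.2) -
                N r.1.1.1.1 i j t) * (r.1.2 : ZMod r.1.1.1.2) ^ t) hq2 hqs2 (hl.comp h02) (C := C)
            (fun r => hC r.1.1.1.1) Def.idx' hks1.idx (ha.comp h02) (hb.comp h02) _ _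
            (fun r => ?_) ?_
          · have hA' := (hA r.1.1.1.1).trans_lt r.1.1.2.2
            have hs := r.3
            have : l r.1.1.1.1 * r.2 ≤ l r.1.1.1.1 * k r.1.1.1.1 := Nat.mul_le_mul_left _ (by omega)
            dsimp only at hA'
            omega
          · refine DefZ.mul hq3 hv3 (DefZ.sum ((hd.comp h03).add (Def.const 1)) hds3 hq3 hqs3 ?_)
            have h04 := h03.comp (Def.fst' (g := fun r => d r.1.1.1.1.1.1 + 1))
            have hq4 := hq3.comp (Def.fst' (g := fun r => d r.1.1.1.1.1.1 + 1))
            have hqs4 := hqs3.comp (Def.fst' (g := fun r => d r.1.1.1.1.1.1 + 1))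
            refine DefZ.mul hq4 (DefZ.sub hq4 (Big.natCast ?_ hq4 hqs4) (Big.natCast ?_ hq4 hqs4))
              (DefZ.pow Def.idx' hds3.idx hq4 hqs4 (hv3.comp Def.fst'))
            · exact Big.at_cell hP h04 (by fun_prop) (by fun_prop) Def.idx' (fun r => r.1.1.3)
                (fun r => r.1.3) fun r => r.3
            · exact Big.at_cell hN h04 (by fun_prop) (by fun_prop) Def.idx' (fun r => r.1.1.3)
                (fun r => r.1.3) fun r => r.3
        · refine Big.natCast ?_ hq hqs
          simpa using (Big.const 1).mul_two_pow (hT.comp h0) (hTs.comp h0)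
      refine Def.congr key fun r => ?_
      have hA' := (hA r.1.1).trans_lt r.2.2
      have h3 := hmk r.1.1
      dsimp only at hA'
      have h6 := cast_coeff_clearedSum (q := r.1.2) (l r.1.1) (d r.1.1) (k r.1.1) (D r.1.1)
        (P r.1.1) (N r.1.1) ⟨a r.1.1, hal r.1.1⟩ ⟨b r.1.1, hbl r.1.1⟩ (m r.1.1) (by omega) (by omega)
      rw [← hZ] at h6
      refine congrArg ZMod.val (Eq.trans ?_ (congrArg (· + _) h6))
      have h4 := abs_lt.1 (hZT r.1.1)
      have h5 : (((Z r.1.1 + 2 ^ T r.1.1).toNat : ℤ) : ZMod r.1.2) =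
          ((Z r.1.1 + 2 ^ T r.1.1 : ℤ) : ZMod r.1.2) := by
        rw [Int.toNat_of_nonneg (by linarith)]
      push_cast at h5 ⊢
      exact h5
  have h2 : Big fun γ => 2 ^ T γ := by simpa using (Big.const 1).mul_two_pow hT hTs
  constructor
  · refine ((hbig.truncSub h2).add (h2.truncSub hbig)).congr fun γ => ?_
    have h4 := abs_lt.1 (hZT γ)
    have h5 : ((2 ^ T γ : ℕ) : ℤ) = 2 ^ T γ := by push_cast; rfl
    rw [← h5] at h4 ⊢
    omega
  · refine (hbig.lt h2).congr_iff fun γ => ?_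
    have h4 := abs_lt.1 (hZT γ)
    zify
    omega

end

/-! ### From definable functions to formulas for words -/

section

variable {Γ : Type} [Ctx Γ]

/-- The context with five more variables, that name a bit of a word of polynomial size. -/
abbrev Bits (Γ : Type) [Ctx Γ] (e : ℕ) : Type :=
  Ext fun p : Ext (fun p : Ext (fun p : Ext (fun p : Ext (fun γ : Γ => (Ctx.size γ + 2) ^ e) =>
    (Ctx.size p + 2) ^ e) => (Ctx.size p + 2) ^ e) => (Ctx.size p + 2) ^ e) => (Ctx.size p + 2) ^ e

end

/-! ### Instances of the matrix power problem -/

/-- An instance of the matrix power problem for some `n`, with a code for it. -/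
structure MatPowInput (l d b k : ℕ → ℕ) where
  n : ℕ
  mat : (MatPow (l n) (d n) (b n) (k n)).Instance
  word : Word
  code : (MatPow (l n) (d n) (b n) (k n)).Code mat word

instance {l d b k : ℕ → ℕ} : Ctx (MatPowInput l d b k) where
  dim := 0
  size ω := ω.n
  cst ω := fun p => (![fun n => n, l, d, b, k] : Fin 5 → ℕ → ℕ) p ω.n
  word ω := ω.word
  val _ := Fin.elim0
  cst_zero _ := rfl

theorem snoc_snoc_snoc_snoc_snoc (v : Fin 0 → ℕ) (q : Fin 5 → ℕ) :
    Fin.snoc (α := fun _ => ℕ) (Fin.snoc (α := fun _ => ℕ) (Fin.snoc (α := fun _ => ℕ)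
      (Fin.snoc (α := fun _ => ℕ) (Fin.snoc (α := fun _ => ℕ) v (q 0)) (q 1)) (q 2)) (q 3)) (q 4) =
        q := by
  funext j
  fin_cases j <;> simp [Fin.snoc]

namespace MatPowInput

variable {l d b k : ℕ → ℕ}

/-- An input together with the position of a bit in a universe of
size `(n + 2) ^ f`. -/
def bitPoints (l d b k : ℕ → ℕ) (f : ℕ) : Points 5 where
  pt := {x : MatPowInput l d b k × (Fin 5 → ℕ) // ∀ j, x.2 j < (Ctx.size x.1 + 2) ^ f}
  top x := (Ctx.size x.1.1 + 2) ^ f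
  cst x := Ctx.cst x.1.1
  word x := Ctx.word x.1.1
  val x := x.1.2

theorem exists_bits {e : ℕ} (γ : MatPowInput l d b k) (q : Fin 5 → ℕ)
    (hq : ∀ j, q j < (Ctx.size γ + 2) ^ e) : ∃ p : Bits (MatPowInput l d b k) e,
      p.1.1.1.1.1 = γ ∧ Ctx.val p = q ∧ ![p.1.1.1.1.2, p.1.1.1.2, p.1.1.2, p.1.2, p.2] = q := by
  refine ⟨⟨⟨⟨⟨⟨γ, q 0, hq 0⟩, q 1, hq 1⟩, q 2, hq 2⟩, q 3, hq 3⟩, q 4, hq 4⟩, rfl,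
    snoc_snoc_snoc_snoc_snoc _ q, ?_⟩
  funext j
  fin_cases j <;> rfl

/-- A definable set of bits is the output of a formula, which also says that the positions are less
than `(n + 2) ^ e`: nothing is known about the truth of the formula for `P` at larger positions. -/
theorem exists_formula (e : ℕ) {P : MatPowInput l d b k → (Fin 5 → ℕ) → Prop}
    (hP : Def fun p : Bits (MatPowInput l d b k) e => P p.1.1.1.1.1
        ![p.1.1.1.1.2, p.1.1.1.2, p.1.1.2, p.1.2, p.2]) :
    ∃ (f : ℕ) (φ : Formula 5 4 5), ∀ (γ : MatPowInput l d b k) (O : Fin 4 → Word → Word)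
        (q : Fin 5 → ℕ),
      φ.output ((Ctx.size γ + 2) ^ f) (Ctx.cst γ) (Ctx.word γ) O q ↔
        (∀ j, q j < (Ctx.size γ + 2) ^ e) ∧ P γ q := by
  have hsize : Def fun γ : MatPowInput l d b k => (Ctx.size γ + 2) ^ e := by fun_prop
  obtain ⟨⟨e', he'⟩, -⟩ := def_nat_iff.1 hsize 0
  have hbdd : ∀ γ : MatPowInput l d b k, Ctx.Bounded (MatPowInput l d b k) 0 γ := fun _ i => i.elim0
  have ev := (def_nat_iff.1 hsize 0).2.and ((def_prop_iff.1 hP e).and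
    ((eventually_ge_atTop e').and (eventually_ge_atTop e)))
  obtain ⟨f, hf, ⟨φ, hφ⟩, hf₁, hef⟩ := ev.exists
  have hf' : (bitPoints l d b k f).RepG fun x => (Ctx.size x.1.1 + 2) ^ e :=
    Points.RepG.pullback (S := Ctx.points (MatPowInput l d b k) 0 f) (S' := bitPoints l d b k f)
      (fun x => ⟨x.1.1, hbdd x.1.1⟩) (fun i => i.elim0) (fun _ => rfl) (fun _ => rfl)
      (fun _ => rfl) (fun _ i => i.elim0) hf
  have hlt : ∀ j, (bitPoints l d b k f).Rep fun x => x.1.2 j < (Ctx.size x.1.1 + 2) ^ e := fun j =>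
    Points.Rep.subst (.not (.le 1 0)) (S := bitPoints l d b k f)
      ![fun x => x.1.2 j, fun x => (Ctx.size x.1.1 + 2) ^ e]
      (Fin.forall_fin_two.2 ⟨Points.RepG.var j, hf'⟩) (Fin.forall_fin_two.2 ⟨fun x => x.2 j,
        fun x => (he' x.1.1 (hbdd _)).trans_le (pow_le_pow_size _ hf₁)⟩)
      fun x O => by simp [Formula.Holds]
  obtain ⟨ψ, hψ⟩ := (((((hlt 0).and (hlt 1)).and (hlt 2)).and (hlt 3)).and (hlt 4))
  refine ⟨f, .and ψ φ, fun γ O q => ?_⟩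
  have hall : (∀ j, q j < (Ctx.size γ + 2) ^ e) ↔ ((((q 0 < (Ctx.size γ + 2) ^ e ∧
      q 1 < (Ctx.size γ + 2) ^ e) ∧ q 2 < (Ctx.size γ + 2) ^ e) ∧ q 3 < (Ctx.size γ + 2) ^ e) ∧
        q 4 < (Ctx.size γ + 2) ^ e) := by
    refine ⟨fun h => ⟨⟨⟨⟨h 0, h 1⟩, h 2⟩, h 3⟩, h 4⟩, fun h j => ?_⟩
    fin_cases j
    exacts [h.1.1.1.1, h.1.1.1.2, h.1.1.2, h.1.2, h.2]
  have key : (∀ j, q j < (Ctx.size γ + 2) ^ f) → (∀ j, q j < (Ctx.size γ + 2) ^ e) →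
      (φ.Holds ((Ctx.size γ + 2) ^ f) (Ctx.cst γ) (Ctx.word γ) O q ↔ P γ q) := fun _ hqe => by
    obtain ⟨p, rfl, hval, hq⟩ := exists_bits γ q hqe
    have h2 := hφ ⟨p, fun j => (congrFun hval j).trans_lt (hqe j)⟩ O
    refine Iff.trans (iff_of_eq (congrArg (φ.Holds _ _ _ _) hval.symm)) (h2.trans ?_)
    exact iff_of_eq (congrArg (P _) hq)
  constructor
  · rintro ⟨hq, h1, h2⟩
    have h3 := hall.2 ((hψ ⟨(γ, q), hq⟩ O).1 h1)
    exact ⟨h3, (key hq h3).1 h2⟩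
  · rintro ⟨hq, h⟩
    have hq' : ∀ j, q j < (Ctx.size γ + 2) ^ f := fun j => (hq j).trans_le (pow_le_pow_size _ hef)
    refine ⟨hq', (hψ ⟨(γ, q), hq'⟩ O).2 (hall.1 hq), (key hq' hq).2 h⟩

/-- The fraction in the cell `(i, j, m)` of the input, and a junk value if there is no such cell. -/
def entry (ω : MatPowInput l d b k) (i j m : ℕ) : ℤ × ℕ :=
  if h : i < l ω.n ∧ j < l ω.n ∧ m < d ω.n + 1 then
    (ω.mat.1 ⟨i, h.1⟩ ⟨j, h.2.1⟩ ⟨m, h.2.2⟩).pair else (0, 1)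

/-- The positive parts of the numerators over the common denominator. -/
def posNum (ω : MatPowInput l d b k) (i j m : ℕ) : ℕ :=
  (ω.entry i j m).1.toNat * cofactor (l ω.n) (d ω.n) (fun i j m => (ω.entry i j m).2) i j m

/-- The negative parts that belong to `posNum`. -/
def negNum (ω : MatPowInput l d b k) (i j m : ℕ) : ℕ :=
  (-(ω.entry i j m).1).toNat * cofactor (l ω.n) (d ω.n) (fun i j m => (ω.entry i j m).2) i j m

/-- The common denominator of the entries of the input. -/
def den (ω : MatPowInput l d b k) : ℕ := denominator (l ω.n) (d ω.n) fun i j m => (ω.entry i j m).2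

/-- The numerator of the coefficient `m` of the entry `(i, j)` of the output, whose denominator is
`ω.den ^ k ω.n`. -/
noncomputable def num (ω : MatPowInput l d b k) (i j m : ℕ) : ℤ :=
  if h : i < l ω.n ∧ j < l ω.n then
    (clearedSum (ω.den : ℤ) (shiftedMatrix (l ω.n) (d ω.n) fun i j m =>
      (ω.posNum i j m : ℤ) - ω.negNum i j m) (k ω.n) ⟨i, h.1⟩ ⟨j, h.2⟩).coeff m else 0

theorem entry_of_lt (ω : MatPowInput l d b k) (i j : Fin (l ω.n)) (m : Fin (d ω.n + 1)) :
    ω.entry i j m = (ω.mat.1 i j m).pair := by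
  exact dif_pos ⟨i.2, j.2, m.2⟩

theorem entry_den_pos (ω : MatPowInput l d b k) (i j m : ℕ) : 0 < (ω.entry i j m).2 := by
  rw [entry]
  split_ifs with h
  · have := (ω.mat.1 ⟨i, h.1⟩ ⟨j, h.2.1⟩ ⟨m, h.2.2⟩).abs_num_lt
    exact_mod_cast (abs_nonneg _).trans_lt this
  · exact Nat.one_pos

theorem den_pos (ω : MatPowInput l d b k) : 0 < ω.den := by
  unfold den denominator
  exact Finset.prod_pos fun i _ => Finset.prod_pos fun j _ => Finset.prod_pos fun m _ =>
    ω.entry_den_pos i j m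

theorem posNum_sub_negNum (ω : MatPowInput l d b k) (i j : Fin (l ω.n)) (m : Fin (d ω.n + 1)) :
    (((ω.posNum i j m : ℤ) - ω.negNum i j m : ℤ) : ℚ) = ω.den * (ω.mat.1 i j m).val := by
  have h1 := mul_cofactor (fun i j m => (ω.entry i j m).2) i.2 j.2 m.2
  have h2 : ((ω.posNum i j m : ℤ) - ω.negNum i j m : ℤ) = (ω.entry i j m).1 *
      cofactor (l ω.n) (d ω.n) (fun i j m => (ω.entry i j m).2) i j m := by
    rw [posNum, negNum, Nat.cast_mul, Nat.cast_mul, ← sub_mul]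
    congr 1
    omega
  have h3 : ((ω.entry i j m).2 : ℚ) ≠ 0 := by exact_mod_cast (ω.entry_den_pos i j m).ne'
  have h4 : (ω.mat.1 i j m).val = (ω.entry i j m).1 / (ω.entry i j m).2 := by
    rw [entry_of_lt]; rfl
  rw [h2, h4, den, ← h1]
  push_cast
  field_simp

/-- The fractions `ω.num i j m / ω.den ^ k` are the coefficients that are to be computed. -/
theorem num_div (ω : MatPowInput l d b k) (i j : Fin (l ω.n)) (m : ℕ) :
    ((∑ s ∈ Finset.range (k ω.n + 1), ((X : ℚ[X]) • polyMatrix ω.mat.1) ^ s) i j).coeff m =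
      (ω.num i j m : ℚ) / ((ω.den ^ k ω.n : ℕ) : ℚ) := by
  have h1 : (mapRingHom (Int.castRingHom ℚ)).mapMatrix (shiftedMatrix (l ω.n) (d ω.n) fun i j m =>
      (ω.posNum i j m : ℤ) - ω.negNum i j m) =
        C (ω.den : ℚ) • ((X : ℚ[X]) • polyMatrix ω.mat.1) := by
    rw [map_shiftedMatrix]
    refine Matrix.ext fun i j => ?_
    simp only [shiftedMatrix, polyMatrix, polyOf, Matrix.smul_apply, Matrix.of_apply, smul_eq_mul,
      Finset.sum_range, eq_intCast, posNum_sub_negNum, C_mul]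
    rw [mul_left_comm, Finset.mul_sum (a := C (ω.den : ℚ))]
    simp only [mul_assoc]
  have h2 : (ω.num i j m : ℚ) = (ω.den : ℚ) ^ k ω.n *
      ((∑ s ∈ Finset.range (k ω.n + 1), ((X : ℚ[X]) • polyMatrix ω.mat.1) ^ s) i j).coeff m := by
    rw [num, dif_pos ⟨i.2, j.2⟩, ← eq_intCast (Int.castRingHom ℚ), ← coeff_map, clearedSum_map, h1,
      eq_intCast, Int.cast_natCast, clearedSum_smul, Matrix.smul_apply, smul_eq_mul, coeff_C_mul]
  have h3 : (ω.den : ℚ) ≠ 0 := by exact_mod_cast ω.den_pos.ne'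
  rw [h2, Nat.cast_pow, mul_div_cancel_left₀ _ (pow_ne_zero _ h3)]

end MatPowInput

/-! ### The output of the matrix power problem -/

theorem Def.input_vec {Γ : Type} [Ctx Γ] {x₀ x₁ x₂ x₃ x₄ : Γ → ℕ} (h₀ : Def x₀) (h₁ : Def x₁)
    (h₂ : Def x₂) (h₃ : Def x₃) (h₄ : Def x₄) :
    Def fun γ => Ctx.word γ ![x₀ γ, x₁ γ, x₂ γ, x₃ γ, x₄ γ] := by
  refine (Def.input (x := ![x₀, x₁, x₂, x₃, x₄]) fun j => ?_).congr fun γ => ?_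
  · fin_cases j <;> assumption
  · refine congrArg (Ctx.word γ) (funext fun j => ?_)
    fin_cases j <;> rfl

namespace MatPowInput

variable {l d b k : ℕ → ℕ}

theorem def_cst (c : Fin 5) {g : ℕ → ℕ} (hg : ∃ e, ∀ n, g n ≤ (n + 2).size ^ e)
    (hc : (![fun n => n, l, d, b, k] : Fin 5 → ℕ → ℕ) c = g) :
    Def fun ω : MatPowInput l d b k => g ω.n := by
  obtain ⟨e, he⟩ := hg
  subst hc
  refine Def.cst c ⟨e + 1, fun ω => ?_⟩
  have h1 : (ω.n + 2).size ≤ ω.n + 2 := Nat.size_le.2 Nat.lt_two_pow_self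
  calc _ ≤ (ω.n + 2).size ^ e := he ω.n
    _ ≤ (ω.n + 2) ^ e := Nat.pow_le_pow_left h1 e
    _ < (ω.n + 2) ^ (e + 1) := Nat.pow_lt_pow_right (by omega) (Nat.lt_succ_self e)

theorem small_cst {g : ℕ → ℕ} (hg : ∃ e, ∀ n, g n ≤ (n + 2).size ^ e) :
    Small fun ω : MatPowInput l d b k => g ω.n :=
  hg.imp fun _ he ω => he ω.n

theorem stores_entry (ω : MatPowInput l d b k) {i j m : ℕ} (hi : i < l ω.n) (hj : j < l ω.n)
    (hm : m < d ω.n + 1) : Stores ω.word i j m (ω.entry i j m) := by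
  rw [entry, dif_pos ⟨hi, hj, hm⟩]
  exact ω.code ⟨i, hi⟩ ⟨j, hj⟩ ⟨m, hm⟩

theorem entry_lt (ω : MatPowInput l d b k) (i j m : ℕ) :
    (ω.entry i j m).1.natAbs < 2 ^ (b ω.n + 1) ∧ (ω.entry i j m).2 < 2 ^ (b ω.n + 1) := by
  have h2 : 2 ^ b ω.n < 2 ^ (b ω.n + 1) := Nat.pow_lt_pow_right (by omega) (Nat.lt_succ_self _)
  rw [entry]
  split_ifs with h
  · have h1 := (ω.mat.1 ⟨i, h.1⟩ ⟨j, h.2.1⟩ ⟨m, h.2.2⟩).abs_num_lt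
    have h3 := (ω.mat.1 ⟨i, h.1⟩ ⟨j, h.2.1⟩ ⟨m, h.2.2⟩).den_le
    rw [Int.abs_eq_natAbs] at h1
    simp only [BitRat.pair]
    omega
  · exact ⟨by positivity, Nat.one_lt_two_pow (by omega)⟩

/-- The context of the cells of the input. -/
abbrev InputCells (l d b k : ℕ → ℕ) : Type :=
  Cells (fun ω : MatPowInput l d b k => l ω.n) fun ω => d ω.n

/-- The context of the cells of the output. -/
abbrev OutputCells (l d b k : ℕ → ℕ) : Type :=
  Cells (fun ω : MatPowInput l d b k => l ω.n) fun ω => k ω.n * (d ω.n + 1)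

theorem stores_cell (c : InputCells l d b k) : Stores (Ctx.word c) c.1.1.2 c.1.2 c.2
    (c.1.1.1.entry c.1.1.2 c.1.2 c.2) :=
  c.1.1.1.stores_entry c.1.1.3 c.1.3 c.3

theorem def_input_bit (tag e : ℕ) : Def fun p : Ext (fun c : InputCells l d b k => Ctx.len c ^ e) =>
    Ctx.word p ![tag, p.1.1.1.2, p.1.1.2, p.1.2, p.2] :=
  Def.input_vec (Def.const tag) (by fun_prop) (by fun_prop) (by fun_prop) (by fun_prop)

theorem def_input_sign : Def fun c : InputCells l d b k =>
    (c.1.1.1.entry c.1.1.2 c.1.2 c.2).1 < 0 :=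
  (Def.input_vec (x₀ := fun _ => 0) (x₁ := fun c => c.1.1.2) (x₂ := fun c => c.1.2)
    (x₃ := fun c => c.2) (x₄ := fun _ => 0) (by fun_prop) (by fun_prop) (by fun_prop)
    (by fun_prop) (by fun_prop)).congr_iff fun c => (stores_cell c).1.symm

theorem small_entry (hb : ∃ e, ∀ n, b n ≤ (n + 2).size ^ e) :
    Small fun c : InputCells l d b k => b c.1.1.1.n + 1 :=
  ((small_cst hb).comp Def.cell_fst).add (Small.const 1)

theorem big_entry_den (hb : ∃ e, ∀ n, b n ≤ (n + 2).size ^ e) :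
    Big fun c : InputCells l d b k => (c.1.1.1.entry c.1.1.2 c.1.2 c.2).2 :=
  Big.of_testBit (small_entry hb) (fun c => (c.1.1.1.entry_lt _ _ _).2) fun e =>
    (def_input_bit 2 e).congr_iff fun p => ((stores_cell p.1).2.2 p.2).symm

theorem big_entry_natAbs (hb : ∃ e, ∀ n, b n ≤ (n + 2).size ^ e) :
    Big fun c : InputCells l d b k => (c.1.1.1.entry c.1.1.2 c.1.2 c.2).1.natAbs :=
  Big.of_testBit (small_entry hb) (fun c => (c.1.1.1.entry_lt _ _ _).1) fun e =>
    (def_input_bit 1 e).congr_iff fun p => ((stores_cell p.1).2.1 p.2).symm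

theorem big_cofactor (hl : ∃ e, ∀ n, l n ≤ (n + 2).size ^ e)
    (hd : ∃ e, ∀ n, d n ≤ (n + 2).size ^ e) (hb : ∃ e, ∀ n, b n ≤ (n + 2).size ^ e) :
    Big fun c : InputCells l d b k => cofactor (l c.1.1.1.n) (d c.1.1.1.n)
      (fun i j m => (c.1.1.1.entry i j m).2) c.1.1.2 c.1.2 c.2 := by
  have hc : Def fun c : InputCells l d b k => c.1.1.1 := Def.cell_fst
  refine Big.cofactor ((def_cst 1 hl rfl).comp hc) ((small_cst hl).comp hc)
    ((def_cst 2 hd rfl).comp hc) ((small_cst hd).comp hc) (by fun_prop) (by fun_prop) (by fun_prop)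
    (β := fun c i j m => (c.1.1.1.entry i j m).2) ?_
  exact Big.comp_cell (x := fun ω i j m => (ω.entry i j m).2) (big_entry_den hb) hc

theorem big_posNum (hl : ∃ e, ∀ n, l n ≤ (n + 2).size ^ e)
    (hd : ∃ e, ∀ n, d n ≤ (n + 2).size ^ e) (hb : ∃ e, ∀ n, b n ≤ (n + 2).size ^ e) :
    Big fun c : InputCells l d b k => c.1.1.1.posNum c.1.1.2 c.1.2 c.2 := by
  refine Big.mul ?_ (big_cofactor hl hd hb)
  refine (Big.ite (Big.const 0) (big_entry_natAbs hb) def_input_sign).congr fun c => ?_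
  split_ifs <;> omega

theorem big_negNum (hl : ∃ e, ∀ n, l n ≤ (n + 2).size ^ e)
    (hd : ∃ e, ∀ n, d n ≤ (n + 2).size ^ e) (hb : ∃ e, ∀ n, b n ≤ (n + 2).size ^ e) :
    Big fun c : InputCells l d b k => c.1.1.1.negNum c.1.1.2 c.1.2 c.2 := by
  refine Big.mul ?_ (big_cofactor hl hd hb)
  refine (Big.ite (big_entry_natAbs hb) (Big.const 0) def_input_sign).congr fun c => ?_
  split_ifs <;> omega

theorem big_den (hl : ∃ e, ∀ n, l n ≤ (n + 2).size ^ e)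
    (hd : ∃ e, ∀ n, d n ≤ (n + 2).size ^ e) (hb : ∃ e, ∀ n, b n ≤ (n + 2).size ^ e) :
    Big fun ω : MatPowInput l d b k => ω.den :=
  Big.denominator (def_cst 1 hl rfl) (small_cst hl) (def_cst 2 hd rfl) (small_cst hd)
    (big_entry_den hb)

theorem big_den_pow (hl : ∃ e, ∀ n, l n ≤ (n + 2).size ^ e)
    (hd : ∃ e, ∀ n, d n ≤ (n + 2).size ^ e) (hb : ∃ e, ∀ n, b n ≤ (n + 2).size ^ e)
    (hk : ∃ e, ∀ n, k n ≤ (n + 2).size ^ e) :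
    Big fun ω : MatPowInput l d b k => ω.den ^ k ω.n := by
  have := Big.prod (x := fun ω _ => ω.den) (def_cst 4 hk rfl) (small_cst hk)
    ((big_den (k := k) hl hd hb).comp Def.fst')
  simpa using this

theorem num_of_lt (ω : MatPowInput l d b k) {i j : ℕ} (hi : i < l ω.n) (hj : j < l ω.n) (m : ℕ) :
    ω.num i j m = (clearedSum (ω.den : ℤ) (shiftedMatrix (l ω.n) (d ω.n) fun i j m =>
      (ω.posNum i j m : ℤ) - ω.negNum i j m) (k ω.n) ⟨i, hi⟩ ⟨j, hj⟩).coeff m :=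
  dif_pos ⟨hi, hj⟩

theorem big_num {C : ℕ} (hC : ∀ n, (n + 2).size.size * (l n + 1) ≤ C * (n + 2).size)
    (hl : ∃ e, ∀ n, l n ≤ (n + 2).size ^ e)
    (hd : ∃ e, ∀ n, d n ≤ (n + 2).size ^ e) (hb : ∃ e, ∀ n, b n ≤ (n + 2).size ^ e)
    (hk : ∃ e, ∀ n, k n ≤ (n + 2).size ^ e) :
    (Big fun c : OutputCells l d b k => (c.1.1.1.num c.1.1.2 c.1.2 c.2).natAbs) ∧
      Def fun c : OutputCells l d b k => c.1.1.1.num c.1.1.2 c.1.2 c.2 < 0 := by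
  have hc : Def fun c : OutputCells l d b k => c.1.1.1 := Def.cell_fst
  refine Big.clearedSum (D := fun c => c.1.1.1.den) (P := fun c => c.1.1.1.posNum)
    (N := fun c => c.1.1.1.negNum) ((def_cst 1 hl rfl).comp hc) ((small_cst hl).comp hc) (C := C)
    (fun c => hC c.1.1.1.n) ((def_cst 2 hd rfl).comp hc) ((small_cst hd).comp hc)
    ((def_cst 4 hk rfl).comp hc) ((small_cst hk).comp hc) (Def.idx (Def.fst Def.fst'))
    (Def.idx Def.fst') Def.idx'
    (fun c => c.1.1.3) (fun c => c.1.3) (fun c => Nat.lt_succ_iff.1 c.3)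
    ((big_den hl hd hb).comp hc) ?_ ?_ fun c =>
      num_of_lt c.1.1.1 c.1.1.3 c.1.3 c.2
  · exact Big.comp_cell (x := fun ω => ω.posNum) (big_posNum hl hd hb) hc
  · exact Big.comp_cell (x := fun ω => ω.negNum) (big_negNum hl hd hb) hc

/-- The cell `(i, j, m)` belongs to the output. -/
def IsOutputCell (ω : MatPowInput l d b k) (i j m : ℕ) : Prop :=
  i < l ω.n ∧ j < l ω.n ∧ m < k ω.n * (d ω.n + 1) + 1

/-- The bit at the position `(tag, i, j, m, t)` of the output. -/
def OutputBit (ω : MatPowInput l d b k) (tag i j m t : ℕ) : Prop :=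
  (tag = 0 ∧ t = 0 ∧ ω.num i j m < 0) ∨ (tag = 1 ∧ (ω.num i j m).natAbs.testBit t = true) ∨
    (tag = 2 ∧ (ω.den ^ k ω.n).testBit t = true)

theorem def_isOutputCell {Γ : Type} [Ctx Γ] {h : Γ → MatPowInput l d b k} {i j m : Γ → ℕ}
    (hl : ∃ e, ∀ n, l n ≤ (n + 2).size ^ e) (hd : ∃ e, ∀ n, d n ≤ (n + 2).size ^ e)
    (hk : ∃ e, ∀ n, k n ≤ (n + 2).size ^ e) (hh : Def h) (hi : Def i) (hj : Def j) (hm : Def m) :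
    Def fun γ => IsOutputCell (h γ) (i γ) (j γ) (m γ) := by
  have hl' := (def_cst 1 hl rfl).comp hh
  have hd' := (def_cst 2 hd rfl).comp hh
  have hk' := (def_cst 4 hk rfl).comp hh
  exact (hi.lt hl').and ((hj.lt hl').and
    (hm.lt ((hk'.mul (hd'.add (Def.const 1))).add (Def.const 1))))

theorem def_outputBit {Γ : Type} [Ctx Γ] {h : Γ → MatPowInput l d b k} {tag i j m t : Γ → ℕ} {C : ℕ}
    (hC : ∀ n, (n + 2).size.size * (l n + 1) ≤ C * (n + 2).size)
    (hl : ∃ e, ∀ n, l n ≤ (n + 2).size ^ e) (hd : ∃ e, ∀ n, d n ≤ (n + 2).size ^ e)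
    (hb : ∃ e, ∀ n, b n ≤ (n + 2).size ^ e) (hk : ∃ e, ∀ n, k n ≤ (n + 2).size ^ e)
    (hh : Def h) (htag : Def tag) (hi : Def i) (hj : Def j) (hm : Def m) (ht : Def t)
    (hc : ∀ γ, IsOutputCell (h γ) (i γ) (j γ) (m γ)) :
    Def fun γ => OutputBit (h γ) (tag γ) (i γ) (j γ) (m γ) (t γ) := by
  obtain ⟨hnum, hsign⟩ := big_num hC hl hd hb hk
  refine ((htag.eq (Def.const 0)).and ((ht.eq (Def.const 0)).and ?_)).or
    (((htag.eq (Def.const 1)).and ?_).or ((htag.eq (Def.const 2)).and ?_))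
  · exact Def.at_cell (F := fun ω i j m => ω.num i j m < 0) hsign hh hi hj hm (fun γ => (hc γ).1)
      (fun γ => (hc γ).2.1) fun γ => (hc γ).2.2
  · exact (Big.at_cell (x := fun ω i j m => (ω.num i j m).natAbs) hnum hh hi hj hm
      (fun γ => (hc γ).1) (fun γ => (hc γ).2.1) fun γ => (hc γ).2.2).testBit ht
  · exact ((big_den_pow hl hd hb hk).comp hh).testBit ht

theorem def_output {C : ℕ} (hC : ∀ n, (n + 2).size.size * (l n + 1) ≤ C * (n + 2).size)
    (hl : ∃ e, ∀ n, l n ≤ (n + 2).size ^ e) (hd : ∃ e, ∀ n, d n ≤ (n + 2).size ^ e)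
    (hb : ∃ e, ∀ n, b n ≤ (n + 2).size ^ e) (hk : ∃ e, ∀ n, k n ≤ (n + 2).size ^ e) (e : ℕ) :
    Def fun p : Bits (MatPowInput l d b k) e => IsOutputCell p.1.1.1.1.1 p.1.1.1.2 p.1.1.2 p.1.2 ∧
      OutputBit p.1.1.1.1.1 p.1.1.1.1.2 p.1.1.1.2 p.1.1.2 p.1.2 p.2 := by
  have h0 : Def fun p : Bits (MatPowInput l d b k) e => p := Def.id
  have h4 := h0.fst.fst.fst.fst
  exact Def.and_subtype (def_isOutputCell hl hd hk h4.fst h0.fst.fst.fst.idx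
      h0.fst.fst.idx h0.fst.idx)
    (def_outputBit hC hl hd hb hk (h4.fst.comp (Def.val' Def.id)) (h4.idx.comp (Def.val' Def.id))
      (h0.fst.fst.fst.idx.comp (Def.val' Def.id)) (h0.fst.fst.idx.comp (Def.val' Def.id))
      (h0.fst.idx.comp (Def.val' Def.id)) (h0.idx.comp (Def.val' Def.id)) fun p => p.2)

/-- A word stores the fractions `ω.num i j m / ω.den ^ k` if it has the bits of the output, up to a
bound that exceeds all positions of ones. -/
theorem stores_of_iff {ω : MatPowInput l d b k} {w : Word} {N i j m : ℕ} (h2 : 2 < N)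
    (hi : i < N) (hj : j < N) (hm : m < N) (hnum : (ω.num i j m).natAbs < 2 ^ N)
    (hden : ω.den ^ k ω.n < 2 ^ N) (hc : IsOutputCell ω i j m)
    (hw : ∀ q, w q ↔ (∀ s, q s < N) ∧ IsOutputCell ω (q 1) (q 2) (q 3) ∧
      OutputBit ω (q 0) (q 1) (q 2) (q 3) (q 4)) :
    Stores w i j m (ω.num i j m, ω.den ^ k ω.n) := by
  have hq : ∀ tag t : ℕ, tag < N → (w ![tag, i, j, m, t] ↔ t < N ∧ OutputBit ω tag i j m t) := by
    intro tag t htag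
    refine (hw _).trans ⟨fun h => ⟨h.1 4, h.2.2⟩, fun h => ⟨fun s => ?_, hc, h.2⟩⟩
    fin_cases s
    exacts [htag, hi, hj, hm, h.1]
  have hbit : ∀ {x t : ℕ}, x < 2 ^ N → x.testBit t = true → t < N := fun {x t} hx ht => by
    by_contra! hNt
    rw [Nat.testBit_lt_two_pow (hx.trans_le (Nat.pow_le_pow_right (by omega) hNt))] at ht
    exact Bool.false_ne_true ht
  refine ⟨(hq 0 0 (by omega)).trans ?_, fun t => (hq 1 t (by omega)).trans ?_,
    fun t => (hq 2 t h2).trans ?_⟩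
  · simp [OutputBit]; omega
  · simpa [OutputBit] using hbit hnum
  · simpa [OutputBit] using hbit hden

end MatPowInput

/-- The matrix power problem is definable without queries, so it is reducible to any problems. -/
theorem reduces_matPow (Q : Fin 4 → ℕ → Problem) {l d b k : ℕ → ℕ} {C : ℕ}
    (hC : ∀ n, (n + 2).size.size * (l n + 1) ≤ C * (n + 2).size)
    (hl : ∃ e, ∀ n, l n ≤ (n + 2).size ^ e) (hd : ∃ e, ∀ n, d n ≤ (n + 2).size ^ e)
    (hb : ∃ e, ∀ n, b n ≤ (n + 2).size ^ e) (hk : ∃ e, ∀ n, k n ≤ (n + 2).size ^ e) :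
    Reduces ![fun n => n, l, d, b, k] (fun n => MatPow (l n) (d n) (b n) (k n)) Q := by
  intro _
  -- The positions of ones in the output are polynomially bounded.
  have hbound : ∃ e, ∀ ω : MatPowInput l d b k, 2 < (ω.n + 2) ^ e ∧ l ω.n < (ω.n + 2) ^ e ∧
      k ω.n * (d ω.n + 1) + 1 < (ω.n + 2) ^ e ∧ (∀ i < l ω.n, ∀ j < l ω.n,
        ∀ m < k ω.n * (d ω.n + 1) + 1, (ω.num i j m).natAbs < 2 ^ (ω.n + 2) ^ e) ∧
      ω.den ^ k ω.n < 2 ^ (ω.n + 2) ^ e := by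
    obtain ⟨e₁, h₁⟩ : Small fun ω : MatPowInput l d b k =>
        2 + (l ω.n + (k ω.n * (d ω.n + 1) + 1)) :=
      (Small.const 2).add ((MatPowInput.small_cst hl).add (((MatPowInput.small_cst hk).mul
        ((MatPowInput.small_cst hd).add (Small.const 1))).add (Small.const 1)))
    obtain ⟨e₂, h₂, -⟩ := (MatPowInput.big_num hC hl hd hb hk).1
    obtain ⟨e₃, h₃, -⟩ := MatPowInput.big_den_pow (k := k) hl hd hb hk
    refine ⟨e₁ + e₂ + e₃ + 1, fun ω => ?_⟩
    have hlen : ∀ e ≤ e₁ + e₂ + e₃, (ω.n + 2).size ^ e < (ω.n + 2) ^ (e₁ + e₂ + e₃ + 1) :=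
      fun e he => calc (ω.n + 2).size ^ e
          _ ≤ (ω.n + 2) ^ e := Nat.pow_le_pow_left (Nat.size_le.2 Nat.lt_two_pow_self) e
          _ < _ := Nat.pow_lt_pow_right (by omega) (by omega)
    have h := (h₁ ω).trans_lt (hlen e₁ (by omega))
    dsimp only at h
    refine ⟨by omega, by omega, by omega, fun i hi j hj m hm => ?_, ?_⟩
    · exact (h₂ ⟨⟨⟨ω, i, hi⟩, j, hj⟩, m, hm⟩).trans
        (Nat.pow_lt_pow_right (by omega) (hlen e₂ (by omega)))
    · exact (h₃ ω).trans (Nat.pow_lt_pow_right (by omega) (hlen e₃ (by omega)))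
  obtain ⟨e, he⟩ := hbound
  obtain ⟨f, φ, hφ⟩ := MatPowInput.exists_formula e (P := fun ω q =>
    ω.IsOutputCell (q 1) (q 2) (q 3) ∧ ω.OutputBit (q 0) (q 1) (q 2) (q 3) (q 4))
    (MatPowInput.def_output hC hl hd hb hk e)
  refine ⟨f, φ, fun n O _ A w hA i j m hm => ?_⟩
  obtain ⟨h2, hle, hme, hnum, hden⟩ := he ⟨n, A, w, hA⟩
  refine ⟨(MatPowInput.num ⟨n, A, w, hA⟩ i j m, MatPowInput.den ⟨n, A, w, hA⟩ ^ k n),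
    Nat.pow_pos (MatPowInput.den_pos ⟨n, A, w, hA⟩),
    MatPowInput.num_div ⟨n, A, w, hA⟩ i j m, ?_⟩
  exact MatPowInput.stores_of_iff h2 (i.2.trans hle) (j.2.trans hle)
    ((Nat.lt_succ_of_le hm).trans hme) (hnum i i.2 j j.2 m (Nat.lt_succ_of_le hm)) hden
    ⟨i.2, j.2, Nat.lt_succ_of_le hm⟩ (hφ ⟨n, A, w, hA⟩ O)

end ACZero

theorem mainTheorem4 (l d b k : ℕ → ℕ)
    (hl : (fun n : ℕ => (l n : ℝ)) =O[Filter.atTop]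
      fun n : ℕ => Real.log (n : ℝ) / Real.log (Real.log (n : ℝ)))
    (hk : (fun n : ℕ => (k n : ℝ)) =O[Filter.atTop] fun n : ℕ => Real.log (n : ℝ))
    (hb : ∃ C : ℕ, (fun n : ℕ => (b n : ℝ)) =O[Filter.atTop] fun n : ℕ => Real.log (n : ℝ) ^ C)
    (hd : ∃ C : ℕ, (fun n : ℕ => (d n : ℝ)) =O[Filter.atTop] fun n : ℕ => Real.log (n : ℝ) ^ C) :
    ACZero.Reduces ![fun n => n, l, d, b, k]
      (fun n => ACZero.MatPow (l n) (d n) (b n) (k n))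
      ![fun n => ACZero.MatPow (l n) 0 (l n * b n) (l n),
        fun n => ACZero.DetPoly (l n) 1 (l n * b n + 2 * k n ^ 2 * d n),
        fun n => ACZero.Interpolate (d n * k n)
          (k n * l n ^ 2 * b n + k n ^ 3 * l n * d n),
        fun n => ACZero.Div (k n) (l n) (l n ^ 2 * b n + 2 * k n ^ 2 * l n * d n)] := by
  obtain ⟨C, hC⟩ := ACZero.exists_size_mul_le hl
  refine ACZero.reduces_matPow _ hC ⟨C + 1, fun n => ?_⟩ (ACZero.exists_le_size_pow hd)
    (ACZero.exists_le_size_pow hb) (ACZero.exists_le_size_pow ⟨1, by simpa using hk⟩)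
  have h2 : 2 ≤ (n + 2).size := Nat.lt_size.2 (by omega)
  have h1 : 0 < (n + 2).size.size := Nat.size_pos.2 (by omega)
  calc l n ≤ C * (n + 2).size := le_trans (by nlinarith) (hC n)
    _ ≤ (n + 2).size ^ C * (n + 2).size := Nat.mul_le_mul_right _
        (Nat.lt_two_pow_self.le.trans (Nat.pow_le_pow_left h2 C))
    _ = _ := (pow_succ _ _).symm
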